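/- Let $\mathcal K$ be the space of complex Borel measures $V$ on $\mathbb R^3$ of locally bounded variation with $$\|V\|_{\mathcal K}=\sup_{y\in\mathbb R^3}\int_{\mathbb R^3}\frac{d|V|(x)}{|x-y|}<\infty ,$$ locally integrable functions $V$ being identified with the measures $V\,dx$. Let $\mathcal K_0$ be the closure of $C_c^\infty(\mathbb R^3)$ in $\mathcal K$. Say that $V$ has the local Kato property if $\lim_{\epsilon\to0}\sup_y\int_{|x-y|<\epsilon}\frac{d|V|(x)}{|x-y|}=0$, and let $\mathcal K_1$ be the set of $V\in\mathcal K$ having the local Kato property and the modified distal Kato property $\lim_{R\to\infty}\sup_y\int_{|x|>R}\frac{d|V|(x)}{|x-y|}=0$. Let $V\in\mathcal K$ be real-valued and suppose that $V$ has the local Kato property (in particular, $V$ may be in $\mathcal K_0$ or in $\mathcal K_1$). Let $H=-\Delta+V$ be the operator on $L^2(\mathbb R^3)$ associated with the quadratic form of $-\Delta+V$: $Hu=f$ means that $u\in H^1$, $f\in L^2$ and $q(u,\psi)=\int f\bar\psi\,dx$ for all $\psi\in C_c^\infty$, where $q(u,\psi)$ is the extension by continuity in $u\in H^1$ of $\int\nabla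 u\cdot\nabla\bar\psi\,dx+\int u\bar\psi\,dV$ from $u\in C_c^\infty$. Then: (i) $H$ is a well-defined operator, and its spectrum is real and bounded from below: there is $c\in\mathbb R$ such that $\sigma(H)\subset[c,\infty)$. (ii) Let $R_0(\lambda)=(-\Delta-\lambda)^{-1}$ be the free resolvent, with kernel $\frac{e^{-\sqrt{-\lambda}\,|x-y|}}{4\pi|x-y|}$ (principal square root). There is $a_0\ge0$ such that for every $\lambda\in\mathbb C$ with $\operatorname{Re}\sqrt{-\lambda}>a_0$ (in particular, for every real $\lambda<-a_0^2$), $VR_0(\lambda)$ is a bounded operator of norm less than $1$ both on the space $\mathcal M$ of finite complex Borel measures with the total variation norm and on $\mathcal K$, and on each of these two spaces $I+VR_0(\lambda)$ has a bounded inverse, given by the Born series $\sum_{n\ge0}(-VR_0(\lambda))^n$, which converges in operator norm. -/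

import Mathlib

open MeasureTheory Filter Topology
open scoped ENNReal ComplexConjugate

namespace KatoSchrodinger

noncomputable section

/-- Euclidean three-space. -/
abbrev R3 : Type := EuclideanSpace ℝ (Fin 3)

/-! ### Locally finite complex measures -/

/-- The total variation of a complex measure is finite. -/
theorem isFiniteMeasure_variation (c : ComplexMeasure R3) : IsFiniteMeasure c.variation := by
  have h : c.variation ≤ (ComplexMeasure.re c).totalVariation
      + (ComplexMeasure.im c).totalVariation := by
    refine VectorMeasure.variation_le_of_forall_enorm_le fun s _ => ?_
    calc ‖c s‖ₑ ≤ ‖(c s).re‖ₑ + ‖(c s).im‖ₑ := by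
          rw [← ofReal_norm, ← ofReal_norm, ← ofReal_norm,
            ← ENNReal.ofReal_add (norm_nonneg _) (norm_nonneg _)]
          exact ENNReal.ofReal_le_ofReal (Complex.norm_le_abs_re_add_abs_im _)
      _ ≤ _ := add_le_add (SignedMeasure.enorm_le_totalVariation (ComplexMeasure.re c) s)
          (SignedMeasure.enorm_le_totalVariation (ComplexMeasure.im c) s)
  have h1 : IsFiniteMeasure (ComplexMeasure.re c).totalVariation := by
    unfold SignedMeasure.totalVariation; infer_instance
  have h2 : IsFiniteMeasure (ComplexMeasure.im c).totalVariation := by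
    unfold SignedMeasure.totalVariation; infer_instance
  exact isFiniteMeasure_of_le _ h

/-- The compatible sequences of complex measures on the balls `B(0, n)`. -/
def locSubmodule : Submodule ℂ (ℕ → ComplexMeasure R3) where
  carrier := {ν | ∀ m n : ℕ, m ≤ n →
    (ν n).restrict (Metric.ball (0 : R3) (m : ℝ)) = ν m}
  add_mem' := fun {a b} ha hb m n h => by
    simp only [Pi.add_apply, VectorMeasure.restrict_add, ha m n h, hb m n h]
  zero_mem' := fun m n _ => by simp
  smul_mem' := fun c a ha m n h => by
    simp only [Pi.smul_apply, VectorMeasure.restrict_smul, ha m n h]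

/-- Complex Borel measures on `ℝ³` of locally bounded variation. Such a (not necessarily finite)
measure is given by the compatible sequence of its restrictions to the balls `B(0, n)`. -/
def LocMeasure : Type := locSubmodule

instance : AddCommGroup LocMeasure := inferInstanceAs (AddCommGroup locSubmodule)

instance : Module ℂ LocMeasure := inferInstanceAs (Module ℂ locSubmodule)

namespace LocMeasure

/-- `∫ f d|ν|`, for `f ≥ 0`, where `|ν|` is the total variation of `ν`. -/
def lintegralAbs (ν : LocMeasure) (f : R3 → ℝ≥0∞) : ℝ≥0∞ :=
  ⨆ n : ℕ, ∫⁻ x, f x ∂(ν.1 n).variation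

/-- `∫ f dν`, the limit of the integrals over the balls `B(0, n)`. -/
def integral (ν : LocMeasure) (f : R3 → ℂ) : ℂ :=
  limUnder atTop fun n : ℕ => (ν.1 n).integral f (ContinuousLinearMap.mul ℝ ℂ)

/-- `ν` takes real values on bounded sets. -/
def IsReal (ν : LocMeasure) : Prop := ∀ (n : ℕ) (s : Set R3), (ν.1 n s).im = 0

/-- `W = g V`, where the function `g` is locally integrable with respect to `|V|`. -/
def IsProduct (g : R3 → ℂ) (V W : LocMeasure) : Prop :=
  ∀ n : ℕ, (V.1 n).Integrable g ∧
    W.1 n = (V.1 n).withDensity g (ContinuousLinearMap.mul ℝ ℂ)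

/-- A finite complex measure, seen as a measure of locally bounded variation. -/
def ofComplexMeasure (μ : ComplexMeasure R3) : LocMeasure :=
  ⟨fun n => μ.restrict (Metric.ball 0 (n : ℝ)), fun m n h => by
    rw [VectorMeasure.restrict_restrict _ measurableSet_ball measurableSet_ball,
      Set.inter_eq_left.2 (Metric.ball_subset_ball (by exact_mod_cast h))]⟩

/-- The measure `f dx`, for a locally integrable function `f`. -/
def ofFunction (f : R3 → ℂ) (hf : LocallyIntegrable f) : LocMeasure :=
  ⟨fun n => (volume.restrict (Metric.ball (0 : R3) (n : ℝ))).withDensityᵥ f, fun m n h => by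
    have hi : ∀ k : ℕ, Integrable f (volume.restrict (Metric.ball (0 : R3) (k : ℝ))) := fun k =>
      (hf.integrableOn_isCompact (isCompact_closedBall (0 : R3) (k : ℝ))).mono_set
        Metric.ball_subset_closedBall
    ext s hs
    rw [VectorMeasure.restrict_apply _ measurableSet_ball hs,
      withDensityᵥ_apply (hi n) (hs.inter measurableSet_ball), withDensityᵥ_apply (hi m) hs,
      Measure.restrict_restrict (hs.inter measurableSet_ball), Measure.restrict_restrict hs,
      Set.inter_assoc,
      Set.inter_eq_left.2 (Metric.ball_subset_ball (by exact_mod_cast h))]⟩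

theorem lintegralAbs_add_le (μ ν : LocMeasure) (f : R3 → ℝ≥0∞) :
    (μ + ν).lintegralAbs f ≤ μ.lintegralAbs f + ν.lintegralAbs f := by
  refine iSup_le fun n => ?_
  calc ∫⁻ x, f x ∂((μ + ν).1 n).variation
      ≤ ∫⁻ x, f x ∂((μ.1 n).variation + (ν.1 n).variation) :=
        lintegral_mono' VectorMeasure.variation_add_le le_rfl
    _ = ∫⁻ x, f x ∂(μ.1 n).variation + ∫⁻ x, f x ∂(ν.1 n).variation := lintegral_add_measure _ _ _
    _ ≤ _ := add_le_add (le_iSup (fun n => ∫⁻ x, f x ∂(μ.1 n).variation) n)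
        (le_iSup (fun n => ∫⁻ x, f x ∂(ν.1 n).variation) n)

theorem lintegralAbs_smul (c : ℂ) (ν : LocMeasure) (f : R3 → ℝ≥0∞) :
    (c • ν).lintegralAbs f = ‖c‖ₑ * ν.lintegralAbs f := by
  unfold lintegralAbs
  rw [ENNReal.mul_iSup]
  refine iSup_congr fun n => ?_
  have : (c • ν).1 n = c • ν.1 n := rfl
  rw [this, VectorMeasure.variation_smul, lintegral_smul_measure]
  rfl

end LocMeasure

/-! ### The Kato class -/

/-- The Kato norm `sup_y ∫ d|ν|(x) / |x - y|`, with values in `[0, ∞]`. -/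
def katoENorm (ν : LocMeasure) : ℝ≥0∞ :=
  ⨆ y : R3, ν.lintegralAbs fun x => ‖x - y‖ₑ⁻¹

theorem katoENorm_add_le (μ ν : LocMeasure) : katoENorm (μ + ν) ≤ katoENorm μ + katoENorm ν :=
  iSup_le fun y => (LocMeasure.lintegralAbs_add_le μ ν _).trans <|
    add_le_add (le_iSup (fun y => μ.lintegralAbs fun x => ‖x - y‖ₑ⁻¹) y)
      (le_iSup (fun y => ν.lintegralAbs fun x => ‖x - y‖ₑ⁻¹) y)

theorem katoENorm_smul (c : ℂ) (ν : LocMeasure) : katoENorm (c • ν) = ‖c‖ₑ * katoENorm ν := by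
  unfold katoENorm
  rw [ENNReal.mul_iSup]
  exact iSup_congr fun y => LocMeasure.lintegralAbs_smul c ν _

theorem katoENorm_zero : katoENorm 0 = 0 := by
  have h := katoENorm_smul 0 0
  simpa using h

theorem eq_zero_of_katoENorm {ν : LocMeasure} (h : katoENorm ν = 0) : ν = 0 := by
  refine Subtype.ext (funext fun n => ?_)
  have h0 : ∫⁻ x, ‖x - (0 : R3)‖ₑ⁻¹ ∂(ν.1 n).variation = 0 :=
    le_antisymm (((le_iSup (fun n => ∫⁻ x, ‖x - (0 : R3)‖ₑ⁻¹ ∂(ν.1 n).variation) n).trans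
      (le_iSup (fun y => ν.lintegralAbs fun x => ‖x - y‖ₑ⁻¹) 0)).trans h.le) zero_le
  have hm : Measurable fun x : R3 => ‖x - (0 : R3)‖ₑ⁻¹ := by fun_prop
  rw [lintegral_eq_zero_iff hm] at h0
  have h1 : (ν.1 n).variation = 0 := by
    rw [← Measure.measure_univ_eq_zero]
    refine measure_mono_null (fun x _ => ?_) h0
    simp
  exact VectorMeasure.variation_eq_zero.1 h1

/-- The measures with finite Kato norm. -/
def katoSubmodule : Submodule ℂ LocMeasure where
  carrier := {ν | katoENorm ν ≠ ⊤}
  add_mem' := fun {a b} ha hb =>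
    ne_top_of_le_ne_top (ENNReal.add_ne_top.2 ⟨ha, hb⟩) (katoENorm_add_le a b)
  zero_mem' := by simp [katoENorm_zero]
  smul_mem' := fun c a ha => by
    simpa [katoENorm_smul] using ENNReal.mul_ne_top (by simp) ha

/-- The (global) Kato class `𝒦`, a normed space for the Kato norm. -/
def KatoClass : Type := katoSubmodule

instance : AddCommGroup KatoClass := inferInstanceAs (AddCommGroup katoSubmodule)

instance : Module ℂ KatoClass := inferInstanceAs (Module ℂ katoSubmodule)

/-- The measure underlying an element of the Kato class. -/
def KatoClass.toLoc (V : KatoClass) : LocMeasure := V.1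

instance : Norm KatoClass := ⟨fun V => (katoENorm V.toLoc).toReal⟩

theorem KatoClass.core : NormedSpace.Core ℂ KatoClass where
  norm_nonneg _ := ENNReal.toReal_nonneg
  norm_smul c V := by
    change (katoENorm (c • V.toLoc)).toReal = ‖c‖ * (katoENorm V.toLoc).toReal
    simp [katoENorm_smul]
  norm_triangle V W := by
    change (katoENorm (V.toLoc + W.toLoc)).toReal ≤ _
    refine (ENNReal.toReal_mono (ENNReal.add_ne_top.2 ⟨V.2, W.2⟩)
      (katoENorm_add_le _ _)).trans ?_
    exact (ENNReal.toReal_add V.2 W.2).le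
  norm_eq_zero_iff V := by
    constructor
    · intro h
      have h' : (katoENorm V.toLoc).toReal = 0 := h
      rcases (ENNReal.toReal_eq_zero_iff _).1 h' with h' | h'
      · exact Subtype.ext (eq_zero_of_katoENorm h')
      · exact absurd h' V.2
    · rintro rfl
      change (katoENorm 0).toReal = 0
      simp [katoENorm_zero]

instance : NormedAddCommGroup KatoClass := NormedAddCommGroup.ofCore KatoClass.core

instance : NormedSpace ℂ KatoClass := NormedSpace.ofCore KatoClass.core

/-- The local Kato property: `sup_y ∫_{|x-y|<ε} d|V|(x) / |x - y| → 0` as `ε → 0`. -/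
def HasLocalKatoProperty (V : LocMeasure) : Prop :=
  Tendsto (fun ε : ℝ => ⨆ y : R3,
    V.lintegralAbs ((Metric.ball y ε).indicator fun x => ‖x - y‖ₑ⁻¹)) (𝓝[>] 0) (𝓝 0)

/-- The modified distal Kato property: `sup_y ∫_{|x|>R} d|V|(x) / |x - y| → 0` as `R → ∞`. -/
def HasModifiedDistalKatoProperty (V : LocMeasure) : Prop :=
  Tendsto (fun R : ℝ => ⨆ y : R3,
    V.lintegralAbs ({x : R3 | R < ‖x‖}.indicator fun x => ‖x - y‖ₑ⁻¹)) atTop (𝓝 0)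

/-- Test functions: smooth and compactly supported. -/
def IsTestFunction (φ : R3 → ℂ) : Prop := ContDiff ℝ ((⊤ : ℕ∞) : WithTop ℕ∞) φ ∧ HasCompactSupport φ

theorem IsTestFunction.locallyIntegrable {φ : R3 → ℂ} (h : IsTestFunction φ) :
    LocallyIntegrable φ := h.1.continuous.locallyIntegrable

/-- `𝒦₀`, the closure of the test functions in the Kato class. -/
def kato₀ : Set KatoClass :=
  closure {W | ∃ (φ : R3 → ℂ) (h : IsTestFunction φ),
    W.toLoc = LocMeasure.ofFunction φ h.locallyIntegrable}

/-- `𝒦₁`, the elements of the Kato class with the local and modified distal Kato properties. -/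
def kato₁ : Set KatoClass :=
  {V | HasLocalKatoProperty V.toLoc ∧ HasModifiedDistalKatoProperty V.toLoc}

/-! ### The space of finite measures and the Kato–Birman operator -/

/-- The Banach space `ℳ` of complex measures of bounded variation, with the total variation
norm. -/
def FinMeasure : Type := ComplexMeasure R3

instance : AddCommGroup FinMeasure := inferInstanceAs (AddCommGroup (ComplexMeasure R3))

instance : Module ℂ FinMeasure := inferInstanceAs (Module ℂ (ComplexMeasure R3))

/-- The complex measure underlying an element of `ℳ`. -/
def FinMeasure.toComplexMeasure (μ : FinMeasure) : ComplexMeasure R3 := μ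

instance : Norm FinMeasure := ⟨fun μ => (μ.toComplexMeasure.variation Set.univ).toReal⟩

theorem FinMeasure.core : NormedSpace.Core ℂ FinMeasure where
  norm_nonneg _ := ENNReal.toReal_nonneg
  norm_smul c μ := by
    change ((c • μ.toComplexMeasure).variation Set.univ).toReal
      = ‖c‖ * (μ.toComplexMeasure.variation Set.univ).toReal
    rw [VectorMeasure.variation_smul]
    rw [Measure.smul_apply, ENNReal.smul_def, smul_eq_mul, ENNReal.toReal_mul]
    rfl
  norm_triangle μ ν := by
    have h1 := isFiniteMeasure_variation μ.toComplexMeasure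
    have h2 := isFiniteMeasure_variation ν.toComplexMeasure
    change ((μ.toComplexMeasure + ν.toComplexMeasure).variation Set.univ).toReal ≤ _
    refine (ENNReal.toReal_mono (ENNReal.add_ne_top.2
      ⟨measure_ne_top _ Set.univ, measure_ne_top _ Set.univ⟩)
      (VectorMeasure.variation_add_le Set.univ)).trans ?_
    exact (ENNReal.toReal_add (measure_ne_top _ _) (measure_ne_top _ _)).le
  norm_eq_zero_iff μ := by
    have h1 := isFiniteMeasure_variation μ.toComplexMeasure
    constructor
    · intro h
      have h' : (μ.toComplexMeasure.variation Set.univ).toReal = 0 := h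
      rcases (ENNReal.toReal_eq_zero_iff _).1 h' with h' | h'
      · exact VectorMeasure.variation_eq_zero.1 (Measure.measure_univ_eq_zero.1 h')
      · exact absurd h' (measure_ne_top _ _)
    · rintro rfl
      change ((0 : ComplexMeasure R3).variation Set.univ).toReal = 0
      simp

instance : NormedAddCommGroup FinMeasure := NormedAddCommGroup.ofCore FinMeasure.core

instance : NormedSpace ℂ FinMeasure := NormedSpace.ofCore FinMeasure.core

/-- The principal branch of `√(-lam)`; it has positive real part for `lam ∉ [0, ∞)`. -/
def sqrtNeg (lam : ℂ) : ℂ := (-lam) ^ (1 / 2 : ℂ)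

/-- The convolution kernel `e^{-√(-lam) |x|} / (4π |x|)` of `R₀(lam) = (-Δ - lam)⁻¹`. -/
def freeKernel (lam : ℂ) (x : R3) : ℂ :=
  Complex.exp (-sqrtNeg lam * (‖x‖ : ℂ)) / (4 * (Real.pi : ℂ) * (‖x‖ : ℂ))

/-- `A` is the operator `V R₀(lam)` on `ℳ`. -/
def IsKatoBirmanFin (V : LocMeasure) (lam : ℂ) (A : FinMeasure →L[ℂ] FinMeasure) : Prop :=
  ∀ μ : FinMeasure, LocMeasure.IsProduct
    (fun x => μ.toComplexMeasure.integral (fun y => freeKernel lam (x - y))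
      (ContinuousLinearMap.mul ℝ ℂ))
    V (LocMeasure.ofComplexMeasure (A μ).toComplexMeasure)

/-- `A` is the operator `V R₀(lam)` on `𝒦`. -/
def IsKatoBirmanKato (V : LocMeasure) (lam : ℂ) (A : KatoClass →L[ℂ] KatoClass) : Prop :=
  ∀ ν : KatoClass, LocMeasure.IsProduct
    (fun x => ν.toLoc.integral fun y => freeKernel lam (x - y)) V (A ν).toLoc

/-- `‖A‖ < 1`, and `I + A` is invertible, its inverse being the sum in operator norm of the Born
series `∑ (-A)^n`. -/
def IsBornInvertible {X : Type*} [NormedAddCommGroup X] [NormedSpace ℂ X] (A : X →L[ℂ] X) :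
    Prop :=
  ‖A‖ < 1 ∧ ∃ B : X →L[ℂ] X, (1 + A) * B = 1 ∧ B * (1 + A) = 1 ∧
    HasSum (fun n : ℕ => (-A) ^ n) B

/-! ### The Hamiltonian -/

/-- The Hilbert space `L²(ℝ³)`. -/
abbrev L2 : Type := Lp ℂ 2 (volume : Measure R3)

/-- The sesquilinear form `∫ ∇φ · ∇ψ̄ dx + ∫ φ ψ̄ dV` of `-Δ + V` on test functions. -/
def energyForm (V : LocMeasure) (φ ψ : R3 → ℂ) : ℂ :=
  (∫ x, ∑ i : Fin 3, fderiv ℝ φ x (EuclideanSpace.single i 1) *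
      conj (fderiv ℝ ψ x (EuclideanSpace.single i 1)))
    + V.integral fun x => φ x * conj (ψ x)

/-- The test functions `φ n` converge to `u` in the Sobolev space `H¹`. -/
def IsH1Approx (φ : ℕ → R3 → ℂ) (u : L2) : Prop :=
  (∀ n, IsTestFunction (φ n)) ∧
  Tendsto (fun n => eLpNorm (fun x => φ n x - u x) 2 volume) atTop (𝓝 0) ∧
  ∀ i : Fin 3, Tendsto (fun p : ℕ × ℕ =>
    eLpNorm (fun x => fderiv ℝ (φ p.1) x (EuclideanSpace.single i 1)
      - fderiv ℝ (φ p.2) x (EuclideanSpace.single i 1)) 2 volume) atTop (𝓝 0)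

theorem IsTestFunction.add {φ χ : R3 → ℂ} (hφ : IsTestFunction φ) (hχ : IsTestFunction χ) :
    IsTestFunction fun x => φ x + χ x := ⟨hφ.1.add hχ.1, hφ.2.add hχ.2⟩

theorem IsTestFunction.smul {φ : R3 → ℂ} (c : ℂ) (hφ : IsTestFunction φ) :
    IsTestFunction fun x => c * φ x := ⟨contDiff_const.mul hφ.1, hφ.2.mul_left⟩

theorem IsTestFunction.differentiable {φ : R3 → ℂ} (hφ : IsTestFunction φ) :
    Differentiable ℝ φ := hφ.1.differentiable (by simp)

theorem IsTestFunction.continuous_fderiv {φ : R3 → ℂ} (hφ : IsTestFunction φ) :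
    Continuous (fderiv ℝ φ) := hφ.1.continuous_fderiv (by simp)

theorem IsTestFunction.continuous_mul_conj {φ ψ : R3 → ℂ} (hφ : IsTestFunction φ)
    (hψ : IsTestFunction ψ) : Continuous fun x => φ x * conj (ψ x) :=
  hφ.1.continuous.mul (Complex.continuous_conj.comp hψ.1.continuous)

theorem IsTestFunction.hasCompactSupport_mul_conj {φ : R3 → ℂ} (hφ : IsTestFunction φ)
    (ψ : R3 → ℂ) : HasCompactSupport fun x => φ x * conj (ψ x) := hφ.2.mul_right

theorem integrable_variation (c : ComplexMeasure R3) {f : R3 → ℂ} (hf : Continuous f)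
    (hc : HasCompactSupport f) : c.Integrable f := by
  have := isFiniteMeasure_variation c
  exact hf.integrable_of_hasCompactSupport hc

theorem integral_const_mul_complexMeasure (c : ℂ) (μ : ComplexMeasure R3) {f : R3 → ℂ}
    (hf : μ.Integrable f) :
    μ.integral (fun x => c * f x) (ContinuousLinearMap.mul ℝ ℂ)
      = c * μ.integral f (ContinuousLinearMap.mul ℝ ℂ) := by
  have h1 := VectorMeasure.integral_continuousLinearMap_comp (μ := μ) (f := f)
    (B := ContinuousLinearMap.mul ℝ ℂ) (C := ContinuousLinearMap.mul ℝ ℂ c) hf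
  have h2 := VectorMeasure.continuousLinearMap_apply_integral (μ := μ) (f := f)
    (B := ContinuousLinearMap.mul ℝ ℂ) (C := ContinuousLinearMap.mul ℝ ℂ c) hf
  simp only [ContinuousLinearMap.mul_apply'] at h1 h2
  rw [h1, h2]
  congr 1
  refine ContinuousLinearMap.ext fun a => ContinuousLinearMap.ext fun b => ?_
  simp [mul_assoc]

theorem LocMeasure.tendsto_integral (V : LocMeasure) {f : R3 → ℂ} (hc : HasCompactSupport f) :
    Tendsto (fun n : ℕ => (V.1 n).integral f (ContinuousLinearMap.mul ℝ ℂ)) atTop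
      (𝓝 (V.integral f)) := by
  refine tendsto_nhds_limUnder ?_
  obtain ⟨r, hr⟩ := hc.isCompact.isBounded.subset_ball (0 : R3)
  obtain ⟨N, hN⟩ := exists_nat_ge r
  refine ⟨(V.1 N).integral f (ContinuousLinearMap.mul ℝ ℂ), tendsto_const_nhds.congr' ?_⟩
  filter_upwards [eventually_ge_atTop N] with n hn
  rw [← V.2 N n hn]
  refine VectorMeasure.setIntegral_eq_integral_of_forall_compl_eq_zero measurableSet_ball ?_
  intro x hx
  by_contra hne
  exact hx (Metric.ball_subset_ball hN (hr (subset_tsupport f hne)))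

theorem LocMeasure.integral_add (V : LocMeasure) {f g : R3 → ℂ} (hf : Continuous f)
    (hcf : HasCompactSupport f) (hg : Continuous g) (hcg : HasCompactSupport g) :
    V.integral (fun x => f x + g x) = V.integral f + V.integral g := by
  refine tendsto_nhds_unique (V.tendsto_integral (hcf.add hcg)) ?_
  refine ((V.tendsto_integral hcf).add (V.tendsto_integral hcg)).congr fun n => ?_
  exact (VectorMeasure.integral_fun_add (integrable_variation _ hf hcf)
    (integrable_variation _ hg hcg)).symm

theorem LocMeasure.integral_const_mul (V : LocMeasure) (c : ℂ) {f : R3 → ℂ} (hf : Continuous f)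
    (hcf : HasCompactSupport f) : V.integral (fun x => c * f x) = c * V.integral f := by
  refine tendsto_nhds_unique (V.tendsto_integral hcf.mul_left) ?_
  refine ((V.tendsto_integral hcf).const_mul c).congr fun n => ?_
  exact (integral_const_mul_complexMeasure c _ (integrable_variation _ hf hcf)).symm

theorem integrable_gradient {φ ψ : R3 → ℂ} (hφ : IsTestFunction φ) (hψ : IsTestFunction ψ) :
    Integrable fun x => ∑ i : Fin 3, fderiv ℝ φ x (EuclideanSpace.single i 1) *
      conj (fderiv ℝ ψ x (EuclideanSpace.single i 1)) := by
  refine integrable_finsetSum _ fun i _ => Continuous.integrable_of_hasCompactSupport ?_ ?_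
  · exact (hφ.continuous_fderiv.clm_apply continuous_const).mul
      (Complex.continuous_conj.comp (hψ.continuous_fderiv.clm_apply continuous_const))
  · exact (hφ.2.fderiv_apply ℝ _).mul_right

theorem energyForm_add (V : LocMeasure) {φ χ ψ : R3 → ℂ} (hφ : IsTestFunction φ)
    (hχ : IsTestFunction χ) (hψ : IsTestFunction ψ) :
    energyForm V (fun x => φ x + χ x) ψ = energyForm V φ ψ + energyForm V χ ψ := by
  have h1 : ∀ x, fderiv ℝ (fun x => φ x + χ x) x = fderiv ℝ φ x + fderiv ℝ χ x := fun x =>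
    fderiv_fun_add (hφ.differentiable x) (hχ.differentiable x)
  unfold energyForm
  simp only [h1, _root_.add_apply, add_mul, Finset.sum_add_distrib]
  rw [MeasureTheory.integral_add (integrable_gradient hφ hψ) (integrable_gradient hχ hψ),
    V.integral_add (hφ.continuous_mul_conj hψ) (hφ.hasCompactSupport_mul_conj ψ)
      (hχ.continuous_mul_conj hψ) (hχ.hasCompactSupport_mul_conj ψ)]
  ring

theorem energyForm_smul (V : LocMeasure) (c : ℂ) {φ ψ : R3 → ℂ} (hφ : IsTestFunction φ)
    (hψ : IsTestFunction ψ) : energyForm V (fun x => c * φ x) ψ = c * energyForm V φ ψ := by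
  have h1 : ∀ x, fderiv ℝ (fun x => c * φ x) x = c • fderiv ℝ φ x := fun x =>
    fderiv_const_mul (hφ.differentiable x) c
  unfold energyForm
  simp only [h1, _root_.smul_apply, smul_eq_mul, mul_assoc, ← Finset.mul_sum]
  rw [MeasureTheory.integral_const_mul,
    V.integral_const_mul c (hφ.continuous_mul_conj hψ) (hφ.hasCompactSupport_mul_conj ψ)]
  ring

theorem IsH1Approx.add {φ χ : ℕ → R3 → ℂ} {u v : L2} (hφ : IsH1Approx φ u)
    (hχ : IsH1Approx χ v) : IsH1Approx (fun n x => φ n x + χ n x) (u + v) := by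
  refine ⟨fun n => (hφ.1 n).add (hχ.1 n), ?_, ?_⟩
  · have h := hφ.2.1.add hχ.2.1
    rw [add_zero] at h
    refine tendsto_of_tendsto_of_tendsto_of_le_of_le tendsto_const_nhds h
      (fun _ => zero_le) fun n => ?_
    refine le_trans (le_of_eq (eLpNorm_congr_ae ?_)) (eLpNorm_add_le
      ((hφ.1 n).1.continuous.aestronglyMeasurable.sub (Lp.aestronglyMeasurable u))
      ((hχ.1 n).1.continuous.aestronglyMeasurable.sub (Lp.aestronglyMeasurable v)) (by norm_num))
    filter_upwards [Lp.coeFn_add u v] with x hx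
    simp only [hx, Pi.add_apply]
    ring
  · intro i
    have h := (hφ.2.2 i).add (hχ.2.2 i)
    rw [add_zero] at h
    refine tendsto_of_tendsto_of_tendsto_of_le_of_le tendsto_const_nhds h
      (fun _ => zero_le) fun p => ?_
    have hm : ∀ {χ : ℕ → R3 → ℂ}, (∀ n, IsTestFunction (χ n)) → AEStronglyMeasurable
        (fun x => fderiv ℝ (χ p.1) x (EuclideanSpace.single i 1)
          - fderiv ℝ (χ p.2) x (EuclideanSpace.single i 1)) (volume : Measure R3) := fun h =>
      (((h p.1).continuous_fderiv.clm_apply continuous_const).sub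
        ((h p.2).continuous_fderiv.clm_apply continuous_const)).aestronglyMeasurable
    refine le_trans (le_of_eq (eLpNorm_congr_ae (Eventually.of_forall fun x => ?_)))
      (eLpNorm_add_le (hm hφ.1) (hm hχ.1) (by norm_num))
    simp only [Pi.add_apply]
    rw [fderiv_fun_add ((hφ.1 p.1).differentiable x) ((hχ.1 p.1).differentiable x),
      fderiv_fun_add ((hφ.1 p.2).differentiable x) ((hχ.1 p.2).differentiable x)]
    simp only [_root_.add_apply]
    ring

theorem IsH1Approx.smul {φ : ℕ → R3 → ℂ} {u : L2} (c : ℂ) (hφ : IsH1Approx φ u) :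
    IsH1Approx (fun n x => c * φ n x) (c • u) := by
  refine ⟨fun n => (hφ.1 n).smul c, ?_, ?_⟩
  · have h := ENNReal.Tendsto.const_mul (a := ‖c‖ₑ) hφ.2.1 (Or.inr (by simp))
    rw [mul_zero] at h
    refine h.congr fun n => ?_
    rw [← eLpNorm_const_smul]
    refine eLpNorm_congr_ae ?_
    filter_upwards [Lp.coeFn_smul c u] with x hx
    simp only [hx, Pi.smul_apply, smul_eq_mul]
    ring
  · intro i
    have h := ENNReal.Tendsto.const_mul (a := ‖c‖ₑ) (hφ.2.2 i) (Or.inr (by simp))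
    rw [mul_zero] at h
    refine h.congr fun p => ?_
    rw [← eLpNorm_const_smul]
    refine eLpNorm_congr_ae (Eventually.of_forall fun x => ?_)
    simp only [Pi.smul_apply]
    rw [fderiv_const_mul ((hφ.1 p.1).differentiable x),
      fderiv_const_mul ((hφ.1 p.2).differentiable x)]
    exact smul_sub c _ _

theorem integrable_mul_conj (f : L2) {ψ : R3 → ℂ} (hψ : IsTestFunction ψ) :
    Integrable fun x => f x * conj (ψ x) := by
  have h : MemLp (fun x => conj (ψ x)) 2 volume :=
    (Complex.continuous_conj.comp hψ.1.continuous).memLp_of_hasCompactSupport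
      (hψ.2.comp_left (map_zero _))
  exact (Lp.memLp f).integrable_mul h

/-- The graph of `H = -Δ + V`: the pairs `(u, f)` such that `u` lies in `H¹` and the extension by
continuity of the form of `-Δ + V` from test functions to `H¹` satisfies `q(u, ψ) = ⟨f, ψ⟩` for all
test functions `ψ`. -/
def hamiltonianGraph (V : LocMeasure) : Submodule ℂ (L2 × L2) where
  carrier := {p | ∃ φ : ℕ → R3 → ℂ, IsH1Approx φ p.1 ∧ ∀ ψ : R3 → ℂ, IsTestFunction ψ →
    Tendsto (fun n => energyForm V (φ n) ψ) atTop (𝓝 (∫ x, p.2 x * conj (ψ x)))}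
  add_mem' := by
    rintro p q ⟨φ, hφ, hp⟩ ⟨χ, hχ, hq⟩
    refine ⟨fun n x => φ n x + χ n x, hφ.add hχ, fun ψ hψ => ?_⟩
    have h := (hp ψ hψ).add (hq ψ hψ)
    rw [← integral_add (integrable_mul_conj p.2 hψ) (integrable_mul_conj q.2 hψ)] at h
    have hi : ∫ x, (p + q).2 x * conj (ψ x) =
        ∫ x, (p.2 x * conj (ψ x) + q.2 x * conj (ψ x)) := by
      refine integral_congr_ae ?_
      filter_upwards [Lp.coeFn_add p.2 q.2] with x hx
      rw [Prod.snd_add, hx, Pi.add_apply, add_mul]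
    rw [hi]
    exact h.congr fun n => (energyForm_add V (hφ.1 n) (hχ.1 n) hψ).symm
  zero_mem' := by
    refine ⟨fun _ _ => 0, ⟨fun _ => ⟨contDiff_const, HasCompactSupport.zero⟩, ?_, ?_⟩,
      fun ψ hψ => ?_⟩
    · have h : eLpNorm (fun x => (0 : ℂ) - (0 : L2) x) 2 volume = 0 := by
        refine (eLpNorm_congr_ae (g := fun _ => (0 : ℂ)) ?_).trans eLpNorm_zero'
        filter_upwards [Lp.coeFn_zero ℂ 2 (volume : Measure R3)] with x hx
        rw [hx, Pi.zero_apply, sub_zero]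
      simp only [Prod.fst_zero, h, tendsto_const_nhds]
    · intro i
      simp only [fderiv_fun_const, Pi.zero_apply, sub_self, eLpNorm_zero', tendsto_const_nhds]
    · have hi : ∫ x, (0 : L2 × L2).2 x * conj (ψ x) = 0 := by
        rw [← integral_zero R3 ℂ (μ := volume)]
        refine integral_congr_ae ?_
        filter_upwards [Lp.coeFn_zero ℂ 2 (volume : Measure R3)] with x hx
        rw [Prod.snd_zero, hx, Pi.zero_apply, zero_mul]
      have h0 := energyForm_smul V 0 (φ := fun _ => 0) ⟨contDiff_const, HasCompactSupport.zero⟩ hψ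
      simp only [mul_zero, zero_mul] at h0
      rw [hi]
      simp only [h0, tendsto_const_nhds]
  smul_mem' := by
    rintro c p ⟨φ, hφ, hp⟩
    refine ⟨fun n x => c * φ n x, hφ.smul c, fun ψ hψ => ?_⟩
    have h := (hp ψ hψ).const_mul c
    rw [← integral_const_mul] at h
    have hi : ∫ x, (c • p).2 x * conj (ψ x) = ∫ x, c * (p.2 x * conj (ψ x)) := by
      refine integral_congr_ae ?_
      filter_upwards [Lp.coeFn_smul c p.2] with x hx
      rw [Prod.smul_snd, hx, Pi.smul_apply, smul_eq_mul, mul_assoc]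
    rw [hi]
    exact h.congr fun n => (energyForm_smul V c (hφ.1 n) hψ).symm

/-- The Hamiltonian `H = -Δ + V`, as an unbounded operator on `L²(ℝ³)`: the operator with graph
`hamiltonianGraph V`. -/
def hamiltonian (V : LocMeasure) : L2 →ₗ.[ℂ] L2 := (hamiltonianGraph V).toLinearPMap

/-- The spectrum of an unbounded operator `T`: the complement of the set of those `z` for which
`T - z` has a bounded everywhere defined inverse `R`. -/
def operatorSpectrum {X : Type*} [NormedAddCommGroup X] [NormedSpace ℂ X] (T : X →ₗ.[ℂ] X) :
    Set ℂ :=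
  {z | ∃ R : X →L[ℂ] X, (∀ f : X, ∃ h : R f ∈ T.domain, T ⟨R f, h⟩ - z • R f = f) ∧
    ∀ u : T.domain, R (T u - z • (u : X)) = u}ᶜ

end

end KatoSchrodinger

open KatoSchrodinger

namespace KatoSchrodinger

/-! ### A softened Coulomb kernel -/

/-! Part (i) rests on a form bound: for every δ > 0 there is C with ∫|φ|² d|V| ≤ δ∫|∇φ|² + C∫|φ|²
for all test functions φ (`exists_form_bound`). It comes from Jacobi's inequality ∫|∇φ|² ≥
∫(-Δh/h)|φ|² for h > 0 (`jacobi_inequality`). For h one takes a constant c plus the potential of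
|V|, cut to a ball, for the kernel (|x|²+ε²)^{-1/2} - (|x|²+b²)^{-1/2}. The local Kato property and
the finite Kato norm make this potential at most c for small b, uniformly in ε, so c ≤ h ≤ 2c, while
-Δh is |V| smeared at scale ε, up to a constant factor, minus a bounded function. Letting ε → 0
gives the form bound with δ proportional to c.

Consequently the restrictions of test functions to L²(V₊) and L²(V₋) extend to H¹, and the form is
given by a bounded operator T on H¹ with ⟨e, Te⟩ real and at least ‖e‖²/2 - C‖Je‖², where J is the
embedding of H¹ into L² (`exists_formOperator`). A pair (u, f) is in the graph of H iff u = Je and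
Te = J*f for some e (`mem_hamiltonianGraph_iff`). Since J is injective with dense range, H is well
defined. For z nonreal, or Re z < -C, coercivity makes T - zJ*J invertible, and J(T - zJ*J)⁻¹J* is
the resolvent.

For part (ii) let a = Re √(-λ). The kernel of R₀(λ) has modulus e^{-a|x-y|}/(4π|x-y|). With Y(a) =
sup_y ∫ e^{-a|x-y|}/|x-y| d|V|(x), Tonelli bounds the norm of VR₀(λ) by Y(a)/(4π) on ℳ, and by
3Y(a)/(4π) on 𝒦 thanks to `yukawa_mul_inv_enorm_le`. The local Kato property gives Y(a) → 0 as a → ∞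
(`tendsto_yukawaNorm`). Once Y(a) ≤ 1 both norms are below 1, and the Born series converges because
ℳ and 𝒦 are complete. -/

/-- The standard basis vectors of `ℝ³`. -/
noncomputable abbrev basisVec (i : Fin 3) : R3 := EuclideanSpace.single i (1 : ℝ)

/-- The softened Coulomb kernel `(|x|² + b²)^{-1/2}`. -/
noncomputable def softCoulomb (b : ℝ) (x : R3) : ℝ := (√(‖x‖ ^ 2 + b ^ 2))⁻¹

section softCoulomb

variable {b : ℝ}

theorem softCoulomb_rad_pos (hb : 0 < b) (x : R3) : 0 < ‖x‖ ^ 2 + b ^ 2 := by positivity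

theorem softCoulomb_pos (hb : 0 < b) (x : R3) : 0 < softCoulomb b x :=
  inv_pos.2 (Real.sqrt_pos.2 (softCoulomb_rad_pos hb x))

theorem continuous_softCoulomb (hb : 0 < b) : Continuous (softCoulomb b) := by
  unfold softCoulomb
  exact Continuous.inv₀ (by fun_prop) fun x => (Real.sqrt_pos.2 (softCoulomb_rad_pos hb x)).ne'

theorem softCoulomb_le_inv (hb : 0 < b) (x : R3) : softCoulomb b x ≤ b⁻¹ := by
  unfold softCoulomb
  refine inv_anti₀ hb (Real.le_sqrt_of_sq_le ?_)
  nlinarith [sq_nonneg ‖x‖]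

theorem softCoulomb_mul_norm_le (hb : 0 < b) (x : R3) : softCoulomb b x * ‖x‖ ≤ 1 := by
  unfold softCoulomb
  rw [inv_mul_le_iff₀ (Real.sqrt_pos.2 (softCoulomb_rad_pos hb x)), mul_one]
  exact Real.le_sqrt_of_sq_le (by nlinarith [sq_nonneg b])

theorem softCoulomb_sq (hb : 0 < b) (x : R3) :
    softCoulomb b x ^ 2 * (‖x‖ ^ 2 + b ^ 2) = 1 := by
  unfold softCoulomb
  rw [inv_pow, Real.sq_sqrt (softCoulomb_rad_pos hb x).le,
    inv_mul_cancel₀ (softCoulomb_rad_pos hb x).ne']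

theorem softCoulomb_anti {ε : ℝ} (hε : 0 < ε) (h : ε ≤ b) (x : R3) :
    softCoulomb b x ≤ softCoulomb ε x := by
  unfold softCoulomb
  refine inv_anti₀ (Real.sqrt_pos.2 (softCoulomb_rad_pos hε x)) (Real.sqrt_le_sqrt ?_)
  gcongr

theorem norm_sq_add_smul_basisVec (x : R3) (i : Fin 3) (t : ℝ) :
    ‖x + t • basisVec i‖ ^ 2 = ‖x‖ ^ 2 + 2 * t * x i + t ^ 2 := by
  rw [norm_add_sq_real, inner_smul_right, norm_smul, EuclideanSpace.inner_single_right]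
  simp
  ring

theorem add_smul_basisVec_apply (x : R3) (i : Fin 3) (t : ℝ) : (x + t • basisVec i) i = x i + t := by
  simp

/-- Directional derivatives suffice throughout: the integration by parts in Jacobi's inequality is
done one coordinate at a time. -/
theorem hasLineDerivAt_softCoulomb (hb : 0 < b) (x : R3) (i : Fin 3) :
    HasLineDerivAt ℝ (softCoulomb b) (-(x i * softCoulomb b x ^ 3)) x (basisVec i) := by
  have h0 := softCoulomb_rad_pos hb x
  have h1 : HasDerivAt (fun t : ℝ => ‖x‖ ^ 2 + 2 * t * x i + t ^ 2 + b ^ 2) (2 * x i) 0 := by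
    have := ((((hasDerivAt_id (0 : ℝ)).const_mul 2).mul_const (x i)).const_add (‖x‖ ^ 2)).add
      ((hasDerivAt_id (0 : ℝ)).pow 2) |>.add_const (b ^ 2)
    simpa using this
  have h2 := (h1.sqrt (by simpa using h0.ne')).inv (by simpa using (Real.sqrt_pos.2 h0).ne')
  unfold HasLineDerivAt
  refine (h2.congr_deriv ?_).congr_of_eventuallyEq (Eventually.of_forall fun t => ?_)
  · have hs := Real.sqrt_pos.2 h0
    simp only [softCoulomb, mul_zero, zero_mul, add_zero, ne_eq, OfNat.ofNat_ne_zero,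
      not_false_eq_true, zero_pow]
    field_simp
  · simp only [softCoulomb, norm_sq_add_smul_basisVec, Pi.inv_apply]

theorem hasLineDerivAt_coord_mul_softCoulomb (hb : 0 < b) (x : R3) (i : Fin 3) :
    HasLineDerivAt ℝ (fun x => -(x i * softCoulomb b x ^ 3))
      (3 * x i ^ 2 * softCoulomb b x ^ 5 - softCoulomb b x ^ 3) x (basisVec i) := by
  have h1 := hasLineDerivAt_softCoulomb hb x i
  unfold HasLineDerivAt at h1 ⊢
  have h2 : HasDerivAt (fun t : ℝ => x i + t) 1 0 := (hasDerivAt_id (0 : ℝ)).const_add (x i)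
  have h3 := (h2.mul (h1.pow 3)).neg
  simp only [Pi.pow_apply, zero_smul, add_zero] at h3
  refine (h3.congr_deriv (by push_cast; ring)).congr_of_eventuallyEq ?_
  refine Eventually.of_forall fun t => ?_
  simp only [add_smul_basisVec_apply, Pi.neg_apply, Pi.mul_apply, Pi.pow_apply]

theorem norm_sq_eq_sum_coord (x : R3) : ‖x‖ ^ 2 = ∑ i, x i ^ 2 := EuclideanSpace.real_norm_sq_eq x

theorem abs_coord_le_norm (x : R3) (i : Fin 3) : |x i| ≤ ‖x‖ := by
  simpa using PiLp.norm_apply_le x i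

/-- With s = (|x|²+b²)^{-1/2}, the identities ∑ xᵢ² = |x|² and s²(|x|²+b²) = 1 collapse the sum. The
sign is what matters: -Δs is a positive bump of width b. -/
theorem laplacian_softCoulomb (hb : 0 < b) (x : R3) :
    ∑ i : Fin 3, (3 * x i ^ 2 * softCoulomb b x ^ 5 - softCoulomb b x ^ 3)
      = -(3 * b ^ 2 * softCoulomb b x ^ 5) := by
  have h := softCoulomb_sq hb x
  rw [Finset.sum_sub_distrib, ← Finset.sum_mul, ← Finset.mul_sum, ← norm_sq_eq_sum_coord]
  simp only [Finset.sum_const, Finset.card_univ, Fintype.card_fin, nsmul_eq_mul]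
  push_cast
  linear_combination (3 * softCoulomb b x ^ 3) * h

theorem abs_coord_mul_softCoulomb_le (hb : 0 < b) (x : R3) (i : Fin 3) :
    |x i| * softCoulomb b x ≤ 1 := by
  refine le_trans ?_ (softCoulomb_mul_norm_le hb x)
  rw [mul_comm]
  exact mul_le_mul_of_nonneg_left (abs_coord_le_norm x i) (softCoulomb_pos hb x).le

/-- This sup bound and the next are constants, hence integrable against a finite measure; they
justify differentiating under the integral. -/
theorem abs_deriv_softCoulomb_le (hb : 0 < b) (x : R3) (i : Fin 3) :
    |(-(x i * softCoulomb b x ^ 3))| ≤ b⁻¹ ^ 2 := by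
  have h0 := (softCoulomb_pos hb x).le
  rw [abs_neg, abs_mul, abs_of_nonneg (pow_nonneg h0 3)]
  calc |x i| * softCoulomb b x ^ 3 = (|x i| * softCoulomb b x) * softCoulomb b x ^ 2 := by ring
    _ ≤ 1 * b⁻¹ ^ 2 := by
      gcongr
      · exact abs_coord_mul_softCoulomb_le hb x i
      · exact softCoulomb_le_inv hb x
    _ = _ := one_mul _

theorem abs_deriv2_softCoulomb_le (hb : 0 < b) (x : R3) (i : Fin 3) :
    |3 * x i ^ 2 * softCoulomb b x ^ 5 - softCoulomb b x ^ 3| ≤ 4 * b⁻¹ ^ 3 := by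
  have h0 := (softCoulomb_pos hb x).le
  have h1 : softCoulomb b x ^ 3 ≤ b⁻¹ ^ 3 := by
    gcongr
    exact softCoulomb_le_inv hb x
  have h2 : (|x i| * softCoulomb b x) ^ 2 ≤ 1 :=
    pow_le_one₀ (by positivity) (abs_coord_mul_softCoulomb_le hb x i)
  have h3 : 3 * x i ^ 2 * softCoulomb b x ^ 5
      = 3 * (|x i| * softCoulomb b x) ^ 2 * softCoulomb b x ^ 3 := by
    rw [mul_pow, sq_abs]; ring
  have h4 : 0 ≤ softCoulomb b x ^ 3 := by positivity
  have h5 : 0 ≤ (|x i| * softCoulomb b x) ^ 2 := sq_nonneg _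
  rw [h3, abs_le]
  constructor <;> nlinarith [mul_le_mul_of_nonneg_right h2 h4, mul_nonneg h5 h4]

end softCoulomb

/-! ### Superpositions of translates of a kernel -/

section superposition

variable {g g' : R3 → ℝ} {M : ℝ} (m : Measure R3) [IsFiniteMeasure m]

theorem integrable_kernel_sub (hg : Continuous g) (hM : ∀ x, |g x| ≤ M) (x : R3) :
    Integrable (fun y => g (x - y)) m :=
  Integrable.of_bound (hg.comp (by fun_prop)).aestronglyMeasurable M
    (Eventually.of_forall fun y => hM _)

theorem continuous_integral_kernel_sub (hg : Continuous g) (hM : ∀ x, |g x| ≤ M) :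
    Continuous fun x => ∫ y, g (x - y) ∂m :=
  continuous_of_dominated (bound := fun _ => M)
    (fun x => (hg.comp (by fun_prop)).aestronglyMeasurable)
    (fun x => Eventually.of_forall fun y => hM _) (integrable_const M)
    (Eventually.of_forall fun y => hg.comp (by fun_prop))

theorem hasLineDerivAt_integral_kernel_sub {v : R3} (hg : Continuous g) (hM : ∀ x, |g x| ≤ M)
    (hg' : Continuous g') {M' : ℝ} (hM' : ∀ x, |g' x| ≤ M')
    (h : ∀ x, HasLineDerivAt ℝ g (g' x) x v) (x : R3) :
    HasLineDerivAt ℝ (fun x => ∫ y, g (x - y) ∂m) (∫ y, g' (x - y) ∂m) x v := by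
  unfold HasLineDerivAt
  have key := hasDerivAt_integral_of_dominated_loc_of_deriv_le (μ := m) (x₀ := (0 : ℝ))
    (s := Set.univ) (F := fun (t : ℝ) y => g (x + t • v - y))
    (F' := fun (t : ℝ) y => g' (x + t • v - y)) (bound := fun _ => M') univ_mem
    (Eventually.of_forall fun t => (integrable_kernel_sub m hg hM _).1)
    (integrable_kernel_sub m hg hM _) (integrable_kernel_sub m hg' hM' _).1
    (Eventually.of_forall fun y t _ => hM' _) (integrable_const M')
    (Eventually.of_forall fun y t _ => ?_)
  · simpa using key.2
  · have h1 := h (x + t • v - y)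
    unfold HasLineDerivAt at h1
    -- Writing 0 as t - t turns the derivative at 0 along the line through x + tv - y into a
    -- derivative at t along the line through x - y.
    rw [← sub_self t] at h1
    refine (h1.comp_sub_const t t).congr_of_eventuallyEq (Eventually.of_forall fun s => ?_)
    change g (x + s • v - y) = g (x + t • v - y + (s - t) • v)
    congr 1
    module

end superposition

/-! ### Jacobi's inequality -/

/-- The squared length of the gradient. -/
noncomputable def gradSq (φ : R3 → ℂ) (x : R3) : ℝ := ∑ i : Fin 3, ‖fderiv ℝ φ x (basisVec i)‖ ^ 2

section Jacobi

variable {φ : R3 → ℂ}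

theorem hasCompactSupport_norm_sq (hφ : HasCompactSupport φ) :
    HasCompactSupport fun x => ‖φ x‖ ^ 2 :=
  hφ.comp_left (g := fun z => ‖z‖ ^ 2) (by simp)

theorem IsTestFunction.continuous_fderiv_basisVec (hφ : IsTestFunction φ) (i : Fin 3) :
    Continuous fun x => fderiv ℝ φ x (basisVec i) :=
  hφ.continuous_fderiv.clm_apply continuous_const

theorem IsTestFunction.hasCompactSupport_fderiv_basisVec (hφ : IsTestFunction φ) (i : Fin 3) :
    HasCompactSupport fun x => fderiv ℝ φ x (basisVec i) := hφ.2.fderiv_apply ℝ _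

theorem IsTestFunction.integrable_normSq_fderiv (hφ : IsTestFunction φ) (i : Fin 3) :
    Integrable fun x => ‖fderiv ℝ φ x (basisVec i)‖ ^ 2 :=
  ((hφ.continuous_fderiv_basisVec i).norm.pow 2).integrable_of_hasCompactSupport
    (hasCompactSupport_norm_sq (hφ.hasCompactSupport_fderiv_basisVec i))

theorem hasLineDerivAt_norm_sq (hφ : IsTestFunction φ) (x v : R3) :
    HasLineDerivAt ℝ (fun x => ‖φ x‖ ^ 2) (2 * inner ℝ (φ x) (fderiv ℝ φ x v)) x v := by
  have h := (hφ.differentiable x).hasFDerivAt.hasLineDerivAt v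
  unfold HasLineDerivAt at h ⊢
  simpa using h.norm_sq

/-- Jacobi's inequality: `∫ |∇φ|² + ∫ (Δh / h) |φ|² ≥ 0` for `h > 0`. -/
theorem jacobi_inequality (hφ : IsTestFunction φ) {h : R3 → ℝ} {h₁ h₂ : Fin 3 → R3 → ℝ}
    (hpos : ∀ x, 0 < h x) (hc : Continuous h) (hc₁ : ∀ i, Continuous (h₁ i))
    (hc₂ : ∀ i, Continuous (h₂ i)) (hd : ∀ i x, HasLineDerivAt ℝ h (h₁ i x) x (basisVec i))
    (hd₁ : ∀ i x, HasLineDerivAt ℝ (h₁ i) (h₂ i x) x (basisVec i)) :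
    ∫ x, ‖φ x‖ ^ 2 * (-(∑ i, h₂ i x) / h x) ≤ ∫ x, gradSq φ x := by
  have hne : ∀ x, h x ≠ 0 := fun x => (hpos x).ne'
  have hφ2 : Continuous fun x => ‖φ x‖ ^ 2 := hφ.1.continuous.norm.pow 2
  have hcs := hasCompactSupport_norm_sq hφ.2
  have hint : ∀ {f : R3 → ℝ}, Continuous f → Integrable fun x => f x * ‖φ x‖ ^ 2 := fun hf =>
    (hf.mul hφ2).integrable_of_hasCompactSupport hcs.mul_left
  have hF : ∀ i, Continuous fun x => h₁ i x / h x := fun i => (hc₁ i).div hc hne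
  have hF' : ∀ i, Continuous fun x => h₂ i x / h x - (h₁ i x / h x) ^ 2 := fun i =>
    ((hc₂ i).div hc hne).sub ((hF i).pow 2)
  have hdc : ∀ i, Continuous fun x => 2 * inner ℝ (φ x) (fderiv ℝ φ x (basisVec i)) := fun i =>
    continuous_const.mul (hφ.1.continuous.inner (hφ.continuous_fderiv_basisVec i))
  have hds : ∀ i, HasCompactSupport fun x => 2 * inner ℝ (φ x) (fderiv ℝ φ x (basisVec i)) :=
    fun i => by
      refine hφ.2.mono' fun x hx => subset_tsupport _ ?_
      intro h0
      simp [h0] at hx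
  have hFg : ∀ i, Integrable fun x =>
      h₁ i x / h x * (2 * inner ℝ (φ x) (fderiv ℝ φ x (basisVec i))) := fun i =>
    ((hF i).mul (hdc i)).integrable_of_hasCompactSupport (hds i).mul_left
  have hF2 : ∀ i, Integrable fun x => (h₁ i x / h x) ^ 2 * ‖φ x‖ ^ 2 := fun i =>
    hint ((hF i).pow 2)
  have hFn : ∀ i, Integrable fun x => -((h₂ i x / h x - (h₁ i x / h x) ^ 2) * ‖φ x‖ ^ 2) :=
    fun i => (hint (hF' i)).neg
  -- Integration by parts of F = ∂ᵢh/h against ∂ᵢ|φ|² = 2 Re⟨φ, ∂ᵢφ⟩, where ∂ᵢF = ∂ᵢ²h/h - F².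
  have hparts : ∀ i, ∫ x, h₁ i x / h x * (2 * inner ℝ (φ x) (fderiv ℝ φ x (basisVec i)))
      = -∫ x, (h₂ i x / h x - (h₁ i x / h x) ^ 2) * ‖φ x‖ ^ 2 := fun i => by
    refine integral_bilinear_hasLineDerivAt_right_eq_neg_left_of_integrable (μ := volume)
      (B := ContinuousLinearMap.mul ℝ ℝ) (v := basisVec i) (hint (hF' i)) (hFg i) (hint (hF i))
      (fun x _ => ?_) fun x _ => hasLineDerivAt_norm_sq hφ x _
    have e1 := hd i x
    have e2 := hd₁ i x
    unfold HasLineDerivAt at e1 e2 ⊢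
    refine (e2.div e1 (by simpa using hne x)).congr_deriv ?_
    simp only [zero_smul, add_zero]
    field_simp [hne x]
  -- Completing the square: pointwise 2F Re⟨φ, ∂ᵢφ⟩ - F²|φ|² ≤ |∂ᵢφ|², by Cauchy–Schwarz and (|F||φ|
  -- - |∂ᵢφ|)² ≥ 0.
  have hi : ∀ i, ∫ x, ‖φ x‖ ^ 2 * (-(h₂ i x) / h x)
      ≤ ∫ x, ‖fderiv ℝ φ x (basisVec i)‖ ^ 2 := fun i => by
    calc ∫ x, ‖φ x‖ ^ 2 * (-(h₂ i x) / h x)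
        = (-∫ x, (h₂ i x / h x - (h₁ i x / h x) ^ 2) * ‖φ x‖ ^ 2)
          - ∫ x, (h₁ i x / h x) ^ 2 * ‖φ x‖ ^ 2 := by
          rw [← integral_neg, ← integral_sub (hFn i) (hF2 i)]
          refine integral_congr_ae (Eventually.of_forall fun x => ?_)
          simp only
          ring
      _ = ∫ x, (h₁ i x / h x * (2 * inner ℝ (φ x) (fderiv ℝ φ x (basisVec i)))
            - (h₁ i x / h x) ^ 2 * ‖φ x‖ ^ 2) := by
          rw [← hparts, integral_sub (hFg i) (hF2 i)]
      _ ≤ _ := by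
          refine integral_mono ((hFg i).sub (hF2 i))
            (hφ.integrable_normSq_fderiv i) fun x => ?_
          have h1 := real_inner_le_norm ((h₁ i x / h x) • φ x) (fderiv ℝ φ x (basisVec i))
          rw [inner_smul_left, norm_smul] at h1
          have h2 := sq_nonneg (‖h₁ i x / h x‖ * ‖φ x‖ - ‖fderiv ℝ φ x (basisVec i)‖)
          have h3 : ‖h₁ i x / h x‖ ^ 2 = (h₁ i x / h x) ^ 2 := by
            rw [Real.norm_eq_abs, sq_abs]
          simp only [RCLike.conj_to_real] at h1
          simp only
          nlinarith
  unfold gradSq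
  rw [integral_finsetSum _ fun i _ => hφ.integrable_normSq_fderiv i]
  calc ∫ x, ‖φ x‖ ^ 2 * (-(∑ i, h₂ i x) / h x)
      = ∫ x, ∑ i, ‖φ x‖ ^ 2 * (-(h₂ i x) / h x) := by
        refine integral_congr_ae (Eventually.of_forall fun x => ?_)
        simp only [neg_div, Finset.sum_div, mul_neg, Finset.mul_sum, Finset.sum_neg_distrib]
    _ = ∑ i, ∫ x, ‖φ x‖ ^ 2 * (-(h₂ i x) / h x) := integral_finsetSum _ fun i _ => by
        have h1 : Continuous fun x => -(h₂ i x) / h x := (hc₂ i).neg.div hc hne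
        simpa only [mul_comm] using hint h1
    _ ≤ _ := Finset.sum_le_sum fun i _ => hi i

end Jacobi

/-! ### The form bound for a finite measure -/

section formBound

variable {φ : R3 → ℂ} (m : Measure R3) [IsFiniteMeasure m]

theorem continuous_softCoulomb_pow {b : ℝ} (hb : 0 < b) (n : ℕ) :
    Continuous fun x => softCoulomb b x ^ n := (continuous_softCoulomb hb).pow n

theorem abs_softCoulomb_pow_le {b : ℝ} (hb : 0 < b) (n : ℕ) (x : R3) :
    |softCoulomb b x ^ n| ≤ b⁻¹ ^ n := by
  have h := (softCoulomb_pos hb x).le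
  rw [abs_of_nonneg (by positivity)]
  gcongr
  exact softCoulomb_le_inv hb x

/-- The superposition of the kernels `-Δ (|x|² + b²)^{-1/2}`. -/
noncomputable def softDensity (b : ℝ) (x : R3) : ℝ :=
  ∫ y, 3 * b ^ 2 * softCoulomb b (x - y) ^ 5 ∂m

theorem continuous_softDensity {b : ℝ} (hb : 0 < b) : Continuous (softDensity m b) := by
  unfold softDensity
  simp only [integral_const_mul]
  exact (continuous_const.mul (continuous_integral_kernel_sub m (continuous_softCoulomb_pow hb 5)
    (abs_softCoulomb_pow_le hb 5)))

/-- Jacobi's inequality for h = c + (potential of the kernel difference). As c ≤ h ≤ 2c, the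
quotient -Δh/h is at least (smeared measure at scale ε)/(2c) - C/c; multiplying by 2c gives the
claim. -/
theorem integral_softDensity_mul_le (hφ : IsTestFunction φ) {ε b c C : ℝ} (hε : 0 < ε)
    (hεb : ε ≤ b) (hc : 0 < c)
    (hW : ∀ x, ∫ y, (softCoulomb ε (x - y) - softCoulomb b (x - y)) ∂m ≤ c)
    (hC : ∀ x, softDensity m b x ≤ C) :
    ∫ x, softDensity m ε x * ‖φ x‖ ^ 2
      ≤ 2 * c * (∫ x, gradSq φ x) + 2 * C * ∫ x, ‖φ x‖ ^ 2 := by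
  have hb : 0 < b := hε.trans_le hεb
  have hJ : ∀ {b : ℝ}, 0 < b → ∀ x, Integrable (fun y => softCoulomb b (x - y)) m := fun hb x => by
    simpa using integrable_kernel_sub m (continuous_softCoulomb_pow hb 1)
      (abs_softCoulomb_pow_le hb 1) x
  have hWc : ∀ {b : ℝ}, 0 < b → Continuous fun x => ∫ y, softCoulomb b (x - y) ∂m := fun hb => by
    simpa using continuous_integral_kernel_sub m (continuous_softCoulomb_pow hb 1)
      (abs_softCoulomb_pow_le hb 1)
  set k₁ : ℝ → Fin 3 → R3 → ℝ := fun b i x => -(x i * softCoulomb b x ^ 3) with hk₁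
  set k₂ : ℝ → Fin 3 → R3 → ℝ := fun b i x =>
    3 * x i ^ 2 * softCoulomb b x ^ 5 - softCoulomb b x ^ 3 with hk₂
  have hk₁c : ∀ {b : ℝ}, 0 < b → ∀ i, Continuous (k₁ b i) := fun hb i => by
    have := continuous_softCoulomb_pow hb 3
    simp only [hk₁]
    fun_prop
  have hk₂c : ∀ {b : ℝ}, 0 < b → ∀ i, Continuous (k₂ b i) := fun hb i => by
    have := continuous_softCoulomb_pow hb 3
    have := continuous_softCoulomb_pow hb 5
    simp only [hk₂]
    fun_prop
  -- The difference of the two potentials is nonnegative since ε ≤ b, and at most c by `hW`.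
  set h : R3 → ℝ := fun x =>
    c + (∫ y, softCoulomb ε (x - y) ∂m - ∫ y, softCoulomb b (x - y) ∂m) with hh
  set h₁ : Fin 3 → R3 → ℝ := fun i x => ∫ y, k₁ ε i (x - y) ∂m - ∫ y, k₁ b i (x - y) ∂m with hh₁
  set h₂ : Fin 3 → R3 → ℝ := fun i x => ∫ y, k₂ ε i (x - y) ∂m - ∫ y, k₂ b i (x - y) ∂m with hh₂
  have hle : ∀ x, h x ≤ 2 * c := fun x => by
    have := hW x
    rw [integral_sub (hJ hε x) (hJ hb x)] at this
    simp only [hh]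
    linarith
  have hge : ∀ x, c ≤ h x := fun x => by
    have : ∫ y, softCoulomb b (x - y) ∂m ≤ ∫ y, softCoulomb ε (x - y) ∂m :=
      integral_mono (hJ hb x) (hJ hε x) fun y => softCoulomb_anti hε hεb _
    simp only [hh]
    linarith
  have hd : ∀ {b : ℝ}, 0 < b → ∀ i x, HasLineDerivAt ℝ (fun x => ∫ y, softCoulomb b (x - y) ∂m)
      (∫ y, k₁ b i (x - y) ∂m) x (basisVec i) := fun {b} hb i x =>
    hasLineDerivAt_integral_kernel_sub m (continuous_softCoulomb hb)
      (fun x => by simpa using abs_softCoulomb_pow_le hb 1 x) (hk₁c hb i)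
      (fun x => abs_deriv_softCoulomb_le hb x i) (fun x => hasLineDerivAt_softCoulomb hb x i) x
  have hd₁ : ∀ {b : ℝ}, 0 < b → ∀ i x, HasLineDerivAt ℝ (fun x => ∫ y, k₁ b i (x - y) ∂m)
      (∫ y, k₂ b i (x - y) ∂m) x (basisVec i) := fun {b} hb i x =>
    hasLineDerivAt_integral_kernel_sub m (hk₁c hb i)
      (fun x => abs_deriv_softCoulomb_le hb x i) (hk₂c hb i)
      (fun x => abs_deriv2_softCoulomb_le hb x i)
      (fun x => hasLineDerivAt_coord_mul_softCoulomb hb x i) x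
  have hlap : ∀ {b : ℝ}, 0 < b → ∀ x, ∑ i, ∫ y, k₂ b i (x - y) ∂m = -softDensity m b x :=
    fun {b} hb x => by
      rw [← integral_finsetSum _ fun i _ => integrable_kernel_sub m (hk₂c hb i)
        (fun x => abs_deriv2_softCoulomb_le hb x i) x, softDensity, ← integral_neg]
      exact integral_congr_ae (Eventually.of_forall fun y => laplacian_softCoulomb hb (x - y))
  have hhc : Continuous h := continuous_const.add ((hWc hε).sub (hWc hb))
  have hpos : ∀ x, 0 < h x := fun x => hc.trans_le (hge x)
  have key := jacobi_inequality hφ (h := h) (h₁ := h₁) (h₂ := h₂) hpos hhc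
    (fun i => (continuous_integral_kernel_sub m (hk₁c hε i)
        fun x => abs_deriv_softCoulomb_le hε x i).sub
      (continuous_integral_kernel_sub m (hk₁c hb i) fun x => abs_deriv_softCoulomb_le hb x i))
    (fun i => (continuous_integral_kernel_sub m (hk₂c hε i)
        fun x => abs_deriv2_softCoulomb_le hε x i).sub
      (continuous_integral_kernel_sub m (hk₂c hb i) fun x => abs_deriv2_softCoulomb_le hb x i))
    (fun i x => by
      have e1 := hd hε i x
      have e2 := hd hb i x
      unfold HasLineDerivAt at e1 e2 ⊢
      exact (e1.sub e2).const_add c)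
    (fun i x => by
      have e1 := hd₁ hε i x
      have e2 := hd₁ hb i x
      unfold HasLineDerivAt at e1 e2 ⊢
      exact e1.sub e2)
  have hsum : ∀ x, -(∑ i, h₂ i x) = softDensity m ε x - softDensity m b x := fun x => by
    simp only [hh₂, Finset.sum_sub_distrib, hlap hε, hlap hb]
    ring
  simp only [hsum] at key
  have hUnn : ∀ {b : ℝ}, 0 < b → ∀ x, 0 ≤ softDensity m b x := fun {b} hb x =>
    integral_nonneg fun y => by
      have := (softCoulomb_pos hb (x - y)).le
      positivity
  have hcs := hasCompactSupport_norm_sq hφ.2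
  have hφ2 : Continuous fun x => ‖φ x‖ ^ 2 := hφ.1.continuous.norm.pow 2
  have hi : ∀ {f : R3 → ℝ}, Continuous f → Integrable fun x => f x * ‖φ x‖ ^ 2 := fun hf =>
    (hf.mul hφ2).integrable_of_hasCompactSupport hcs.mul_left
  have hi2 : Integrable fun x => (2 * c)⁻¹ * (softDensity m ε x * ‖φ x‖ ^ 2) :=
    (hi (continuous_softDensity m hε)).const_mul _
  have hi3 : Integrable fun x => C / c * ‖φ x‖ ^ 2 := hi continuous_const
  have hi4 : Integrable fun x =>
      ‖φ x‖ ^ 2 * ((softDensity m ε x - softDensity m b x) / h x) := by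
    have h1 : Continuous fun x => (softDensity m ε x - softDensity m b x) / h x :=
      ((continuous_softDensity m hε).sub (continuous_softDensity m hb)).div hhc
        fun x => (hpos x).ne'
    simpa only [mul_comm] using hi h1
  have h1 : (∫ x, (2 * c)⁻¹ * (softDensity m ε x * ‖φ x‖ ^ 2)) - ∫ x, C / c * ‖φ x‖ ^ 2
      ≤ ∫ x, gradSq φ x := by
    refine le_trans ?_ key
    rw [← integral_sub hi2 hi3]
    refine integral_mono (hi2.sub hi3) hi4 fun x => ?_
    have h2 : (2 * c)⁻¹ * softDensity m ε x ≤ softDensity m ε x / h x := by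
      rw [inv_mul_eq_div]
      exact div_le_div_of_nonneg_left (hUnn hε x) (hpos x) (hle x)
    have h3 : softDensity m b x / h x ≤ C / c :=
      div_le_div₀ ((hUnn hb x).trans (hC x)) (hC x) hc (hge x)
    simp only
    rw [sub_div]
    nlinarith [sq_nonneg ‖φ x‖]
  rw [integral_const_mul, integral_const_mul, sub_le_iff_le_add, inv_mul_le_iff₀ (by positivity)]
    at h1
  refine h1.trans (le_of_eq ?_)
  field_simp

/-- The constant in the lower bound for `-Δ (|x|² + ε²)^{-1/2}`. -/
noncomputable def softConst : ℝ := 3 * (√2)⁻¹ ^ 5 * volume.real (Metric.ball (0 : R3) 1)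

theorem softConst_pos : 0 < softConst := by
  unfold softConst
  have : 0 < volume.real (Metric.ball (0 : R3) 1) :=
    ENNReal.toReal_pos (Metric.measure_ball_pos _ _ one_pos).ne' measure_ball_lt_top.ne
  positivity

theorem le_softCoulomb_of_norm_lt {ε : ℝ} (hε : 0 < ε) {x : R3} (hx : ‖x‖ < ε) :
    (√2)⁻¹ * ε⁻¹ ≤ softCoulomb ε x := by
  unfold softCoulomb
  rw [← mul_inv]
  refine inv_anti₀ (Real.sqrt_pos.2 (softCoulomb_rad_pos hε x)) (Real.sqrt_le_iff.2 ⟨by positivity, ?_⟩)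
  rw [mul_pow, Real.sq_sqrt zero_le_two]
  nlinarith [norm_nonneg x]

/-- On the ball of radius ε about y the kernel is at least 3ε²(√2 ε)^{-5}, and the ball has volume
ε³|B₁|. The powers of ε cancel and leave `softConst`, so a lower bound replaces the limit of an
approximate identity. If the left side is nonpositive there is nothing to prove. -/
theorem le_integral_softCoulomb_mul (hφ : IsTestFunction φ) {ε δ : ℝ} (hε : 0 < ε) (y : R3)
    (h : ∀ x, ‖x - y‖ < ε → ‖φ y‖ ^ 2 - δ ≤ ‖φ x‖ ^ 2) :
    softConst * (‖φ y‖ ^ 2 - δ) ≤ ∫ x, 3 * ε ^ 2 * softCoulomb ε (x - y) ^ 5 * ‖φ x‖ ^ 2 := by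
  have hnn : ∀ x, 0 ≤ 3 * ε ^ 2 * softCoulomb ε (x - y) ^ 5 * ‖φ x‖ ^ 2 := fun x => by
    have := (softCoulomb_pos hε (x - y)).le
    positivity
  rcases le_total (‖φ y‖ ^ 2 - δ) 0 with h0 | h0
  · exact (mul_nonpos_of_nonneg_of_nonpos softConst_pos.le h0).trans (integral_nonneg hnn)
  have hi : Integrable fun x => 3 * ε ^ 2 * softCoulomb ε (x - y) ^ 5 * ‖φ x‖ ^ 2 := by
    refine Continuous.integrable_of_hasCompactSupport ?_ (hasCompactSupport_norm_sq hφ.2).mul_left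
    have h1 := (continuous_softCoulomb_pow hε 5).comp (continuous_sub_right y)
    exact (continuous_const.mul h1).mul (hφ.1.continuous.norm.pow 2)
  refine le_trans ?_ (setIntegral_le_integral (s := Metric.ball y ε) hi (Eventually.of_forall hnn))
  have hvol : volume.real (Metric.ball y ε) = ε ^ 3 * volume.real (Metric.ball (0 : R3) 1) := by
    unfold Measure.real
    rw [Measure.addHaar_ball_of_pos _ _ hε, ENNReal.toReal_mul, ENNReal.toReal_ofReal (by positivity)]
    simp
  have h2 : ∫ x in Metric.ball y ε, 3 * (√2)⁻¹ ^ 5 * ε⁻¹ ^ 3 * (‖φ y‖ ^ 2 - δ)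
      = softConst * (‖φ y‖ ^ 2 - δ) := by
    rw [setIntegral_const, hvol, softConst, smul_eq_mul]
    field_simp
  rw [← h2]
  refine setIntegral_mono_on (integrableOn_const (by finiteness)) hi.integrableOn
    measurableSet_ball fun x hx => ?_
  have hx' : ‖x - y‖ < ε := by simpa [dist_eq_norm] using hx
  have h3 := le_softCoulomb_of_norm_lt hε hx'
  calc 3 * (√2)⁻¹ ^ 5 * ε⁻¹ ^ 3 * (‖φ y‖ ^ 2 - δ)
      = 3 * ε ^ 2 * ((√2)⁻¹ * ε⁻¹) ^ 5 * (‖φ y‖ ^ 2 - δ) := by field_simp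
    _ ≤ 3 * ε ^ 2 * softCoulomb ε (x - y) ^ 5 * ‖φ x‖ ^ 2 := by
      have := softCoulomb_pos hε (x - y)
      gcongr
      exact h x hx'

/-- Fubini: for fixed ε the kernel is bounded, `m` is finite and |φ|² is integrable. -/
theorem integral_softDensity_mul (hφ : IsTestFunction φ) {ε : ℝ} (hε : 0 < ε) :
    Integrable (fun y => ∫ x, 3 * ε ^ 2 * softCoulomb ε (x - y) ^ 5 * ‖φ x‖ ^ 2) m ∧
    ∫ x, softDensity m ε x * ‖φ x‖ ^ 2
      = ∫ y, (∫ x, 3 * ε ^ 2 * softCoulomb ε (x - y) ^ 5 * ‖φ x‖ ^ 2) ∂m := by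
  have hφi : Integrable fun x => ‖φ x‖ ^ 2 :=
    (hφ.1.continuous.norm.pow 2).integrable_of_hasCompactSupport (hasCompactSupport_norm_sq hφ.2)
  have hp : Integrable (fun p : R3 × R3 => 3 * ε ^ 2 * softCoulomb ε (p.1 - p.2) ^ 5 * ‖φ p.1‖ ^ 2)
      (volume.prod m) := by
    refine (hφi.comp_fst m).bdd_mul (c := 3 * ε ^ 2 * ε⁻¹ ^ 5) ?_ (Eventually.of_forall fun p => ?_)
    · have h1 := (continuous_softCoulomb_pow hε 5).comp
        (continuous_fst.sub continuous_snd : Continuous fun p : R3 × R3 => p.1 - p.2)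
      exact (continuous_const.mul h1).aestronglyMeasurable
    · rw [norm_mul, Real.norm_of_nonneg (by positivity)]
      gcongr
      exact abs_softCoulomb_pow_le hε 5 _
  refine ⟨hp.integral_prod_right, ?_⟩
  rw [← integral_integral_swap hp]
  refine integral_congr_ae (Eventually.of_forall fun x => ?_)
  simp only [softDensity, integral_mul_const]

theorem exists_pos_norm_sq_sub_le (hφ : IsTestFunction φ) {δ : ℝ} (hδ : 0 < δ) :
    ∃ r : ℝ, 0 < r ∧ ∀ x y, ‖x - y‖ < r → ‖φ y‖ ^ 2 - δ ≤ ‖φ x‖ ^ 2 := by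
  have hu : UniformContinuous fun x => ‖φ x‖ ^ 2 :=
    (hasCompactSupport_norm_sq hφ.2).uniformContinuous_of_continuous
      (hφ.1.continuous.norm.pow 2)
  obtain ⟨r, hr, h⟩ := Metric.uniformContinuous_iff.1 hu δ hδ
  refine ⟨r, hr, fun x y hxy => ?_⟩
  have := h (by rwa [dist_eq_norm] : dist x y < r)
  rw [Real.dist_eq, abs_lt] at this
  linarith

/-- The form bound for a finite measure: a bound on the potential of the kernel
`(|x|² + ε²)^{-1/2} - (|x|² + b²)^{-1/2}`, uniform in `ε`, controls `∫ |φ|² dm`. -/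
theorem softConst_mul_integral_le (hφ : IsTestFunction φ) {b c C : ℝ} (hb : 0 < b) (hc : 0 < c)
    (hW : ∀ ε, 0 < ε → ε ≤ b → ∀ x,
      ∫ y, (softCoulomb ε (x - y) - softCoulomb b (x - y)) ∂m ≤ c)
    (hC : ∀ x, softDensity m b x ≤ C) :
    softConst * ∫ x, ‖φ x‖ ^ 2 ∂m ≤ 2 * c * (∫ x, gradSq φ x) + 2 * C * ∫ x, ‖φ x‖ ^ 2 := by
  have hφm : Integrable (fun x => ‖φ x‖ ^ 2) m :=
    (hφ.1.continuous.norm.pow 2).integrable_of_hasCompactSupport (hasCompactSupport_norm_sq hφ.2)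
  -- Here δ bounds the drop of |φ|² over distances below r, and ε = min r b is small enough for both
  -- purposes. The error m(ℝ³)δ disappears as δ → 0 because `m` is finite.
  have key : ∀ δ : ℝ, 0 < δ → softConst * ((∫ x, ‖φ x‖ ^ 2 ∂m) - m.real Set.univ * δ)
      ≤ 2 * c * (∫ x, gradSq φ x) + 2 * C * ∫ x, ‖φ x‖ ^ 2 := fun δ hδ => by
    obtain ⟨r, hr, h⟩ := exists_pos_norm_sq_sub_le hφ hδ
    have hε : 0 < min r b := lt_min hr hb
    refine le_trans ?_ (integral_softDensity_mul_le m hφ hε (min_le_right r b) hc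
      (hW _ hε (min_le_right r b)) hC)
    obtain ⟨h1, h2⟩ := integral_softDensity_mul m hφ hε
    rw [h2]
    have h3 : softConst * ((∫ x, ‖φ x‖ ^ 2 ∂m) - m.real Set.univ * δ)
        = ∫ y, softConst * (‖φ y‖ ^ 2 - δ) ∂m := by
      rw [integral_const_mul, integral_sub hφm (integrable_const δ), integral_const, smul_eq_mul]
    rw [h3]
    exact integral_mono ((hφm.sub (integrable_const δ)).const_mul _) h1 fun y =>
      le_integral_softCoulomb_mul hφ hε y fun x hx => h x y (hx.trans_le (min_le_left r b))
  have hlim : Tendsto (fun δ : ℝ => softConst * ((∫ x, ‖φ x‖ ^ 2 ∂m) - m.real Set.univ * δ))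
      (𝓝[>] 0) (𝓝 (softConst * ((∫ x, ‖φ x‖ ^ 2 ∂m) - m.real Set.univ * 0))) :=
    (Continuous.tendsto (by fun_prop) 0).mono_left nhdsWithin_le_nhds
  rw [mul_zero, sub_zero] at hlim
  exact le_of_tendsto hlim (eventually_nhdsWithin_of_forall key)

end formBound

/-! ### Gluing measures given on an exhaustion by balls -/

section glue

/-- The measure on `ℝ³` whose restrictions to the balls `B(0, n)` are the `p n`. -/
noncomputable def glueMeasure (p : ℕ → Measure R3) : Measure R3 :=
  Measure.sum fun n =>
    (p (n + 1)).restrict (Metric.ball (0 : R3) ((n + 1 : ℕ) : ℝ) \ Metric.ball 0 (n : ℝ))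

/-- The measures `p n` on the balls `B(0, n)` are compatible. -/
def IsCompatible (p : ℕ → Measure R3) : Prop :=
  ∀ m n : ℕ, m ≤ n → (p n).restrict (Metric.ball (0 : R3) (m : ℝ)) = p m

variable {p : ℕ → Measure R3}

/-- Telescoping over the shells B(0, k+1) \ B(0, k). It makes the partial sums of the glued measure
equal to the given measures. -/
theorem IsCompatible.eq_sum (hp : IsCompatible p) (n : ℕ) :
    p n = ∑ k ∈ Finset.range n,
      (p (k + 1)).restrict (Metric.ball (0 : R3) ((k + 1 : ℕ) : ℝ) \ Metric.ball 0 (k : ℝ)) := by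
  induction n with
  | zero => rw [Finset.sum_range_zero, ← hp 0 0 le_rfl]; simp
  | succ n ih =>
    rw [Finset.sum_range_succ, ← ih]
    have hsub : Metric.ball (0 : R3) (n : ℝ) ⊆ Metric.ball 0 ((n + 1 : ℕ) : ℝ) :=
      Metric.ball_subset_ball (by simp)
    conv_lhs => rw [← hp (n + 1) (n + 1) le_rfl, ← Measure.restrict_inter_add_sdiff
      (Metric.ball (0 : R3) ((n + 1 : ℕ) : ℝ)) (measurableSet_ball (x := (0 : R3)) (ε := (n : ℝ)))]
    rw [Set.inter_eq_right.2 hsub, hp n (n + 1) n.le_succ]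

theorem lintegral_glueMeasure (hp : IsCompatible p) (f : R3 → ℝ≥0∞) :
    ∫⁻ x, f x ∂glueMeasure p = ⨆ n, ∫⁻ x, f x ∂p n := by
  rw [glueMeasure, lintegral_sum_measure, ENNReal.tsum_eq_iSup_nat]
  refine iSup_congr fun n => ?_
  conv_rhs => rw [hp.eq_sum n, lintegral_finsetSum_measure]

theorem glueMeasure_apply (hp : IsCompatible p) {s : Set R3} (hs : MeasurableSet s) :
    glueMeasure p s = ⨆ n, p n s := by
  simpa [lintegral_indicator_one hs] using lintegral_glueMeasure hp (s.indicator 1)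

theorem glueMeasure_restrict (hp : IsCompatible p) (n : ℕ) :
    (glueMeasure p).restrict (Metric.ball 0 (n : ℝ)) = p n := by
  ext s hs
  rw [Measure.restrict_apply hs, glueMeasure_apply hp (hs.inter measurableSet_ball)]
  -- The supremum over k is attained at k = n: larger balls add nothing inside B(0, n), smaller ones
  -- see less.
  have h1 : ∀ k, p k (s ∩ Metric.ball 0 (n : ℝ)) ≤ p n s := fun k => by
    rw [← Measure.restrict_apply hs]
    rcases le_total n k with h | h
    · rw [hp n k h]
    · refine Measure.restrict_apply_le _ _ |>.trans ?_
      rw [← hp k n h]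
      exact Measure.restrict_apply_le _ _
  refine le_antisymm (iSup_le h1) ?_
  refine le_iSup_of_le n (le_of_eq ?_)
  rw [← Measure.restrict_apply hs, hp n n le_rfl]

theorem le_glueMeasure (hp : IsCompatible p) (n : ℕ) : p n ≤ glueMeasure p := by
  rw [← glueMeasure_restrict hp n]
  exact Measure.restrict_le_self

theorem sFinite_glueMeasure (h : ∀ n, IsFiniteMeasure (p n)) : SFinite (glueMeasure p) := by
  unfold glueMeasure
  infer_instance

theorem integrable_glueMeasure {E : Type*} [NormedAddCommGroup E] (hp : IsCompatible p)
    (h : ∀ n, IsFiniteMeasure (p n)) {f : R3 → E} (hf : Continuous f) (hc : HasCompactSupport f) :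
    Integrable f (glueMeasure p) := by
  obtain ⟨r, hr⟩ := hc.isCompact.isBounded.subset_ball (0 : R3)
  obtain ⟨N, hN⟩ := exists_nat_ge r
  have hs : Function.support f ⊆ Metric.ball 0 (N : ℝ) :=
    (subset_tsupport f).trans (hr.trans (Metric.ball_subset_ball hN))
  rw [← integrableOn_iff_integrable_of_support_subset hs, IntegrableOn, glueMeasure_restrict hp]
  exact hf.integrable_of_hasCompactSupport hc

end glue

/-! ### The total variation of a locally finite complex measure -/

namespace LocMeasure

variable (V : LocMeasure)

theorem isCompatible_variation : IsCompatible fun n => (V.1 n).variation := fun m n h => by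
  have h1 : (V.1 n).restrict (Metric.ball (0 : R3) (m : ℝ)) = V.1 m := V.2 m n h
  have h2 := VectorMeasure.variation_restrict (μ := V.1 n)
    (measurableSet_ball (x := (0 : R3)) (ε := (m : ℝ)))
  rw [h1] at h2
  exact h2.symm

/-- The total variation `|V|`. -/
noncomputable def absMeasure : Measure R3 := glueMeasure fun n => (V.1 n).variation

/-- The suprema over balls in the Kato norm and in the local Kato property become integrals against
a single s-finite measure, to which Tonelli applies. -/
theorem lintegralAbs_eq (f : R3 → ℝ≥0∞) : V.lintegralAbs f = ∫⁻ x, f x ∂V.absMeasure :=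
  (lintegral_glueMeasure V.isCompatible_variation f).symm

theorem absMeasure_restrict (n : ℕ) :
    V.absMeasure.restrict (Metric.ball 0 (n : ℝ)) = (V.1 n).variation :=
  glueMeasure_restrict V.isCompatible_variation n

instance : SFinite V.absMeasure := sFinite_glueMeasure fun n => isFiniteMeasure_variation (V.1 n)

end LocMeasure

theorem lintegral_inv_enorm_sub_le (V : LocMeasure) (y : R3) :
    ∫⁻ x, ‖x - y‖ₑ⁻¹ ∂V.absMeasure ≤ katoENorm V := by
  rw [← LocMeasure.lintegralAbs_eq]
  exact le_iSup (fun y => V.lintegralAbs fun x => ‖x - y‖ₑ⁻¹) y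

/-! ### The local Kato property for elements of `𝒦₀` -/

/-- The singularity has order 1, below the dimension 3. -/
theorem lintegral_inv_enorm_ball_ne_top :
    ∫⁻ x in Metric.ball (0 : R3) 1, ‖x‖ₑ⁻¹ ≠ ⊤ := by
  have h : LocallyIntegrable (fun x : R3 => ‖x‖⁻¹) := by
    refine locallyIntegrable_of_norm_le_rpow (C := 1) (α := 1) (by simp) (by simp)
      (Eventually.of_forall fun x => ?_) (by fun_prop)
    rw [Real.rpow_neg_one, one_mul, norm_inv, norm_norm]
  have h1 := ((h.integrableOn_isCompact (isCompact_closedBall (0 : R3) 1)).mono_set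
    Metric.ball_subset_closedBall).2
  refine ne_of_lt (lt_of_eq_of_lt (lintegral_congr_ae ?_) h1)
  refine ae_restrict_of_ae ?_
  -- The origin is removed because there the real inverse is 0 while the inverse in `ℝ≥0∞` is ⊤.
  filter_upwards [compl_mem_ae_iff.2 (measure_singleton (0 : R3))] with x hx
  rw [enorm_inv (by simpa using hx), enorm_norm]

theorem lintegral_ball_inv_enorm_sub (y : R3) (ε : ℝ) :
    ∫⁻ x, (Metric.ball y ε).indicator (fun x => ‖x - y‖ₑ⁻¹) x
      = ∫⁻ x in Metric.ball (0 : R3) ε, ‖x‖ₑ⁻¹ := by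
  rw [← lintegral_indicator measurableSet_ball,
    ← lintegral_sub_right_eq_self ((Metric.ball (0 : R3) ε).indicator fun x => ‖x‖ₑ⁻¹) y]
  refine lintegral_congr fun x => ?_
  have h : x ∈ Metric.ball y ε ↔ x - y ∈ Metric.ball 0 ε := by
    rw [mem_ball_zero_iff, Metric.mem_ball, dist_eq_norm]
  by_cases hx : x ∈ Metric.ball y ε
  · rw [Set.indicator_of_mem hx, Set.indicator_of_mem (h.1 hx)]
  · rw [Set.indicator_of_notMem hx, Set.indicator_of_notMem fun h' => hx (h.2 h')]

theorem tendsto_lintegral_ball_inv_enorm :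
    Tendsto (fun ε : ℝ => ∫⁻ x in Metric.ball (0 : R3) ε, ‖x‖ₑ⁻¹) (𝓝[>] 0) (𝓝 0) := by
  have h : Tendsto (fun ε : ℝ => (volume.restrict (Metric.ball (0 : R3) 1)) (Metric.ball 0 ε))
      (𝓝[>] 0) (𝓝 0) := by
    have h1 : Tendsto (fun ε : ℝ => ENNReal.ofReal (ε ^ 3) * volume (Metric.ball (0 : R3) 1))
        (𝓝[>] 0) (𝓝 (ENNReal.ofReal ((0 : ℝ) ^ 3) * volume (Metric.ball (0 : R3) 1))) := by
      refine ENNReal.Tendsto.mul_const ?_ (Or.inr measure_ball_lt_top.ne)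
      exact ((ENNReal.continuous_ofReal.comp (continuous_pow 3)).tendsto 0).mono_left
        nhdsWithin_le_nhds
    simp only [ne_eq, OfNat.ofNat_ne_zero, not_false_eq_true, zero_pow, ENNReal.ofReal_zero,
      zero_mul] at h1
    refine tendsto_of_tendsto_of_tendsto_of_le_of_le' tendsto_const_nhds h1
      (Eventually.of_forall fun _ => zero_le) ?_
    filter_upwards [self_mem_nhdsWithin] with ε hε
    refine (Measure.restrict_apply_le _ _).trans (le_of_eq ?_)
    rw [Measure.addHaar_ball_of_pos _ _ hε]
    simp
  refine (tendsto_setLIntegral_zero lintegral_inv_enorm_ball_ne_top h).congr' ?_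
  filter_upwards [Ioo_mem_nhdsGT (one_pos : (0 : ℝ) < 1)] with ε hε
  rw [Measure.restrict_restrict measurableSet_ball,
    Set.inter_eq_left.2 (Metric.ball_subset_ball hε.2.le)]

/-- The quantity `sup_y ∫_{|x-y|<ε} d|V|(x) / |x - y|`. -/
noncomputable def localKato (V : LocMeasure) (ε : ℝ) : ℝ≥0∞ :=
  ⨆ y : R3, V.lintegralAbs ((Metric.ball y ε).indicator fun x => ‖x - y‖ₑ⁻¹)

/-- The error term does not depend on ε, so the local Kato property passes to limits in the Kato
norm. -/
theorem localKato_le_add (V W : LocMeasure) (ε : ℝ) :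
    localKato V ε ≤ localKato W ε + katoENorm (V - W) := by
  refine iSup_le fun y => ?_
  conv_lhs => rw [← add_sub_cancel W V]
  refine (LocMeasure.lintegralAbs_add_le _ _ _).trans (add_le_add
    (le_iSup (fun y => W.lintegralAbs ((Metric.ball y ε).indicator fun x => ‖x - y‖ₑ⁻¹)) y) ?_)
  refine le_trans ?_ (le_iSup (fun y => (V - W).lintegralAbs fun x => ‖x - y‖ₑ⁻¹) y)
  rw [LocMeasure.lintegralAbs_eq, LocMeasure.lintegralAbs_eq]
  exact lintegral_mono (Set.indicator_le_self _ _)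

/-- The variation is at most C dx with C = sup |φ|, and the integral of 1/|x - y| over a ball about
y does not depend on y. -/
theorem hasLocalKatoProperty_ofFunction {φ : R3 → ℂ} (h : IsTestFunction φ) :
    HasLocalKatoProperty (LocMeasure.ofFunction φ h.locallyIntegrable) := by
  obtain ⟨C, hC⟩ := h.2.exists_bound_of_continuous h.1.continuous
  have hle : ∀ ε, localKato (LocMeasure.ofFunction φ h.locallyIntegrable) ε
      ≤ ENNReal.ofReal C * ∫⁻ x in Metric.ball (0 : R3) ε, ‖x‖ₑ⁻¹ := fun ε => by
    refine iSup_le fun y => iSup_le fun n => ?_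
    have h1 : ((LocMeasure.ofFunction φ h.locallyIntegrable).1 n).variation
        ≤ ENNReal.ofReal C • volume := by
      refine (le_of_eq (Measure.variation_withDensityᵥ
        (h.1.continuous.integrable_of_hasCompactSupport h.2))).trans ?_
      refine (withDensity_mono (g := fun _ => ENNReal.ofReal C)
        (Eventually.of_forall fun x => ?_)).trans ?_
      · rw [← ofReal_norm]
        exact ENNReal.ofReal_le_ofReal (hC x)
      · rw [withDensity_const]
        refine Measure.le_iff'.2 fun s => ?_
        rw [Measure.smul_apply, Measure.smul_apply, smul_eq_mul, smul_eq_mul]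
        gcongr
        exact Measure.restrict_le_self
    refine (lintegral_mono' h1 le_rfl).trans (le_of_eq ?_)
    rw [lintegral_smul_measure, lintegral_ball_inv_enorm_sub, smul_eq_mul]
  have h2 := ENNReal.Tendsto.const_mul (a := ENNReal.ofReal C) tendsto_lintegral_ball_inv_enorm
    (Or.inr ENNReal.ofReal_ne_top)
  rw [mul_zero] at h2
  exact tendsto_of_tendsto_of_tendsto_of_le_of_le tendsto_const_nhds h2 (fun _ => zero_le) hle

theorem hasLocalKatoProperty_of_mem_kato₀ {V : KatoClass} (hV : V ∈ kato₀) :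
    HasLocalKatoProperty V.toLoc := by
  unfold HasLocalKatoProperty
  rw [ENNReal.tendsto_nhds_zero]
  intro δ hδ
  -- The tolerance may be ⊤, so a real radius below half of it is picked separately in that case.
  obtain ⟨r, hr0, hr⟩ : ∃ r : ℝ, 0 < r ∧ ENNReal.ofReal r ≤ δ / 2 := by
    rcases eq_or_ne δ ⊤ with rfl | hδt
    · exact ⟨1, one_pos, by simp [ENNReal.top_div]⟩
    · exact ⟨(δ / 2).toReal, ENNReal.toReal_pos (by simpa using hδ.ne') (by finiteness),
        ENNReal.ofReal_toReal_le⟩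
  obtain ⟨W, ⟨φ, hφ, hW⟩, hVW⟩ := Metric.mem_closure_iff.1 hV r hr0
  have h1 := ENNReal.tendsto_nhds_zero.1 (hasLocalKatoProperty_ofFunction hφ) (δ / 2)
    (by simpa using hδ.ne')
  filter_upwards [h1] with ε hε
  refine (localKato_le_add V.toLoc W.toLoc ε).trans ?_
  rw [← ENNReal.add_halves δ]
  refine add_le_add (by rw [hW]; exact hε) (le_trans ?_ hr)
  rw [dist_eq_norm] at hVW
  have h2 : katoENorm (V.toLoc - W.toLoc) ≠ ⊤ := (V - W).2
  rw [← ENNReal.ofReal_toReal h2]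
  exact ENNReal.ofReal_le_ofReal hVW.le

/-! ### The form bound for the Kato class -/

theorem ofReal_softCoulomb_le {ε : ℝ} (hε : 0 < ε) (z : R3) :
    ENNReal.ofReal (softCoulomb ε z) ≤ ‖z‖ₑ⁻¹ := by
  rw [ENNReal.le_inv_iff_mul_le, ← ofReal_norm, ← ENNReal.ofReal_mul (softCoulomb_pos hε z).le]
  exact ENNReal.ofReal_le_one.2 (softCoulomb_mul_norm_le hε z)

/-- The first term is replaced by 1/|z|, which removes ε. With s = (|z|²+b²)^{-1/2} and |z|s ≤ 1,
one has 1/|z| - s ≤ 1/|z| - |z|s² = b²s²/|z|, and s² ≤ 1/ρ². -/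
theorem ofReal_softCoulomb_sub_le {ε b ρ : ℝ} (hε : 0 < ε) (hb : 0 < b) (hρ : 0 < ρ) {z : R3}
    (hz : ρ ≤ ‖z‖) :
    ENNReal.ofReal (softCoulomb ε z - softCoulomb b z)
      ≤ ENNReal.ofReal (b ^ 2 / ρ ^ 2) * ‖z‖ₑ⁻¹ := by
  have hz0 : 0 < ‖z‖ := hρ.trans_le hz
  have h1 : softCoulomb ε z ≤ ‖z‖⁻¹ := by
    rw [← one_div, le_div_iff₀ hz0]
    exact softCoulomb_mul_norm_le hε z
  have h2 : ‖z‖⁻¹ - softCoulomb b z ≤ b ^ 2 / ρ ^ 2 * ‖z‖⁻¹ := by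
    have h3 : ‖z‖ * softCoulomb b z ^ 2 ≤ softCoulomb b z := by
      have := softCoulomb_mul_norm_le hb z
      have h0 := softCoulomb_pos hb z
      nlinarith
    have h4 := softCoulomb_sq hb z
    have h5 : softCoulomb b z ^ 2 ≤ (ρ ^ 2)⁻¹ := by
      rw [← one_div, le_div_iff₀ (by positivity), ← h4]
      gcongr
      nlinarith [sq_nonneg b]
    have h6 : ‖z‖⁻¹ - ‖z‖ * softCoulomb b z ^ 2 = b ^ 2 * softCoulomb b z ^ 2 * ‖z‖⁻¹ := by
      field_simp
      linear_combination -h4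
    have h7 : b ^ 2 * softCoulomb b z ^ 2 * ‖z‖⁻¹ ≤ b ^ 2 * (ρ ^ 2)⁻¹ * ‖z‖⁻¹ := by gcongr
    rw [div_eq_mul_inv]
    linarith
  have h3 : ‖z‖ₑ⁻¹ = ENNReal.ofReal ‖z‖⁻¹ := by
    rw [ENNReal.ofReal_inv_of_pos hz0, ofReal_norm]
  rw [h3, ← ENNReal.ofReal_mul (by positivity)]
  exact ENNReal.ofReal_le_ofReal (by linarith)

theorem ofReal_softCoulomb_pow_le {b : ℝ} (hb : 0 < b) (z : R3) :
    ENNReal.ofReal (3 * b ^ 2 * softCoulomb b z ^ 5) ≤ ENNReal.ofReal (3 / b ^ 2) * ‖z‖ₑ⁻¹ := by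
  refine le_trans ?_ (mul_le_mul_right (ofReal_softCoulomb_le hb z) _)
  rw [← ENNReal.ofReal_mul (by positivity)]
  refine ENNReal.ofReal_le_ofReal ?_
  have h0 := softCoulomb_pos hb z
  have h1 : softCoulomb b z ^ 4 ≤ b⁻¹ ^ 4 := by
    gcongr
    exact softCoulomb_le_inv hb z
  calc 3 * b ^ 2 * softCoulomb b z ^ 5 = 3 * b ^ 2 * softCoulomb b z ^ 4 * softCoulomb b z := by ring
    _ ≤ 3 * b ^ 2 * b⁻¹ ^ 4 * softCoulomb b z := by gcongr
    _ = _ := by field_simp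

theorem integral_le_of_lintegral_le {m M : Measure R3} (hm : m ≤ M) {g : R3 → ℝ}
    {F : R3 → ℝ≥0∞} {c : ℝ} (hc : 0 ≤ c) (hg : ∀ x, 0 ≤ g x) (hgm : Measurable g)
    (hgF : ∀ x, ENNReal.ofReal (g x) ≤ F x) (hF : ∫⁻ x, F x ∂M ≤ ENNReal.ofReal c) :
    ∫ x, g x ∂m ≤ c := by
  rw [integral_eq_lintegral_of_nonneg_ae (Eventually.of_forall hg) hgm.aestronglyMeasurable]
  exact ENNReal.toReal_le_of_le_ofReal hc ((lintegral_mono' hm hgF).trans hF)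

theorem KatoClass.katoENorm_eq (V : KatoClass) : katoENorm V.toLoc = ENNReal.ofReal ‖V‖ :=
  (ENNReal.ofReal_toReal V.2).symm

/-- The potential of the kernel difference is split at distance ρ: the near part is controlled by
the local Kato property, the far part by (b²/ρ²)‖V‖. Each is at most c/2, uniformly in ε. -/
theorem exists_form_bound (V : KatoClass) (hV : HasLocalKatoProperty V.toLoc) {δ : ℝ}
    (hδ : 0 < δ) : ∃ C : ℝ, 0 ≤ C ∧ ∀ φ : R3 → ℂ, IsTestFunction φ →
      ∫ x, ‖φ x‖ ^ 2 ∂V.toLoc.absMeasure ≤ δ * (∫ x, gradSq φ x) + C * ∫ x, ‖φ x‖ ^ 2 := by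
  have hκ := softConst_pos
  -- Chosen so that 2c/`softConst` = δ.
  set c : ℝ := softConst * δ / 2 with hcdef
  have hc : 0 < c := by positivity
  obtain ⟨ρ, hρ, hloc⟩ : ∃ ρ : ℝ, 0 < ρ ∧ localKato V.toLoc ρ ≤ ENNReal.ofReal (c / 2) := by
    have h1 := ENNReal.tendsto_nhds_zero.1 hV (ENNReal.ofReal (c / 2)) (by simpa using hc)
    obtain ⟨ρ, h2, h3⟩ := (h1.and self_mem_nhdsWithin).exists
    exact ⟨ρ, h3, h2⟩
  obtain ⟨b, hb, hbc⟩ : ∃ b : ℝ, 0 < b ∧ b ^ 2 / ρ ^ 2 * ‖V‖ ≤ c / 2 := by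
    have h1 : Tendsto (fun b : ℝ => b ^ 2 / ρ ^ 2 * ‖V‖) (𝓝[>] 0) (𝓝 (0 ^ 2 / ρ ^ 2 * ‖V‖)) :=
      (Continuous.tendsto (by fun_prop) 0).mono_left nhdsWithin_le_nhds
    have h2 := (h1.eventually_le_const (u := c / 2) (by simpa using hc)).and self_mem_nhdsWithin
    obtain ⟨b, h3, h4⟩ := h2.exists
    exact ⟨b, h4, h3⟩
  -- The smeared density at scale b is at most (3/b²)‖V‖, because its kernel is at most (3/b²)/|z|.
  refine ⟨2 * (3 / b ^ 2 * ‖V‖) / softConst, by positivity, fun φ hφ => ?_⟩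
  obtain ⟨r, hr⟩ := hφ.2.isCompact.isBounded.subset_ball (0 : R3)
  obtain ⟨N, hN⟩ := exists_nat_ge r
  have hs : Function.support (fun x => ‖φ x‖ ^ 2) ⊆ Metric.ball 0 (N : ℝ) := fun x hx =>
    Metric.ball_subset_ball hN (hr (subset_tsupport φ fun h0 => hx (by simp [h0])))
  -- On the support of φ the measure |V| is replaced by a finite one, as the previous form bound
  -- requires. The constants are still computed from all of |V|, hence do not depend on φ.
  rw [← setIntegral_eq_integral_of_forall_compl_eq_zero (s := Metric.ball 0 (N : ℝ))
    fun x hx => by_contra fun h => hx (hs h), V.toLoc.absMeasure_restrict N]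
  have hfin := isFiniteMeasure_variation (V.toLoc.1 N)
  have hm : (V.toLoc.1 N).variation ≤ V.toLoc.absMeasure :=
    le_glueMeasure V.toLoc.isCompatible_variation N
  have hker : ∀ x : R3, ∫⁻ y, ‖x - y‖ₑ⁻¹ ∂V.toLoc.absMeasure ≤ ENNReal.ofReal ‖V‖ := fun x => by
    rw [← V.katoENorm_eq]
    simpa only [enorm_sub_rev x] using lintegral_inv_enorm_sub_le V.toLoc x
  have key := softConst_mul_integral_le (V.toLoc.1 N).variation hφ hb hc
    (C := 3 / b ^ 2 * ‖V‖) (fun ε hε hεb x => ?_) (fun x => ?_)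
  · rw [← mul_le_mul_iff_right₀ hκ]
    refine key.trans (le_of_eq ?_)
    rw [hcdef]
    field_simp
  · refine integral_le_of_lintegral_le hm (F := fun y =>
      (Metric.ball x ρ).indicator (fun y => ‖y - x‖ₑ⁻¹) y
        + ENNReal.ofReal (b ^ 2 / ρ ^ 2) * ‖x - y‖ₑ⁻¹) hc.le
      (fun y => sub_nonneg.2 (softCoulomb_anti hε hεb _)) ?_ (fun y => ?_) ?_
    · have h1 := (continuous_softCoulomb hε).measurable
      have h2 := (continuous_softCoulomb hb).measurable
      fun_prop
    · by_cases hy : y ∈ Metric.ball x ρ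
      · rw [Set.indicator_of_mem hy, enorm_sub_rev y x]
        refine le_trans (le_trans (ENNReal.ofReal_le_ofReal ?_) (ofReal_softCoulomb_le hε (x - y)))
          le_self_add
        linarith [softCoulomb_pos hb (x - y)]
      · rw [Set.indicator_of_notMem hy, zero_add]
        refine ofReal_softCoulomb_sub_le hε hb hρ ?_
        simpa [dist_eq_norm, norm_sub_rev] using hy
    · rw [lintegral_add_left (by measurability), lintegral_const_mul _ (by fun_prop)]
      calc _ ≤ ENNReal.ofReal (c / 2) + ENNReal.ofReal (b ^ 2 / ρ ^ 2) * ENNReal.ofReal ‖V‖ := by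
            gcongr
            · refine le_trans ?_ hloc
              rw [← LocMeasure.lintegralAbs_eq]
              exact le_iSup (fun y => V.toLoc.lintegralAbs
                ((Metric.ball y ρ).indicator fun x => ‖x - y‖ₑ⁻¹)) x
            · exact hker x
        _ ≤ ENNReal.ofReal (c / 2) + ENNReal.ofReal (c / 2) := by
            rw [← ENNReal.ofReal_mul (by positivity)]
            gcongr
        _ = ENNReal.ofReal c := by
            rw [← ENNReal.ofReal_add (by positivity) (by positivity), add_halves]
  · refine integral_le_of_lintegral_le hm (F := fun y => ENNReal.ofReal (3 / b ^ 2) * ‖x - y‖ₑ⁻¹)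
      (by positivity) (fun y => ?_) ?_ (fun y => ofReal_softCoulomb_pow_le hb _) ?_
    · have := softCoulomb_pos hb (x - y)
      positivity
    · have h2 := (continuous_softCoulomb hb).measurable
      fun_prop
    · rw [lintegral_const_mul _ (by fun_prop), ENNReal.ofReal_mul (by positivity)]
      gcongr
      exact hker x

/-! ### Operators associated with forms -/

section formOperator

open ContinuousLinearMap

variable {E L : Type*} [NormedAddCommGroup E] [InnerProductSpace ℂ E] [CompleteSpace E]
  [NormedAddCommGroup L] [InnerProductSpace ℂ L] [CompleteSpace L]
  {J : E →L[ℂ] L} {T : E →L[ℂ] E} {G : Submodule ℂ (L × L)}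

theorem inner_sub_smul_adjoint_comp (z : ℂ) (e : E) :
    inner ℂ e ((T - z • (adjoint J ∘L J)) e) = inner ℂ e (T e) - z * ((‖J e‖ ^ 2 : ℝ) : ℂ) := by
  rw [sub_apply, smul_apply, comp_apply, inner_sub_right, inner_smul_right, adjoint_inner_right,
    inner_self_eq_norm_sq_to_K]
  norm_cast

/-- Lax–Milgram: |⟨e, (T - zJ*J)e⟩| is bounded below by a multiple of ‖e‖². For nonreal z the
imaginary part controls ‖Je‖², and then the real part controls ‖e‖²; for Re z < -C the real part
alone suffices. -/
theorem isUnit_form_sub {C : ℝ} (hC : 0 ≤ C) (hreal : ∀ e, (inner ℂ e (T e)).im = 0)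
    (hbound : ∀ e, ‖e‖ ^ 2 / 2 - C * ‖J e‖ ^ 2 ≤ (inner ℂ e (T e)).re) {z : ℂ}
    (hz : z.im ≠ 0 ∨ z.re < -C) : IsUnit (T - z • (adjoint J ∘L J)) := by
  have hre : ∀ e, (inner ℂ e ((T - z • (adjoint J ∘L J)) e)).re
      = (inner ℂ e (T e)).re - z.re * ‖J e‖ ^ 2 := fun e => by
    rw [inner_sub_smul_adjoint_comp, Complex.sub_re, Complex.re_mul_ofReal]
  have him : ∀ e, (inner ℂ e ((T - z • (adjoint J ∘L J)) e)).im = -(z.im * ‖J e‖ ^ 2) := fun e => by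
    rw [inner_sub_smul_adjoint_comp, Complex.sub_im, Complex.im_mul_ofReal, hreal, zero_sub]
  suffices h : ∃ κ : ℝ, 0 < κ ∧ ∀ e,
      ‖e‖ ^ 2 * κ ≤ ‖(inner ℂ e ((T - z • (adjoint J ∘L J)) e) : ℂ)‖ by
    obtain ⟨κ, hκ, h⟩ := h
    refine isUnit_of_forall_le_norm_inner_map (𝕜 := ℂ) _ (c := ⟨κ, hκ.le⟩) hκ fun e => ?_
    rw [← norm_inner_symm]
    exact h e
  rcases hz with hz | hz
  · have hz' : 0 < |z.im| := abs_pos.2 hz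
    -- With X = |⟨e, (T - zJ*J)e⟩|, the estimates ‖Je‖² ≤ X/|Im z| and ‖e‖²/2 ≤ X + (C + |Re
    -- z|)‖Je‖² combine to this constant.
    refine ⟨(2 * (1 + (C + |z.re|) / |z.im|))⁻¹, by positivity, fun e => ?_⟩
    rw [← div_eq_mul_inv, div_le_iff₀ (by positivity)]
    set X := ‖(inner ℂ e ((T - z • (adjoint J ∘L J)) e) : ℂ)‖ with hX
    have h1 : ‖J e‖ ^ 2 ≤ X / |z.im| := by
      rw [le_div_iff₀ hz', mul_comm, ← abs_of_nonneg (sq_nonneg ‖J e‖), ← abs_mul, ← abs_neg, ← him]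
      exact Complex.abs_im_le_norm _
    have h2 : (inner ℂ e (T e)).re - z.re * ‖J e‖ ^ 2 ≤ X := by
      rw [← hre]
      exact Complex.re_le_norm _
    have h3 : z.re * ‖J e‖ ^ 2 ≤ |z.re| * ‖J e‖ ^ 2 := by
      gcongr
      exact le_abs_self _
    have h4 : (C + |z.re|) * ‖J e‖ ^ 2 ≤ (C + |z.re|) * (X / |z.im|) := by gcongr
    have h5 : X * (2 * (1 + (C + |z.re|) / |z.im|)) = 2 * X + 2 * ((C + |z.re|) * (X / |z.im|)) := by
      field_simp
    rw [h5]
    linarith [hbound e]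
  · refine ⟨1 / 2, by norm_num, fun e => ?_⟩
    refine le_trans ?_ (Complex.re_le_norm _)
    rw [hre]
    nlinarith [hbound e, sq_nonneg ‖J e‖]

/-- Single-valuedness: Je = 0 forces e = 0, hence J*f = Te = 0, so f is orthogonal to the dense
range of J. -/
theorem eq_zero_of_mem_formGraph (hJ : Function.Injective J) (hJd : DenseRange J)
    (hG : ∀ p : L × L, p ∈ G ↔ ∃ e, J e = p.1 ∧ T e = adjoint J p.2) (p : L × L) (hp : p ∈ G)
    (hp1 : p.1 = 0) : p.2 = 0 := by
  obtain ⟨e, he, hT⟩ := (hG p).1 hp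
  have h0 : e = 0 := hJ (by rw [he, hp1, map_zero])
  rw [h0, map_zero] at hT
  refine hJd.eq_zero_of_inner_left (𝕜 := ℂ) fun v => ?_
  rw [← adjoint_inner_left, ← hT, inner_zero_left]

theorem notMem_operatorSpectrum_of_isUnit (hJ : Function.Injective J) (hJd : DenseRange J)
    (hG : ∀ p : L × L, p ∈ G ↔ ∃ e, J e = p.1 ∧ T e = adjoint J p.2) {z : ℂ}
    (hz : IsUnit (T - z • (adjoint J ∘L J))) : z ∉ operatorSpectrum G.toLinearPMap := by
  have hgr := G.toLinearPMap_graph_eq (eq_zero_of_mem_formGraph hJ hJd hG)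
  obtain ⟨S, hS⟩ := hz
  have hS1 : ∀ e, (T - z • (adjoint J ∘L J)) ((↑S⁻¹ : E →L[ℂ] E) e) = e := fun e => by
    rw [← hS, ← mul_apply_eq_comp, S.mul_inv, one_apply_eq_self]
  have hS2 : ∀ e, (↑S⁻¹ : E →L[ℂ] E) ((T - z • (adjoint J ∘L J)) e) = e := fun e => by
    rw [← hS, ← mul_apply_eq_comp, S.inv_mul, one_apply_eq_self]
  -- The resolvent is J S⁻¹ J*, where S = T - zJ*J: with e = S⁻¹J*f one has Te = J*(f + zJe), so
  -- (Je, f + zJe) lies in the graph.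
  refine not_not_intro ⟨J ∘L (↑S⁻¹ : E →L[ℂ] E) ∘L adjoint J, fun f => ?_, fun u => ?_⟩
  · have hmem : (J ((↑S⁻¹ : E →L[ℂ] E) (adjoint J f)),
        f + z • J ((↑S⁻¹ : E →L[ℂ] E) (adjoint J f))) ∈ G.toLinearPMap.graph := by
      rw [hgr, hG]
      refine ⟨(↑S⁻¹ : E →L[ℂ] E) (adjoint J f), rfl, ?_⟩
      have h1 := hS1 (adjoint J f)
      rw [sub_apply, sub_eq_iff_eq_add, smul_apply, comp_apply] at h1
      rw [h1, map_add, map_smul]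
    rw [LinearPMap.mem_graph_iff] at hmem
    obtain ⟨y, hy1, hy2⟩ := hmem
    simp only at hy1 hy2
    refine ⟨hy1 ▸ y.2, ?_⟩
    have h2 : (⟨(J ∘L (↑S⁻¹ : E →L[ℂ] E) ∘L adjoint J) f, hy1 ▸ y.2⟩ : G.toLinearPMap.domain) = y :=
      Subtype.ext hy1.symm
    rw [h2, hy2]
    exact add_sub_cancel_right _ _
  · have hu : ((u : L), G.toLinearPMap u) ∈ G :=
      (SetLike.ext_iff.1 hgr _).1 (LinearPMap.mem_graph _ u)
    obtain ⟨e, he, hT⟩ := (hG _).1 hu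
    simp only at he hT
    have h1 : adjoint J (G.toLinearPMap u - z • (u : L)) = (T - z • (adjoint J ∘L J)) e := by
      rw [map_sub, map_smul, ← hT, ← he, sub_apply, smul_apply, comp_apply]
    rw [comp_apply, comp_apply, h1, hS2, he]

end formOperator

/-! ### The Jordan decomposition of a real locally finite measure -/

/-- Both integrals are extensions by `setToFun` of set functions over the same measure, so it is
enough that the set functions agree. -/
theorem integral_withDensityᵥ_one (p : Measure R3) [IsFiniteMeasure p] (f : R3 → ℂ) :
    (p.withDensityᵥ fun _ => (1 : ℂ)).integral f (ContinuousLinearMap.mul ℝ ℂ) = ∫ x, f x ∂p := by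
  have h1 : Integrable (fun _ => (1 : ℂ)) p := integrable_const 1
  have hv : (p.withDensityᵥ fun _ => (1 : ℂ)).variation = p := by
    rw [Measure.variation_withDensityᵥ h1]
    simp
  rw [VectorMeasure.integral_eq_setToFun, MeasureTheory.integral_eq_setToFun]
  simp only [hv]
  refine setToFun_congr_left' _ _ (fun s hs _ => ?_) f
  ext
  simp [VectorMeasure.transpose, withDensityᵥ_apply h1 hs, weightedSMul_apply, Measure.real]

theorem variation_re_le (c : ComplexMeasure R3) : (ComplexMeasure.re c).variation ≤ c.variation :=
  VectorMeasure.variation_le_of_forall_enorm_le fun s _ => by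
    refine le_trans ?_ (VectorMeasure.enorm_measure_le_variation c s)
    rw [← ofReal_norm, ← ofReal_norm]
    exact ENNReal.ofReal_le_ofReal (Complex.abs_re_le_norm _)

namespace LocMeasure

variable (V : LocMeasure)

/-- The positive parts of the real parts of the measures `V` on the balls `B(0, n)`. -/
noncomputable def posSeq (n : ℕ) : Measure R3 :=
  (ComplexMeasure.re (V.1 n)).toJordanDecomposition.posPart

/-- The negative parts of the real parts of the measures `V` on the balls `B(0, n)`. -/
noncomputable def negSeq (n : ℕ) : Measure R3 :=
  (ComplexMeasure.re (V.1 n)).toJordanDecomposition.negPart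

instance (n : ℕ) : IsFiniteMeasure (V.posSeq n) := by unfold posSeq; infer_instance

instance (n : ℕ) : IsFiniteMeasure (V.negSeq n) := by unfold negSeq; infer_instance

theorem posSeq_add_negSeq_le (n : ℕ) : V.posSeq n + V.negSeq n ≤ (V.1 n).variation := by
  refine le_trans (le_of_eq ?_) (variation_re_le (V.1 n))
  rw [← SignedMeasure.totalVariation_eq_variation]
  rfl

/-- By uniqueness of the Jordan decomposition: the restricted parts are still mutually singular, and
their difference is the real part on the smaller ball. -/
theorem jordan_restrict {m n : ℕ} (h : m ≤ n) :
    V.posSeq m = (V.posSeq n).restrict (Metric.ball 0 (m : ℝ)) ∧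
      V.negSeq m = (V.negSeq n).restrict (Metric.ball 0 (m : ℝ)) := by
  set j := (ComplexMeasure.re (V.1 n)).toJordanDecomposition with hj
  let k : JordanDecomposition R3 :=
    { posPart := (V.posSeq n).restrict (Metric.ball 0 (m : ℝ))
      negPart := (V.negSeq n).restrict (Metric.ball 0 (m : ℝ))
      mutuallySingular := (j.mutuallySingular.mono_ac Measure.restrict_le_self.absolutelyContinuous
        Measure.restrict_le_self.absolutelyContinuous) }
  have hk : ComplexMeasure.re (V.1 m) = k.toSignedMeasure := by
    have hV : (V.1 n).restrict (Metric.ball (0 : R3) (m : ℝ)) = V.1 m := V.2 m n h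
    ext s hs
    have h2 : V.1 m s = V.1 n (s ∩ Metric.ball 0 (m : ℝ)) := by
      rw [← hV, VectorMeasure.restrict_apply _ measurableSet_ball hs]
    have h3 := SignedMeasure.apply_eq_posPart_real_sub_negPart_real
      (ComplexMeasure.re (V.1 n)) (hs.inter (measurableSet_ball (x := (0 : R3)) (ε := (m : ℝ))))
    have h4 : ComplexMeasure.re (V.1 m) s
        = ComplexMeasure.re (V.1 n) (s ∩ Metric.ball 0 (m : ℝ)) := congrArg Complex.re h2
    rw [h4, h3, JordanDecomposition.toSignedMeasure, _root_.sub_apply,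
      Measure.toSignedMeasure_apply_measurable hs, Measure.toSignedMeasure_apply_measurable hs,
      measureReal_restrict_apply hs, measureReal_restrict_apply hs]
    rfl
  have h5 := SignedMeasure.toJordanDecomposition_eq hk
  exact ⟨congrArg JordanDecomposition.posPart h5, congrArg JordanDecomposition.negPart h5⟩

theorem isCompatible_posSeq : IsCompatible V.posSeq := fun _ _ h => (V.jordan_restrict h).1.symm

theorem isCompatible_negSeq : IsCompatible V.negSeq := fun _ _ h => (V.jordan_restrict h).2.symm

/-- The positive part of a real locally finite measure. -/
noncomputable def posMeasure : Measure R3 := glueMeasure V.posSeq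

/-- The negative part of a real locally finite measure. -/
noncomputable def negMeasure : Measure R3 := glueMeasure V.negSeq

theorem posMeasure_le : V.posMeasure ≤ V.absMeasure := Measure.le_iff.2 fun s hs => by
  rw [posMeasure, absMeasure, glueMeasure_apply V.isCompatible_posSeq hs,
    glueMeasure_apply V.isCompatible_variation hs]
  exact iSup_mono fun n => ((Measure.le_add_right le_rfl).trans (V.posSeq_add_negSeq_le n)) s

theorem negMeasure_le : V.negMeasure ≤ V.absMeasure := Measure.le_iff.2 fun s hs => by
  rw [negMeasure, absMeasure, glueMeasure_apply V.isCompatible_negSeq hs,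
    glueMeasure_apply V.isCompatible_variation hs]
  exact iSup_mono fun n => ((Measure.le_add_left le_rfl).trans (V.posSeq_add_negSeq_le n)) s

variable {V}

theorem IsReal.eq_sub (hV : V.IsReal) (n : ℕ) :
    V.1 n = (V.posSeq n).withDensityᵥ (fun _ => (1 : ℂ))
      - (V.negSeq n).withDensityᵥ fun _ => (1 : ℂ) := by
  ext s hs
  have h3 := SignedMeasure.apply_eq_posPart_real_sub_negPart_real (ComplexMeasure.re (V.1 n)) hs
  have h4 : ComplexMeasure.re (V.1 n) s = (V.1 n s).re := rfl
  rw [_root_.sub_apply, withDensityᵥ_apply (integrable_const 1) hs,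
    withDensityᵥ_apply (integrable_const 1) hs, setIntegral_const, setIntegral_const]
  rw [h4] at h3
  refine Complex.ext ?_ ?_
  · rw [h3]
    simp [posSeq, negSeq]
  · rw [hV n s]
    simp

theorem IsReal.integral_eq (hV : V.IsReal) {f : R3 → ℂ} (hf : Continuous f)
    (hc : HasCompactSupport f) :
    V.integral f = (∫ x, f x ∂V.posMeasure) - ∫ x, f x ∂V.negMeasure := by
  obtain ⟨r, hr⟩ := hc.isCompact.isBounded.subset_ball (0 : R3)
  obtain ⟨N, hN⟩ := exists_nat_ge r
  refine tendsto_nhds_unique (V.tendsto_integral hc) (tendsto_const_nhds.congr' ?_)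
  filter_upwards [eventually_ge_atTop N] with n hn
  have hs : ∀ x ∉ Metric.ball (0 : R3) (n : ℝ), f x = 0 := fun x hx => by
    by_contra h
    exact hx (Metric.ball_subset_ball (hN.trans (by exact_mod_cast hn)) (hr (subset_tsupport f h)))
  have h1 := setIntegral_eq_integral_of_forall_compl_eq_zero (μ := V.posMeasure) hs
  have h2 := setIntegral_eq_integral_of_forall_compl_eq_zero (μ := V.negMeasure) hs
  rw [posMeasure, glueMeasure_restrict V.isCompatible_posSeq] at h1
  rw [negMeasure, glueMeasure_restrict V.isCompatible_negSeq] at h2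
  rw [posMeasure, negMeasure, ← h1, ← h2, hV.eq_sub n,
    VectorMeasure.integral_sub_vectorMeasure (integrable_variation _ hf hc)
      (integrable_variation _ hf hc), integral_withDensityᵥ_one, integral_withDensityᵥ_one]

end LocMeasure

/-! ### The Sobolev space `H¹` -/

/-- The space of test functions. -/
def testSubmodule : Submodule ℂ (R3 → ℂ) where
  carrier := {φ | IsTestFunction φ}
  add_mem' := fun ha hb => ha.add hb
  zero_mem' := ⟨contDiff_const, HasCompactSupport.zero⟩
  smul_mem' := fun c _ h => h.smul c

/-- A function together with its first derivatives. -/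
noncomputable def jet (φ : R3 → ℂ) : Option (Fin 3) → R3 → ℂ
  | none => φ
  | some i => fun x => fderiv ℝ φ x (basisVec i)

theorem IsTestFunction.memLp {φ : R3 → ℂ} (h : IsTestFunction φ) : MemLp φ 2 volume :=
  h.1.continuous.memLp_of_hasCompactSupport h.2

theorem IsTestFunction.memLp_jet {φ : R3 → ℂ} (h : IsTestFunction φ) (o : Option (Fin 3)) :
    MemLp (jet φ o) 2 volume := by
  cases o with
  | none => exact h.memLp
  | some i =>
    exact Continuous.memLp_of_hasCompactSupport (μ := volume) (h.continuous_fderiv_basisVec i)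
      (h.hasCompactSupport_fderiv_basisVec i)

theorem jet_add {φ χ : R3 → ℂ} (hφ : IsTestFunction φ) (hχ : IsTestFunction χ)
    (o : Option (Fin 3)) : jet (φ + χ) o = jet φ o + jet χ o := by
  cases o with
  | none => rfl
  | some i =>
    funext x
    simp [jet, fderiv_add (hφ.differentiable x) (hχ.differentiable x)]

theorem jet_smul {φ : R3 → ℂ} (c : ℂ) (hφ : IsTestFunction φ) (o : Option (Fin 3)) :
    jet (c • φ) o = c • jet φ o := by
  cases o with
  | none => rfl
  | some i =>
    funext x
    simp [jet, fderiv_const_smul (hφ.differentiable x)]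

/-- A test function together with its first derivatives, in `L²`. -/
noncomputable def jetL2 : testSubmodule →ₗ[ℂ] PiLp 2 (fun _ : Option (Fin 3) => L2) where
  toFun φ := WithLp.toLp 2 fun o => (φ.2.memLp_jet o).toLp (jet φ.1 o)
  map_add' φ χ := by
    ext1 o
    simp only [PiLp.add_apply, ← MemLp.toLp_add]
    exact MemLp.toLp_congr _ _ (by rw [← jet_add φ.2 χ.2]; rfl)
  map_smul' c φ := by
    ext1 o
    simp only [PiLp.smul_apply, RingHom.id_apply, ← MemLp.toLp_const_smul]
    exact MemLp.toLp_congr _ _ (by rw [← jet_smul c φ.2]; rfl)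

/-- The Sobolev space `H¹(ℝ³)`, as the closure of the space of test functions. -/
abbrev H1 : Type := (LinearMap.range jetL2).topologicalClosure

/-- The test functions, as elements of `H¹`. -/
noncomputable def testToH1 : testSubmodule →ₗ[ℂ] H1 :=
  jetL2.codRestrict _ fun φ =>
    (LinearMap.range jetL2).le_topologicalClosure (LinearMap.mem_range_self _ φ)

theorem denseRange_testToH1 : DenseRange testToH1 := by
  intro e
  rw [Topology.IsInducing.subtypeVal.closure_eq_preimage_closure_image]
  refine closure_mono ?_ e.2
  rintro _ ⟨φ, rfl⟩
  exact ⟨testToH1 φ, ⟨φ, rfl⟩, rfl⟩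

/-- The components of an element of `H¹`: the function and its weak derivatives. -/
noncomputable def H1.comp (o : Option (Fin 3)) : H1 →L[ℂ] L2 :=
  (PiLp.proj 2 (fun _ : Option (Fin 3) => L2) o : _ →L[ℂ] L2) ∘L
    (LinearMap.range jetL2).topologicalClosure.subtypeL

/-- The embedding of `H¹` into `L²`. -/
noncomputable abbrev H1.toL2 : H1 →L[ℂ] L2 := H1.comp none

theorem H1.comp_testToH1 (φ : testSubmodule) (o : Option (Fin 3)) :
    H1.comp o (testToH1 φ) = (φ.2.memLp_jet o).toLp (jet φ.1 o) := rfl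

theorem H1.norm_sq (e : H1) : ‖e‖ ^ 2 = ∑ o, ‖H1.comp o e‖ ^ 2 :=
  PiLp.norm_sq_eq_of_L2 _ (e : PiLp 2 (fun _ : Option (Fin 3) => L2))

theorem H1.inner_eq (e e' : H1) : inner ℂ e e' = ∑ o, inner ℂ (H1.comp o e) (H1.comp o e') := rfl

theorem inner_toLp {ν : Measure R3} {f g : R3 → ℂ} (hf : MemLp f 2 ν) (hg : MemLp g 2 ν) :
    inner ℂ (hf.toLp f) (hg.toLp g) = ∫ x, g x * conj (f x) ∂ν := by
  rw [L2.inner_def]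
  refine integral_congr_ae ?_
  filter_upwards [hf.coeFn_toLp, hg.coeFn_toLp] with x h1 h2
  rw [h1, h2, RCLike.inner_apply]

theorem norm_toLp_sq {ν : Measure R3} {f : R3 → ℂ} (hf : MemLp f 2 ν) :
    ‖hf.toLp f‖ ^ 2 = ∫ x, ‖f x‖ ^ 2 ∂ν := by
  have h := inner_toLp hf hf
  rw [inner_self_eq_norm_sq_to_K] at h
  simp only [Complex.mul_conj, Complex.normSq_eq_norm_sq, integral_complex_ofReal] at h
  refine Complex.ofReal_injective ?_
  rw [← h]
  simp

theorem norm_toL2_testToH1_sq (φ : testSubmodule) :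
    ‖H1.toL2 (testToH1 φ)‖ ^ 2 = ∫ x, ‖φ.1 x‖ ^ 2 :=
  norm_toLp_sq (φ.2.memLp_jet none)

theorem norm_testToH1_sq (φ : testSubmodule) :
    ‖testToH1 φ‖ ^ 2 = (∫ x, ‖φ.1 x‖ ^ 2) + ∫ x, gradSq φ.1 x := by
  rw [H1.norm_sq, Fintype.sum_option, norm_toL2_testToH1_sq]
  unfold gradSq
  rw [integral_finsetSum _ fun i _ => φ.2.integrable_normSq_fderiv i]
  exact congrArg _ (Finset.sum_congr rfl fun i _ => norm_toLp_sq (φ.2.memLp_jet (some i)))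

theorem denseRange_toL2_testToH1 :
    DenseRange fun φ : testSubmodule => H1.toL2 (testToH1 φ) := by
  refine (Lp.dense_hasCompactSupport_contDiff (E := R3) (F := ℂ) (μ := volume) (p := 2)
    (by simp)).mono ?_
  rintro f ⟨g, hfg, hc, hs⟩
  have hg : IsTestFunction g := ⟨hs, hc⟩
  refine ⟨⟨g, hg⟩, ?_⟩
  change hg.memLp.toLp g = f
  rw [← Lp.toLp_coeFn f (Lp.memLp f)]
  exact MemLp.toLp_congr _ _ hfg.symm

theorem eq_zero_of_inner_test {f : L2}
    (h : ∀ φ : testSubmodule, inner ℂ (H1.toL2 (testToH1 φ)) f = 0) : f = 0 :=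
  denseRange_toL2_testToH1.eq_zero_of_inner_right ℂ fun φ => h φ

theorem denseRange_toL2 : DenseRange H1.toL2 :=
  denseRange_toL2_testToH1.mono (Set.range_comp_subset_range _ _)

/-- The remaining components of an element of H¹ are its weak derivatives. The identity is
integration by parts for test functions and extends by density, both sides being continuous in `e`.
-/
theorem inner_comp_some (ψ : testSubmodule) (i : Fin 3) (e : H1) :
    inner ℂ (H1.toL2 (testToH1 ψ)) (H1.comp (some i) e)
      = -inner ℂ (H1.comp (some i) (testToH1 ψ)) (H1.toL2 e) := by
  refine denseRange_testToH1.induction_on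
    (p := fun e => inner ℂ (H1.toL2 (testToH1 ψ)) (H1.comp (some i) e)
      = -inner ℂ (H1.comp (some i) (testToH1 ψ)) (H1.toL2 e)) e
    (isClosed_eq (by fun_prop) (by fun_prop)) fun φ => ?_
  rw [H1.comp_testToH1, H1.comp_testToH1, H1.comp_testToH1, H1.comp_testToH1, inner_toLp,
    inner_toLp]
  have hψ := ψ.2
  have hφ := φ.2
  have hcs : ∀ x, HasFDerivAt (fun x => conj (ψ.1 x))
      ((Complex.conjCLE : ℂ →L[ℝ] ℂ) ∘L fderiv ℝ ψ.1 x) x := fun x =>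
    (Complex.conjCLE.hasFDerivAt).comp x (hψ.differentiable x).hasFDerivAt
  have hcf : ∀ x, fderiv ℝ (fun x => conj (ψ.1 x)) x (basisVec i)
      = conj (fderiv ℝ ψ.1 x (basisVec i)) := fun x => by rw [(hcs x).fderiv]; rfl
  have hψc : Continuous fun x => conj (ψ.1 x) := Complex.continuous_conj.comp hψ.1.continuous
  have hψd : Continuous fun x => conj (fderiv ℝ ψ.1 x (basisVec i)) :=
    Complex.continuous_conj.comp (hψ.continuous_fderiv_basisVec i)
  have h := integral_mul_fderiv_eq_neg_fderiv_mul_of_integrable (μ := volume) (𝕜 := ℂ)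
    (f := fun x => conj (ψ.1 x)) (g := φ.1) (v := basisVec i)
    ?_ ?_ ?_ (fun x _ => (hcs x).differentiableAt)
    fun x _ => hφ.differentiable x
  · simp only [hcf] at h
    simp only [jet]
    calc _ = _ := integral_congr_ae (Eventually.of_forall fun x => mul_comm _ _)
      _ = _ := h
      _ = _ := congrArg _ (integral_congr_ae (Eventually.of_forall fun x => mul_comm _ _))
  · simp only [hcf]
    exact (hψd.mul hφ.1.continuous).integrable_of_hasCompactSupport hφ.2.mul_left
  · exact (hψc.mul (hφ.continuous_fderiv_basisVec i)).integrable_of_hasCompactSupport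
      (hφ.hasCompactSupport_fderiv_basisVec i).mul_left
  · exact (hψc.mul hφ.1.continuous).integrable_of_hasCompactSupport hφ.2.mul_left

/-- Closability of the gradient: weak derivatives are determined by the function, so an element of
H¹ whose function part vanishes is 0. -/
theorem injective_toL2 : Function.Injective H1.toL2 := by
  rw [injective_iff_map_eq_zero]
  intro e he
  have h : ∀ o, H1.comp o e = 0 := fun o => by
    cases o with
    | none => exact he
    | some i =>
      refine eq_zero_of_inner_test fun ψ => ?_
      rw [inner_comp_some, he, inner_zero_right, neg_zero]
  rw [← norm_eq_zero, ← sq_eq_zero_iff, H1.norm_sq]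
  simp [h]

/-! ### The form operator on `H¹` -/

section hamiltonian

open ContinuousLinearMap

variable {ν : Measure R3}

/-- The restriction of test functions to `L²(ν)`. -/
noncomputable def testToLp (hν : ∀ φ : testSubmodule, MemLp φ.1 2 ν) :
    testSubmodule →ₗ[ℂ] Lp ℂ 2 ν where
  toFun φ := (hν φ).toLp φ.1
  map_add' φ χ := MemLp.toLp_add (hν φ) (hν χ)
  map_smul' c φ := MemLp.toLp_const_smul c (hν φ)

theorem LocMeasure.integrable_absMeasure (V : LocMeasure) {E : Type*} [NormedAddCommGroup E]
    {f : R3 → E} (hf : Continuous f) (hc : HasCompactSupport f) : Integrable f V.absMeasure :=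
  integrable_glueMeasure V.isCompatible_variation (fun n => isFiniteMeasure_variation (V.1 n)) hf hc

/-- The form bound with δ = 1/2 makes restriction to L²(ν) bounded for the H¹ norm, so it extends by
density. The constant serves every ν ≤ |V| and is used for both the positive and the negative part
of V. -/
theorem exists_trace (V : KatoClass) (hV : HasLocalKatoProperty V.toLoc) :
    ∃ C : ℝ, 0 ≤ C ∧ ∀ ν ≤ V.toLoc.absMeasure, ∃ τ : H1 →L[ℂ] Lp ℂ 2 ν,
      (∀ φ ψ : testSubmodule, inner ℂ (τ (testToH1 ψ)) (τ (testToH1 φ))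
        = ∫ x, φ.1 x * conj (ψ.1 x) ∂ν) ∧
      ∀ e, ‖τ e‖ ^ 2 ≤ ‖e‖ ^ 2 / 2 + C * ‖H1.toL2 e‖ ^ 2 := by
  obtain ⟨C, hC0, hC⟩ := exists_form_bound V hV (δ := 1 / 2) (by norm_num)
  refine ⟨C, hC0, fun ν hle => ?_⟩
  have hi : ∀ φ : testSubmodule, Integrable (fun x => ‖φ.1 x‖ ^ 2) V.toLoc.absMeasure := fun φ =>
    V.toLoc.integrable_absMeasure (φ.2.1.continuous.norm.pow 2) (hasCompactSupport_norm_sq φ.2.2)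
  have hν : ∀ φ : testSubmodule, MemLp φ.1 2 ν := fun φ =>
    (memLp_two_iff_integrable_sq_norm φ.2.1.continuous.aestronglyMeasurable).2
      ((hi φ).mono_measure hle)
  have hsq : ∀ φ : testSubmodule, ‖testToLp hν φ‖ ^ 2
      ≤ ‖testToH1 φ‖ ^ 2 / 2 + C * ‖H1.toL2 (testToH1 φ)‖ ^ 2 := fun φ => by
    have h1 : ‖testToLp hν φ‖ ^ 2 = ∫ x, ‖φ.1 x‖ ^ 2 ∂ν := norm_toLp_sq (hν φ)
    have h2 : ∫ x, ‖φ.1 x‖ ^ 2 ∂ν ≤ ∫ x, ‖φ.1 x‖ ^ 2 ∂V.toLoc.absMeasure :=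
      integral_mono_measure hle (Eventually.of_forall fun x => by positivity) (hi φ)
    have h3 := hC φ.1 φ.2
    have h4 : 0 ≤ ∫ x, ‖φ.1 x‖ ^ 2 := integral_nonneg fun x => by positivity
    rw [h1, norm_testToH1_sq, norm_toL2_testToH1_sq]
    linarith
  have hJ : ∀ e, ‖H1.toL2 e‖ ^ 2 ≤ ‖e‖ ^ 2 := fun e => by
    rw [H1.norm_sq e]
    exact Finset.single_le_sum (f := fun o => ‖H1.comp o e‖ ^ 2) (fun o _ => sq_nonneg _)
      (Finset.mem_univ none)
  -- A crude constant: 1/2 + C ≤ (1 + C)², and only the existence of a bound is needed for the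
  -- extension.
  have hb : ∀ φ, ‖testToLp hν φ‖ ≤ (1 + C) * ‖testToH1 φ‖ := fun φ => by
    refine abs_le_of_sq_le_sq' ?_ (by positivity) |>.2
    nlinarith [hsq φ, hJ (testToH1 φ), sq_nonneg ‖testToH1 φ‖, sq_nonneg (C * ‖testToH1 φ‖),
      mul_nonneg hC0 (sub_nonneg.2 (hJ (testToH1 φ))), mul_nonneg hC0 (sq_nonneg ‖testToH1 φ‖)]
  have heq : ∀ φ, (testToLp hν).extendOfNorm testToH1 (testToH1 φ) = testToLp hν φ := fun φ =>
    LinearMap.extendOfNorm_eq denseRange_testToH1 ⟨1 + C, hb⟩ φ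
  refine ⟨(testToLp hν).extendOfNorm testToH1, fun φ ψ => ?_, fun e => ?_⟩
  · rw [heq, heq]
    exact inner_toLp (hν ψ) (hν φ)
  · refine denseRange_testToH1.induction_on
      (p := fun e => ‖(testToLp hν).extendOfNorm testToH1 e‖ ^ 2
        ≤ ‖e‖ ^ 2 / 2 + C * ‖H1.toL2 e‖ ^ 2) e
      (isClosed_le (by fun_prop) (by fun_prop)) fun φ => ?_
    rw [heq]
    exact hsq φ

/-- The operator of the form `⟪e', e⟫ - ⟪J e', J e⟫ + ⟪τ e', τ e⟫ - ⟪σ e', σ e⟫`. -/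
noncomputable def formOperator {E F G K : Type*} [NormedAddCommGroup E] [InnerProductSpace ℂ E]
    [CompleteSpace E] [NormedAddCommGroup F] [InnerProductSpace ℂ F] [CompleteSpace F]
    [NormedAddCommGroup G] [InnerProductSpace ℂ G] [CompleteSpace G]
    [NormedAddCommGroup K] [InnerProductSpace ℂ K] [CompleteSpace K]
    (J : E →L[ℂ] F) (τ : E →L[ℂ] G) (σ : E →L[ℂ] K) : E →L[ℂ] E :=
  1 - adjoint J ∘L J + adjoint τ ∘L τ - adjoint σ ∘L σ

section

variable {E F G K : Type*} [NormedAddCommGroup E] [InnerProductSpace ℂ E]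
  [CompleteSpace E] [NormedAddCommGroup F] [InnerProductSpace ℂ F] [CompleteSpace F]
  [NormedAddCommGroup G] [InnerProductSpace ℂ G] [CompleteSpace G]
  [NormedAddCommGroup K] [InnerProductSpace ℂ K] [CompleteSpace K]
  (J : E →L[ℂ] F) (τ : E →L[ℂ] G) (σ : E →L[ℂ] K)

theorem inner_formOperator (e e' : E) : inner ℂ e' (formOperator J τ σ e)
    = inner ℂ e' e - inner ℂ (J e') (J e) + inner ℂ (τ e') (τ e) - inner ℂ (σ e') (σ e) := by
  rw [formOperator, sub_apply, add_apply, sub_apply, comp_apply, comp_apply, comp_apply,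
    inner_sub_right, inner_add_right, inner_sub_right, adjoint_inner_right, adjoint_inner_right,
    adjoint_inner_right, one_apply_eq_self]

theorem inner_formOperator_self (e : E) : inner ℂ e (formOperator J τ σ e)
    = ((‖e‖ ^ 2 - ‖J e‖ ^ 2 + ‖τ e‖ ^ 2 - ‖σ e‖ ^ 2 : ℝ) : ℂ) := by
  rw [inner_formOperator]
  simp only [inner_self_eq_norm_sq_to_K]
  norm_cast

end

theorem exists_formOperator (V : KatoClass) (hreal : V.toLoc.IsReal)
    (hV : HasLocalKatoProperty V.toLoc) :
    ∃ (C : ℝ) (T : H1 →L[ℂ] H1), 0 ≤ C ∧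
      (∀ φ ψ : testSubmodule, inner ℂ (testToH1 ψ) (T (testToH1 φ)) = energyForm V.toLoc φ.1 ψ.1) ∧
      (∀ e, (inner ℂ e (T e)).im = 0) ∧
      ∀ e, ‖e‖ ^ 2 / 2 - C * ‖H1.toL2 e‖ ^ 2 ≤ (inner ℂ e (T e)).re := by
  obtain ⟨C, hC0, hC⟩ := exists_trace V hV
  obtain ⟨τ, hτ, -⟩ := hC _ V.toLoc.posMeasure_le
  obtain ⟨σ, hσ, hσb⟩ := hC _ V.toLoc.negMeasure_le
  -- The term -‖Je‖² of the form contributes the 1, the bound on ‖σe‖² contributes C and half of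
  -- ‖e‖², and ‖τe‖² is dropped.
  refine ⟨1 + C, formOperator H1.toL2 τ σ,
    by positivity, fun φ ψ => ?_, fun e => ?_, fun e => ?_⟩
  · rw [inner_formOperator, hτ, hσ, energyForm, hreal.integral_eq (φ.2.continuous_mul_conj ψ.2)
      (φ.2.hasCompactSupport_mul_conj ψ.1), H1.inner_eq, Fintype.sum_option, add_sub_cancel_left,
      add_sub_assoc]
    congr 1
    rw [integral_finsetSum _ fun i _ => ?_]
    · exact Finset.sum_congr rfl fun i _ =>
        inner_toLp (ψ.2.memLp_jet (some i)) (φ.2.memLp_jet (some i))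
    · exact ((φ.2.continuous_fderiv_basisVec i).mul (Complex.continuous_conj.comp
        (ψ.2.continuous_fderiv_basisVec i))).integrable_of_hasCompactSupport
        (φ.2.hasCompactSupport_fderiv_basisVec i).mul_right
  · rw [inner_formOperator_self, Complex.ofReal_im]
  · rw [inner_formOperator_self, Complex.ofReal_re]
    nlinarith [hσb e, sq_nonneg ‖τ e‖]

/-! ### Approximating sequences of test functions and elements of H¹ -/

theorem eLpNorm_sub_eq_edist {f g : R3 → ℂ} (hf : MemLp f 2 volume) (hg : MemLp g 2 volume) :
    eLpNorm (fun x => f x - g x) 2 volume = edist (hf.toLp f) (hg.toLp g) :=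
  (Lp.edist_toLp_toLp f g hf hg).symm

theorem eLpNorm_sub_Lp_eq_edist {f : R3 → ℂ} (hf : MemLp f 2 volume) (u : L2) :
    eLpNorm (fun x => f x - u x) 2 volume = edist (hf.toLp f) u := by
  rw [eLpNorm_sub_eq_edist hf (Lp.memLp u), Lp.toLp_coeFn]

theorem inner_toL2_testToH1 (ψ : testSubmodule) (f : L2) :
    inner ℂ (H1.toL2 (testToH1 ψ)) f = ∫ x, f x * conj (ψ.1 x) := by
  rw [H1.comp_testToH1]
  conv_lhs => rw [← Lp.toLp_coeFn f (Lp.memLp f)]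
  exact inner_toLp _ _

theorem cauchySeq_iff_tendsto_edist {α : Type*} [PseudoMetricSpace α] {u : ℕ → α} :
    CauchySeq u ↔ Tendsto (fun p : ℕ × ℕ => edist (u p.1) (u p.2)) atTop (𝓝 0) := by
  rw [cauchySeq_iff_tendsto_dist_atTop_0]
  constructor <;> intro h
  · have := ENNReal.tendsto_ofReal h
    rw [ENNReal.ofReal_zero] at this
    exact this.congr fun p => (edist_dist _ _).symm
  · exact ((ENNReal.tendsto_toReal ENNReal.zero_ne_top).comp h).congr fun p => (dist_edist _ _).symm

theorem exists_tendsto_of_isH1Approx {φ : ℕ → testSubmodule} {u : L2}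
    (h : IsH1Approx (fun n => (φ n).1) u) :
    ∃ e : H1, H1.toL2 e = u ∧ Tendsto (fun n => testToH1 (φ n)) atTop (𝓝 e) := by
  have h0 : Tendsto (fun n => H1.toL2 (testToH1 (φ n))) atTop (𝓝 u) := by
    rw [tendsto_iff_edist_tendsto_0]
    exact h.2.1.congr fun n => eLpNorm_sub_Lp_eq_edist ((φ n).2.memLp_jet none) u
  have hex : ∀ o, ∃ w : L2, Tendsto (fun n => H1.comp o (testToH1 (φ n))) atTop (𝓝 w) := fun o => by
    cases o with
    | none => exact ⟨u, h0⟩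
    | some i =>
      refine cauchySeq_tendsto_of_complete (cauchySeq_iff_tendsto_edist.2 ?_)
      exact (h.2.2 i).congr fun p => eLpNorm_sub_eq_edist ((φ p.1).2.memLp_jet (some i))
        ((φ p.2).2.memLp_jet (some i))
  choose w hw using hex
  have hlim : Tendsto (fun n => jetL2 (φ n)) atTop (𝓝 (WithLp.toLp 2 w)) :=
    ((PiLp.continuous_toLp 2 fun _ : Option (Fin 3) => L2).tendsto w).comp (tendsto_pi_nhds.2 hw)
  refine ⟨⟨WithLp.toLp 2 w, mem_closure_of_tendsto hlim
    (Eventually.of_forall fun n => LinearMap.mem_range_self _ _)⟩, ?_, ?_⟩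
  · exact tendsto_nhds_unique (hw none) h0
  · exact tendsto_subtype_rng.2 hlim

theorem isH1Approx_of_tendsto {φ : ℕ → testSubmodule} {e : H1}
    (h : Tendsto (fun n => testToH1 (φ n)) atTop (𝓝 e)) :
    IsH1Approx (fun n => (φ n).1) (H1.toL2 e) := by
  have hc : ∀ o, Tendsto (fun n => H1.comp o (testToH1 (φ n))) atTop (𝓝 (H1.comp o e)) := fun o =>
    ((H1.comp o).continuous.tendsto e).comp h
  refine ⟨fun n => (φ n).2, ?_, fun i => ?_⟩
  · have h0 := tendsto_iff_edist_tendsto_0.1 (hc none)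
    exact h0.congr fun n => (eLpNorm_sub_Lp_eq_edist ((φ n).2.memLp_jet none) _).symm
  · have h0 := cauchySeq_iff_tendsto_edist.1 (hc (some i)).cauchySeq
    exact h0.congr fun p => (eLpNorm_sub_eq_edist ((φ p.1).2.memLp_jet (some i))
        ((φ p.2).2.memLp_jet (some i))).symm

/-- As T is continuous, the form converges along every approximating sequence, to a limit that
depends only on e. The graph condition thus says ⟨ψ, Te⟩ = ⟨ψ, J*f⟩ for all test functions ψ, which
are dense in H¹. -/
theorem mem_hamiltonianGraph_iff {V : LocMeasure} {T : H1 →L[ℂ] H1}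
    (hT : ∀ φ ψ : testSubmodule, inner ℂ (testToH1 ψ) (T (testToH1 φ)) = energyForm V φ.1 ψ.1)
    (p : L2 × L2) :
    p ∈ hamiltonianGraph V ↔ ∃ e, H1.toL2 e = p.1 ∧ T e = adjoint H1.toL2 p.2 := by
  have hlim : ∀ {φ : ℕ → testSubmodule} {e : H1}, Tendsto (fun n => testToH1 (φ n)) atTop (𝓝 e) →
      ∀ ψ : testSubmodule, Tendsto (fun n => energyForm V (φ n).1 ψ.1) atTop
        (𝓝 (inner ℂ (testToH1 ψ) (T e))) := fun {φ e} h ψ => by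
    simp only [← hT]
    exact tendsto_const_nhds.inner ((T.continuous.tendsto e).comp h)
  have hadj : ∀ ψ : testSubmodule, inner ℂ (testToH1 ψ) (adjoint H1.toL2 p.2)
      = ∫ x, p.2 x * conj (ψ.1 x) := fun ψ => by
    rw [adjoint_inner_right, inner_toL2_testToH1]
  constructor
  · rintro ⟨φ, hφ, hq⟩
    obtain ⟨e, he, hlim'⟩ := exists_tendsto_of_isH1Approx (φ := fun n => ⟨φ n, hφ.1 n⟩) hφ
    refine ⟨e, he, denseRange_testToH1.eq_of_inner_right ℂ fun ψ => ?_⟩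
    rw [hadj]
    exact tendsto_nhds_unique (hlim hlim' ψ) (hq ψ.1 ψ.2)
  · rintro ⟨e, he, hTe⟩
    obtain ⟨x, hx, hxe⟩ := mem_closure_iff_seq_limit.1 (denseRange_testToH1 e)
    choose φ hφ using hx
    have hφe : Tendsto (fun n => testToH1 (φ n)) atTop (𝓝 e) := by simpa only [hφ] using hxe
    refine ⟨fun n => (φ n).1, he ▸ isH1Approx_of_tendsto hφe, fun ψ hψ => ?_⟩
    have := hlim hφe ⟨ψ, hψ⟩
    rwa [hTe, hadj] at this

/-- The equality of graphs expresses that H is well defined, since `toLinearPMap` can have the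
prescribed graph only if that graph is single-valued. -/
theorem hamiltonian_spec (V : KatoClass) (hreal : V.toLoc.IsReal)
    (hV : HasLocalKatoProperty V.toLoc) :
    (hamiltonian V.toLoc).graph = hamiltonianGraph V.toLoc ∧
      ∃ c : ℝ, ∀ z ∈ operatorSpectrum (hamiltonian V.toLoc), z.im = 0 ∧ c ≤ z.re := by
  obtain ⟨C, T, hC, hT, him, hre⟩ := exists_formOperator V hreal hV
  have hG := mem_hamiltonianGraph_iff hT
  refine ⟨Submodule.toLinearPMap_graph_eq _
    (eq_zero_of_mem_formGraph injective_toL2 denseRange_toL2 hG), -C, fun z hz => ?_⟩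
  by_contra hcon
  refine notMem_operatorSpectrum_of_isUnit injective_toL2 denseRange_toL2 hG
    (isUnit_form_sub hC him hre ?_) hz
  by_cases h : z.im = 0
  · exact Or.inr (not_le.1 fun h' => hcon ⟨h, h'⟩)
  · exact Or.inl h

end hamiltonian

/-! ### Polar decomposition of complex measures -/

/-- `h` is a density of bounded modulus of `c` with respect to its variation. -/
structure IsPhase (c : ComplexMeasure R3) (h : R3 → ℂ) : Prop where
  measurable : Measurable h
  norm_le : ∀ x, ‖h x‖ ≤ 1
  apply_eq : ∀ s, MeasurableSet s → c s = ∫ x in s, h x ∂c.variation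

theorem signedMeasure_eq_setIntegral {s : SignedMeasure R3} {m : Measure R3} [IsFiniteMeasure m]
    (h : ∀ t, MeasurableSet t → m t = 0 → s t = 0) :
    ∃ f : R3 → ℝ, Integrable f m ∧ ∀ t, MeasurableSet t → s t = ∫ x in t, f x ∂m := by
  have hs : s ≪ᵥ m.toENNRealVectorMeasure := VectorMeasure.AbsolutelyContinuous.mk fun t ht h0 =>
    h t ht (by rwa [Measure.toENNRealVectorMeasure_apply_measurable ht] at h0)
  refine ⟨s.rnDeriv m, SignedMeasure.integrable_rnDeriv s m, fun t ht => ?_⟩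
  rw [← withDensityᵥ_apply (SignedMeasure.integrable_rnDeriv s m) ht,
    SignedMeasure.withDensityᵥ_rnDeriv_eq s m hs]

/-- Radon–Nikodym for the real and imaginary parts gives a density k with respect to |c|. Comparing
|c| with the variation |k| |c| of the measure k|c| yields |k| = 1 almost everywhere. -/
theorem exists_isPhase (c : ComplexMeasure R3) : ∃ h, IsPhase c h := by
  have hfin := isFiniteMeasure_variation c
  have hc0 : ∀ t, c.variation t = 0 → c t = 0 := fun t h0 => by
    have := VectorMeasure.enorm_measure_le_variation c t
    rw [h0, nonpos_iff_eq_zero, enorm_eq_zero] at this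
    exact this
  obtain ⟨f, hf, hfs⟩ := signedMeasure_eq_setIntegral (s := ComplexMeasure.re c) (m := c.variation)
    fun t _ h0 => by
      change (c t).re = 0
      rw [hc0 t h0, Complex.zero_re]
  obtain ⟨g, hg, hgs⟩ := signedMeasure_eq_setIntegral (s := ComplexMeasure.im c) (m := c.variation)
    fun t _ h0 => by
      change (c t).im = 0
      rw [hc0 t h0, Complex.zero_im]
  have hk : Integrable (fun x => (f x : ℂ) + g x * Complex.I) c.variation :=
    hf.ofReal.add (hg.ofReal.mul_const _)
  have hks : ∀ t, MeasurableSet t → c t = ∫ x in t, ((f x : ℂ) + g x * Complex.I) ∂c.variation :=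
    fun t ht => by
      rw [integral_add hf.ofReal.restrict (hg.ofReal.mul_const _).restrict,
        integral_mul_const, integral_complex_ofReal, integral_complex_ofReal, ← hfs t ht,
        ← hgs t ht]
      exact (Complex.re_add_im (c t)).symm
  have hv : c = c.variation.withDensityᵥ fun x => (f x : ℂ) + g x * Complex.I := by
    ext t ht
    rw [withDensityᵥ_apply hk ht, hks t ht]
  have hn : ∀ᵐ x ∂c.variation, ‖(f x : ℂ) + g x * Complex.I‖ₑ = 1 := by
    have h1 := Measure.variation_withDensityᵥ hk
    rw [← hv] at h1
    have h2 : c.variation.withDensity (fun x => ‖(f x : ℂ) + g x * Complex.I‖ₑ)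
        = c.variation.withDensity 1 := by rw [← h1, withDensity_one]
    exact (withDensity_eq_iff hk.aestronglyMeasurable.enorm aemeasurable_const
      (by simpa [← hasFiniteIntegral_iff_enorm] using hk.2.ne)).1 h2
  obtain ⟨k, hkm, hkk⟩ := hk.aestronglyMeasurable.aemeasurable
  -- Truncation makes the bound hold at every point and changes k only on a null set.
  refine ⟨{x | ‖k x‖ ≤ 1}.indicator k,
    hkm.indicator (measurableSet_le hkm.norm measurable_const), fun x => ?_, fun t ht => ?_⟩
  · rw [Set.indicator_apply]
    split_ifs with h
    · exact h
    · simp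
  · rw [hks t ht]
    refine integral_congr_ae (ae_restrict_of_ae ?_)
    filter_upwards [hn, hkk] with x h1 h2
    rw [Set.indicator_of_mem, h2]
    rw [Set.mem_ofPred_eq, ← h2, ← toReal_enorm, h1, ENNReal.toReal_one]

theorem IsPhase.enorm_le {c : ComplexMeasure R3} {h : R3 → ℂ} (hh : IsPhase c h) (x : R3) :
    ‖h x‖ₑ ≤ 1 := by
  rw [← ofReal_norm]
  exact ENNReal.ofReal_le_one.2 (hh.norm_le x)

theorem IsPhase.integrable_mul {c : ComplexMeasure R3} {h : R3 → ℂ} (hh : IsPhase c h)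
    {m : Measure R3} {f : R3 → ℂ} (hf : Integrable f m) : Integrable (fun x => f x * h x) m :=
  hf.mul_bdd (c := 1) hh.measurable.aestronglyMeasurable (Eventually.of_forall hh.norm_le)

/-- Both sides agree on indicators, are additive, and are continuous in L¹(|c|). This reduces
integrals against complex measures to Bochner integrals. -/
theorem IsPhase.integral_eq {c : ComplexMeasure R3} {h : R3 → ℂ} (hh : IsPhase c h) {f : R3 → ℂ}
    (hf : c.Integrable f) :
    c.integral f (ContinuousLinearMap.mul ℝ ℂ) = ∫ x, f x * h x ∂c.variation := by
  have hfin := isFiniteMeasure_variation c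
  refine Integrable.induction
    (P := fun f => c.integral f (ContinuousLinearMap.mul ℝ ℂ) = ∫ x, f x * h x ∂c.variation)
    (fun a s hs _ => ?_) (fun f g _ hf hg h1 h2 => ?_) ?_ (fun f g hfg hf h1 => ?_) hf
  · rw [VectorMeasure.integral_indicator_const _ hs, ContinuousLinearMap.mul_apply',
      hh.apply_eq s hs, ← integral_const_mul, ← integral_indicator hs]
    refine integral_congr_ae (Eventually.of_forall fun x => ?_)
    by_cases hx : x ∈ s <;> simp [hx]
  · simp only [Pi.add_apply, add_mul]
    rw [VectorMeasure.integral_add hf hg, integral_add (hh.integrable_mul hf)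
      (hh.integrable_mul hg), h1, h2]
  · refine isClosed_eq VectorMeasure.continuous_integral ?_
    refine LipschitzWith.continuous (K := 1) (LipschitzWith.of_dist_le_mul fun f g => ?_)
    rw [NNReal.coe_one, one_mul, dist_eq_norm, dist_eq_norm, L1.norm_sub_eq_lintegral,
      ← integral_sub (hh.integrable_mul (L1.integrable_coeFn f))
      (hh.integrable_mul (L1.integrable_coeFn g))]
    rw [← toReal_enorm]
    refine ENNReal.toReal_mono ?_ ((enorm_integral_le_lintegral_enorm _).trans
      (lintegral_mono fun x => ?_))
    · exact ((L1.integrable_coeFn f).sub (L1.integrable_coeFn g)).2.ne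
    · rw [← sub_mul, enorm_mul]
      exact mul_le_of_le_one_right' (hh.enorm_le x)
  · rw [← VectorMeasure.integral_congr_ae hfg, h1]
    refine integral_congr_ae ?_
    filter_upwards [hfg] with x hx
    rw [hx]

theorem IsPhase.restrict {c : ComplexMeasure R3} {h : R3 → ℂ} (hh : IsPhase c h) {s : Set R3}
    (hs : MeasurableSet s) : IsPhase (c.restrict s) h :=
  ⟨hh.measurable, hh.norm_le, fun t ht => by
    rw [VectorMeasure.restrict_apply _ hs ht, hh.apply_eq _ (ht.inter hs),
      VectorMeasure.variation_restrict hs, Measure.restrict_restrict ht]⟩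

theorem IsPhase.congr {c : ComplexMeasure R3} {h k : R3 → ℂ} (hh : IsPhase c h)
    (hk : Measurable k) (hk1 : ∀ x, ‖k x‖ ≤ 1) (hhk : h =ᵐ[c.variation] k) : IsPhase c k :=
  ⟨hk, hk1, fun s hs => by
    rw [hh.apply_eq s hs]
    exact integral_congr_ae (ae_restrict_of_ae hhk)⟩

theorem IsPhase.ae_eq {c : ComplexMeasure R3} {h k : R3 → ℂ} (hh : IsPhase c h)
    (hk : IsPhase c k) : h =ᵐ[c.variation] k := by
  have hfin := isFiniteMeasure_variation c
  have hi : ∀ {h}, IsPhase c h → Integrable h c.variation := fun hh =>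
    Integrable.of_bound hh.measurable.aestronglyMeasurable 1 (Eventually.of_forall hh.norm_le)
  refine (hi hh).ae_eq_of_forall_setIntegral_eq _ _ (hi hk) fun s hs _ => ?_
  rw [← hh.apply_eq s hs, hk.apply_eq s hs]

theorem LocMeasure.exists_isPhase (V : LocMeasure) : ∃ h, ∀ n, IsPhase (V.1 n) h := by
  choose h hh using fun n => KatoSchrodinger.exists_isPhase (V.1 n)
  -- The index ⌊‖x‖⌋ + 1 is the least n for which the open ball B(0, n) contains x. Phases on
  -- different balls agree almost everywhere where both apply, so the glued function is a phase on
  -- every ball.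
  let k : R3 → ℂ := fun x => h (⌊‖x‖⌋₊ + 1) x
  have hk : Measurable k := by
    have h1 : Measurable fun p : ℕ × R3 => h p.1 p.2 :=
      measurable_from_prod_countable_right fun n => (hh n).measurable
    exact h1.comp ((((Nat.measurable_floor.comp measurable_norm).add_const 1)).prodMk measurable_id)
  refine ⟨k, fun n => (hh n).congr hk (fun x => (hh _).norm_le x) ?_⟩
  have h2 : ∀ m : ℕ, m ≤ n →
      ∀ᵐ x ∂(V.1 n).variation, x ∈ Metric.ball (0 : R3) (m : ℝ) → h n x = h m x := fun m hm => by
    have h3 : (V.1 n).restrict (Metric.ball (0 : R3) (m : ℝ)) = V.1 m := V.2 m n hm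
    have h4 := (hh n).restrict (measurableSet_ball (x := (0 : R3)) (ε := (m : ℝ)))
    rw [h3] at h4
    have h5 := h4.ae_eq (hh m)
    rw [← h3, VectorMeasure.variation_restrict measurableSet_ball] at h5
    exact (ae_restrict_iff' measurableSet_ball).1 h5
  have h6 : ∀ᵐ x ∂(V.1 n).variation, x ∈ Metric.ball (0 : R3) (n : ℝ) := by
    rw [← V.absMeasure_restrict n]
    exact ae_restrict_mem measurableSet_ball
  filter_upwards [ae_all_iff.2 fun m => ae_all_iff.2 fun hm : m ≤ n => h2 m hm, h6] with x hx hxn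
  rw [mem_ball_zero_iff] at hxn
  refine hx _ ?_ ?_
  · exact_mod_cast (Nat.floor_lt (norm_nonneg x)).2 hxn
  · rw [mem_ball_zero_iff]
    push_cast
    exact Nat.lt_floor_add_one _

/-! ### Integration against locally finite complex measures -/

namespace LocMeasure

variable {V W ν ν' : LocMeasure}

theorem absMeasure_add_le (ν ν' : LocMeasure) :
    (ν + ν').absMeasure ≤ ν.absMeasure + ν'.absMeasure := Measure.le_iff.2 fun s hs => by
  have h := lintegralAbs_add_le ν ν' (s.indicator 1)
  simpa only [lintegralAbs_eq, lintegral_indicator_one hs, Measure.add_apply] using h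

theorem absMeasure_smul_le (c : ℂ) (ν : LocMeasure) :
    (c • ν).absMeasure ≤ ‖c‖ₑ • ν.absMeasure := Measure.le_iff.2 fun s hs => by
  have h := lintegralAbs_smul c ν (s.indicator 1)
  simp only [lintegralAbs_eq, lintegral_indicator_one hs] at h
  rw [h]
  rfl

theorem absMeasure_ofComplexMeasure (μ : ComplexMeasure R3) :
    (ofComplexMeasure μ).absMeasure = μ.variation := by
  ext s hs
  rw [← lintegral_indicator_one hs, ← lintegralAbs_eq]
  have h1 : ∀ n : ℕ, ∫⁻ x, s.indicator 1 x ∂((ofComplexMeasure μ).1 n).variation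
      = μ.variation (s ∩ Metric.ball 0 (n : ℝ)) := fun n => by
    change ∫⁻ x, s.indicator 1 x ∂(μ.restrict (Metric.ball 0 (n : ℝ))).variation = _
    rw [lintegral_indicator_one hs, VectorMeasure.variation_restrict measurableSet_ball,
      Measure.restrict_apply hs]
  unfold lintegralAbs
  simp only [h1]
  rw [← Monotone.measure_iUnion (fun m n h => Set.inter_subset_inter_right _
    (Metric.ball_subset_ball (by exact_mod_cast h))), ← Set.inter_iUnion, Metric.iUnion_ball_nat,
    Set.inter_univ]

theorem integrable_of_absMeasure {f : R3 → ℂ} (hf : Integrable f ν.absMeasure) (n : ℕ) :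
    (ν.1 n).Integrable f := by
  change Integrable f (ν.1 n).variation
  rw [← absMeasure_restrict]
  exact hf.restrict

/-- The limit defining the integral exists whenever f is |ν|-integrable, the balls exhausting the
space. -/
theorem tendsto_integral_of_isPhase {h : R3 → ℂ} (hh : ∀ n, IsPhase (ν.1 n) h) {f : R3 → ℂ}
    (hf : Integrable f ν.absMeasure) :
    Tendsto (fun n : ℕ => (ν.1 n).integral f (ContinuousLinearMap.mul ℝ ℂ)) atTop
      (𝓝 (∫ x, f x * h x ∂ν.absMeasure)) := by
  have hfh : Integrable (fun x => f x * h x) ν.absMeasure := (hh 0).integrable_mul hf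
  have h1 : ∀ n : ℕ, (ν.1 n).integral f (ContinuousLinearMap.mul ℝ ℂ)
      = ∫ x in Metric.ball (0 : R3) (n : ℝ), f x * h x ∂ν.absMeasure := fun n => by
    rw [(hh n).integral_eq (integrable_of_absMeasure hf n), absMeasure_restrict]
  simp only [h1]
  have h2 := tendsto_setIntegral_of_monotone (μ := ν.absMeasure) (f := fun x => f x * h x)
    (s := fun n : ℕ => Metric.ball (0 : R3) (n : ℝ)) (fun n => measurableSet_ball)
    (fun m n h => Metric.ball_subset_ball (by exact_mod_cast h)) hfh.integrableOn
  rwa [Metric.iUnion_ball_nat, setIntegral_univ] at h2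

theorem integral_eq_of_isPhase {h : R3 → ℂ} (hh : ∀ n, IsPhase (ν.1 n) h) {f : R3 → ℂ}
    (hf : Integrable f ν.absMeasure) : ν.integral f = ∫ x, f x * h x ∂ν.absMeasure :=
  (tendsto_integral_of_isPhase hh hf).limUnder_eq

theorem tendsto_integral_of_integrable {f : R3 → ℂ} (hf : Integrable f ν.absMeasure) :
    Tendsto (fun n : ℕ => (ν.1 n).integral f (ContinuousLinearMap.mul ℝ ℂ)) atTop
      (𝓝 (ν.integral f)) := by
  obtain ⟨h, hh⟩ := ν.exists_isPhase
  exact tendsto_nhds_limUnder ⟨_, tendsto_integral_of_isPhase hh hf⟩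

theorem integral_add_measure {f : R3 → ℂ} (hf : Integrable f ν.absMeasure)
    (hf' : Integrable f ν'.absMeasure) : (ν + ν').integral f = ν.integral f + ν'.integral f := by
  have hs : Integrable f (ν + ν').absMeasure :=
    (hf.add_measure hf').mono_measure (absMeasure_add_le ν ν')
  refine tendsto_nhds_unique (tendsto_integral_of_integrable hs)
    (((tendsto_integral_of_integrable hf).add (tendsto_integral_of_integrable hf')).congr
      fun n => ?_)
  exact (VectorMeasure.integral_add_vectorMeasure (integrable_of_absMeasure hf n)
    (integrable_of_absMeasure hf' n)).symm

end LocMeasure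

/-- If h is a phase of μ then (c/|c|)h is a phase of cμ, while the variation is multiplied by |c|.
The case c = 0, where c/|c| is no phase, is separate. -/
theorem integral_smul_complexMeasure (c : ℂ) {μ : ComplexMeasure R3} {f : R3 → ℂ}
    (hf : μ.Integrable f) : (c • μ).integral f (ContinuousLinearMap.mul ℝ ℂ)
      = c * μ.integral f (ContinuousLinearMap.mul ℝ ℂ) := by
  rcases eq_or_ne c 0 with rfl | hc
  · have h0 : (0 : ℂ) • μ = 0 := zero_smul ℂ μ
    rw [h0, VectorMeasure.integral_zero_vectorMeasure, zero_mul]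
  have hc' : (‖c‖ : ℂ) ≠ 0 := by simpa using hc
  obtain ⟨h, hh⟩ := exists_isPhase μ
  have hv : (c • μ).variation = ENNReal.ofReal ‖c‖ • μ.variation := by
    rw [VectorMeasure.variation_smul, ofReal_norm]
    rfl
  have hp : IsPhase (c • μ) fun x => c / ‖c‖ * h x := by
    refine ⟨hh.measurable.const_mul _, fun x => ?_, fun s hs => ?_⟩
    · rw [norm_mul, norm_div, Complex.norm_real, norm_norm, div_self (norm_ne_zero_iff.2 hc),
        one_mul]
      exact hh.norm_le x
    · rw [hv, Measure.restrict_smul, MeasureTheory.integral_smul_measure,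
        integral_const_mul, ← hh.apply_eq s hs, ENNReal.toReal_ofReal (norm_nonneg c),
        Complex.real_smul, ← mul_assoc, mul_div_cancel₀ _ hc']
      rfl
  have hf' : (c • μ).Integrable f := by
    change Integrable f (c • μ).variation
    rw [hv]
    exact hf.smul_measure ENNReal.ofReal_ne_top
  rw [hp.integral_eq hf', hh.integral_eq hf, hv, MeasureTheory.integral_smul_measure,
    ENNReal.toReal_ofReal (norm_nonneg c), Complex.real_smul, ← integral_const_mul,
    ← integral_const_mul]
  refine integral_congr_ae (Eventually.of_forall fun x => ?_)
  field_simp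

namespace LocMeasure

variable {V W ν ν' : LocMeasure}

theorem integral_smul_measure (c : ℂ) {f : R3 → ℂ} (hf : Integrable f ν.absMeasure) :
    (c • ν).integral f = c * ν.integral f := by
  have hs : Integrable f (c • ν).absMeasure :=
    (hf.smul_measure (by simp)).mono_measure (absMeasure_smul_le c ν)
  refine tendsto_nhds_unique (tendsto_integral_of_integrable hs)
    (((tendsto_integral_of_integrable hf).const_mul c).congr fun n => ?_)
  exact (integral_smul_complexMeasure c (integrable_of_absMeasure hf n)).symm

theorem integral_ofComplexMeasure {μ : ComplexMeasure R3} {f : R3 → ℂ} (hf : μ.Integrable f) :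
    (ofComplexMeasure μ).integral f = μ.integral f (ContinuousLinearMap.mul ℝ ℂ) := by
  obtain ⟨h, hh⟩ := KatoSchrodinger.exists_isPhase μ
  have hf' : Integrable f (ofComplexMeasure μ).absMeasure := by
    rwa [absMeasure_ofComplexMeasure]
  rw [integral_eq_of_isPhase (fun n => hh.restrict measurableSet_ball) hf', hh.integral_eq hf,
    absMeasure_ofComplexMeasure]

/-- When |W| is finite, a global phase is |W|-integrable and the measure h|W| is the finite measure
sought. -/
theorem exists_ofComplexMeasure_eq {W : LocMeasure} (hW : W.absMeasure Set.univ ≠ ⊤) :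
    ∃ c : ComplexMeasure R3, ofComplexMeasure c = W := by
  obtain ⟨h, hh⟩ := W.exists_isPhase
  have hfin : IsFiniteMeasure W.absMeasure := ⟨hW.lt_top⟩
  have hi : Integrable h W.absMeasure := Integrable.of_bound
    (hh 0).measurable.aestronglyMeasurable 1 (Eventually.of_forall (hh 0).norm_le)
  refine ⟨W.absMeasure.withDensityᵥ h, Subtype.ext (funext fun n => ?_)⟩
  change (W.absMeasure.withDensityᵥ h).restrict (Metric.ball 0 (n : ℝ)) = W.1 n
  ext s hs
  rw [VectorMeasure.restrict_apply _ measurableSet_ball hs,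
    withDensityᵥ_apply hi (hs.inter measurableSet_ball), (hh n).apply_eq s hs,
    ← absMeasure_restrict, Measure.restrict_restrict hs]

/-! ### Products of functions and locally finite measures -/

theorem exists_isProduct {g : R3 → ℂ} (hg : ∀ n, (V.1 n).Integrable g) : ∃ W, IsProduct g V W :=
  ⟨⟨fun n => (V.1 n).withDensity g (ContinuousLinearMap.mul ℝ ℂ), fun m n h => by
    have h1 : (V.1 n).restrict (Metric.ball (0 : R3) (m : ℝ)) = V.1 m := V.2 m n h
    rw [VectorMeasure.restrict_withDensity (hg n), h1]⟩, fun n => ⟨hg n, rfl⟩⟩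

theorem IsProduct.apply_eq {g h : R3 → ℂ} (hW : IsProduct g V W) {n : ℕ}
    (hh : IsPhase (V.1 n) h) {s : Set R3} (hs : MeasurableSet s) :
    W.1 n s = ∫ x in s, g x * h x ∂(V.1 n).variation := by
  have hg : ((V.1 n).restrict s).Integrable g := (hW n).1.restrict
  rw [(hW n).2, VectorMeasure.withDensity_apply (hW n).1, (hh.restrict hs).integral_eq hg,
    VectorMeasure.variation_restrict hs]

theorem ae_variation_of_absMeasure {p : R3 → Prop} (h : ∀ᵐ x ∂V.absMeasure, p x) (n : ℕ) :
    ∀ᵐ x ∂(V.1 n).variation, p x := by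
  rw [← absMeasure_restrict]
  exact ae_restrict_of_ae h

theorem IsProduct.congr {g g' : R3 → ℂ} (hW : IsProduct g V W) (h : g =ᵐ[V.absMeasure] g') :
    IsProduct g' V W := fun n =>
  ⟨(hW n).1.congr (ae_variation_of_absMeasure h n),
    (hW n).2.trans (VectorMeasure.withDensity_congr (ae_variation_of_absMeasure h n))⟩

theorem IsProduct.unique {g : R3 → ℂ} {W' : LocMeasure} (hW : IsProduct g V W)
    (hW' : IsProduct g V W') : W = W' :=
  Subtype.ext (funext fun n => (hW n).2.trans (hW' n).2.symm)

theorem IsProduct.add {g g' : R3 → ℂ} {W' : LocMeasure} (hW : IsProduct g V W)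
    (hW' : IsProduct g' V W') : IsProduct (fun x => g x + g' x) V (W + W') := fun n => by
  obtain ⟨h, hh⟩ := KatoSchrodinger.exists_isPhase (V.1 n)
  have hi : (V.1 n).Integrable fun x => g x + g' x := (hW n).1.add (hW' n).1
  refine ⟨hi, ?_⟩
  ext s hs
  have hr : ((V.1 n).restrict s).Integrable fun x => g x + g' x := hi.restrict
  have h1 : (W + W').1 n s = W.1 n s + W'.1 n s := rfl
  rw [h1, hW.apply_eq hh hs, hW'.apply_eq hh hs, VectorMeasure.withDensity_apply hi,
    (hh.restrict hs).integral_eq hr, VectorMeasure.variation_restrict hs,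
    ← MeasureTheory.integral_add (hh.integrable_mul (hW n).1).restrict
      (hh.integrable_mul (hW' n).1).restrict]
  simp only [add_mul]

theorem IsProduct.smul {g : R3 → ℂ} (c : ℂ) (hW : IsProduct g V W) :
    IsProduct (fun x => c * g x) V (c • W) := fun n => by
  have hi : (V.1 n).Integrable fun x => c * g x := (hW n).1.const_mul c
  refine ⟨hi, ?_⟩
  ext s hs
  have hr : ((V.1 n).restrict s).Integrable g := (hW n).1.restrict
  have h1 : (c • W).1 n s = c * W.1 n s := rfl
  rw [h1, (hW n).2, VectorMeasure.withDensity_apply hi, VectorMeasure.withDensity_apply (hW n).1,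
    integral_const_mul_complexMeasure c _ hr]

theorem IsProduct.lintegralAbs_le {g : R3 → ℂ} (hW : IsProduct g V W) {f : R3 → ℝ≥0∞}
    (hf : Measurable f) : W.lintegralAbs f ≤ ∫⁻ x, ‖g x‖ₑ * f x ∂V.absMeasure := by
  refine iSup_le fun n => ?_
  obtain ⟨h, hh⟩ := KatoSchrodinger.exists_isPhase (V.1 n)
  have hle : (W.1 n).variation ≤ (V.1 n).variation.withDensity fun x => ‖g x‖ₑ := by
    refine VectorMeasure.variation_le_of_forall_enorm_le fun s hs => ?_
    rw [hW.apply_eq hh hs, withDensity_apply _ hs]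
    refine (enorm_integral_le_lintegral_enorm _).trans (lintegral_mono fun x => ?_)
    rw [enorm_mul]
    exact mul_le_of_le_one_right' (hh.enorm_le x)
  refine (lintegral_mono' hle le_rfl).trans ?_
  have hm : AEMeasurable (fun x => ‖g x‖ₑ) (V.1 n).variation := (hW n).1.1.enorm
  rw [lintegral_withDensity_eq_lintegral_mul₀ hm hf.aemeasurable, ← absMeasure_restrict]
  exact setLIntegral_le_lintegral _ _

end LocMeasure

/-! ### Kernel estimates -/

/-- The kernel `e^{-a |x|} / |x|`. -/
noncomputable def yukawa (a : ℝ) (x : R3) : ℝ≥0∞ := ENNReal.ofReal (Real.exp (-a * ‖x‖)) * ‖x‖ₑ⁻¹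

theorem measurable_yukawa (a : ℝ) : Measurable (yukawa a) := by
  unfold yukawa
  fun_prop

theorem measurable_yukawa_sub (a : ℝ) (y : R3) : Measurable fun x => yukawa a (x - y) :=
  (measurable_yukawa a).comp (measurable_id.sub_const y)

theorem measurable_freeKernel (lam : ℂ) : Measurable (freeKernel lam) := by
  unfold freeKernel
  fun_prop

theorem enorm_freeKernel_le (lam : ℂ) (x : R3) :
    ‖freeKernel lam x‖ₑ ≤ ENNReal.ofReal (4 * Real.pi)⁻¹ * yukawa (sqrtNeg lam).re x := by
  -- At the origin the free kernel is 0 by the convention for division.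
  rcases eq_or_ne x 0 with rfl | hx
  · simp [freeKernel]
  have hx' : 0 < ‖x‖ := norm_pos_iff.2 hx
  have h1 : ‖x‖ₑ⁻¹ = ENNReal.ofReal ‖x‖⁻¹ := by
    rw [ENNReal.ofReal_inv_of_pos hx', ofReal_norm]
  have h2 : ‖freeKernel lam x‖
      = (4 * Real.pi)⁻¹ * (Real.exp (-(sqrtNeg lam).re * ‖x‖) * ‖x‖⁻¹) := by
    rw [freeKernel, norm_div, Complex.norm_exp, Complex.re_mul_ofReal, Complex.neg_re, norm_mul,
      norm_mul, Complex.norm_real, Complex.norm_real, norm_norm, Real.norm_of_nonneg Real.pi_pos.le,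
      Complex.norm_ofNat]
    have := Real.pi_pos
    field_simp
  rw [← ofReal_norm, h2, yukawa, h1, ← ENNReal.ofReal_mul (Real.exp_pos _).le,
    ← ENNReal.ofReal_mul (by positivity)]

theorem yukawa_anti {a b : ℝ} (h : a ≤ b) (x : R3) : yukawa b x ≤ yukawa a x := by
  unfold yukawa
  gcongr

theorem enorm_sub_le_add (x y z : R3) : ‖y - z‖ₑ ≤ ‖x - y‖ₑ + ‖x - z‖ₑ := by
  calc ‖y - z‖ₑ = ‖(x - z) - (x - y)‖ₑ := by congr 1; abel
    _ ≤ ‖x - z‖ₑ + ‖x - y‖ₑ := enorm_sub_le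
    _ = _ := add_comm _ _

/-- The triangle inequality |y - z| ≤ |x - y| + |x - z|, divided by all three distances. For y = z
the right side is ⊤. -/
theorem inv_enorm_mul_inv_enorm_le (x y z : R3) :
    ‖x - y‖ₑ⁻¹ * ‖x - z‖ₑ⁻¹ ≤ ‖y - z‖ₑ⁻¹ * (‖x - y‖ₑ⁻¹ + ‖x - z‖ₑ⁻¹) := by
  rcases eq_or_ne ‖y - z‖ₑ 0 with h | h
  · rw [h, ENNReal.inv_zero, ENNReal.top_mul]
    · exact le_top
    · simp
  rw [mul_comm ‖y - z‖ₑ⁻¹, ← div_eq_mul_inv (_ + _), ENNReal.le_div_iff_mul_le (Or.inl h) (Or.inl (by simp))]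
  calc ‖x - y‖ₑ⁻¹ * ‖x - z‖ₑ⁻¹ * ‖y - z‖ₑ
      ≤ ‖x - y‖ₑ⁻¹ * ‖x - z‖ₑ⁻¹ * (‖x - y‖ₑ + ‖x - z‖ₑ) := by
        gcongr
        exact enorm_sub_le_add x y z
    _ = ‖x - y‖ₑ⁻¹ * ‖x - y‖ₑ * ‖x - z‖ₑ⁻¹ + ‖x - z‖ₑ⁻¹ * ‖x - z‖ₑ * ‖x - y‖ₑ⁻¹ := by ring
    _ ≤ 1 * ‖x - z‖ₑ⁻¹ + 1 * ‖x - y‖ₑ⁻¹ := by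
        gcongr <;> exact ENNReal.inv_mul_le_one _
    _ = _ := by rw [one_mul, one_mul, add_comm]

/-- If |x| ≤ |z| then 1/|z| ≤ 1/|x|; otherwise e^{-a|x|} ≤ e^{-a|z|}. -/
theorem ofReal_exp_mul_inv_enorm_le {a : ℝ} (ha : 0 ≤ a) (x z : R3) :
    ENNReal.ofReal (Real.exp (-a * ‖x‖)) * ‖z‖ₑ⁻¹ ≤ yukawa a x + yukawa a z := by
  rcases le_total ‖x‖ ‖z‖ with h | h
  · refine le_trans ?_ le_self_add
    unfold yukawa
    gcongr
    rwa [← ofReal_norm, ← ofReal_norm, ENNReal.ofReal_le_ofReal_iff (norm_nonneg z)]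
  · refine le_trans ?_ le_add_self
    unfold yukawa
    gcongr ENNReal.ofReal (Real.exp ?_) * _
    nlinarith

/-- This extracts 1/|y - z| while keeping exponential decay in every remaining term. The
coefficients 2 + 1 are the factor 3 in the bound on 𝒦. -/
theorem yukawa_mul_inv_enorm_le {a : ℝ} (ha : 0 ≤ a) (x y z : R3) :
    yukawa a (x - y) * ‖x - z‖ₑ⁻¹
      ≤ ‖y - z‖ₑ⁻¹ * (2 * yukawa a (x - y) + yukawa a (x - z)) := by
  calc yukawa a (x - y) * ‖x - z‖ₑ⁻¹
      = ENNReal.ofReal (Real.exp (-a * ‖x - y‖)) * (‖x - y‖ₑ⁻¹ * ‖x - z‖ₑ⁻¹) := by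
        rw [yukawa, mul_assoc]
    _ ≤ ENNReal.ofReal (Real.exp (-a * ‖x - y‖))
        * (‖y - z‖ₑ⁻¹ * (‖x - y‖ₑ⁻¹ + ‖x - z‖ₑ⁻¹)) :=
        mul_le_mul' le_rfl (inv_enorm_mul_inv_enorm_le x y z)
    _ = ‖y - z‖ₑ⁻¹ * (yukawa a (x - y)
        + ENNReal.ofReal (Real.exp (-a * ‖x - y‖)) * ‖x - z‖ₑ⁻¹) := by
        rw [yukawa]; ring
    _ ≤ ‖y - z‖ₑ⁻¹ * (yukawa a (x - y) + (yukawa a (x - y) + yukawa a (x - z))) := by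
        gcongr
        exact ofReal_exp_mul_inv_enorm_le ha _ _
    _ = _ := by ring

/-- The exponentially weighted Kato norm `sup_y ∫ e^{-a |x-y|} / |x - y| d|V|(x)`. -/
noncomputable def yukawaNorm (V : LocMeasure) (a : ℝ) : ℝ≥0∞ :=
  ⨆ y : R3, ∫⁻ x, yukawa a (x - y) ∂V.absMeasure

theorem lintegral_yukawa_le (V : LocMeasure) (a : ℝ) (y : R3) :
    ∫⁻ x, yukawa a (x - y) ∂V.absMeasure ≤ yukawaNorm V a :=
  le_iSup (fun y => ∫⁻ x, yukawa a (x - y) ∂V.absMeasure) y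

theorem yukawaNorm_anti (V : LocMeasure) : Antitone (yukawaNorm V) := fun _ _ h =>
  iSup_mono fun _ => lintegral_mono fun _ => yukawa_anti h _

/-- Within distance ε the exponential is at most 1, beyond it at most e^{-aε}. -/
theorem yukawaNorm_le (V : LocMeasure) {a ε : ℝ} (ha : 0 ≤ a) :
    yukawaNorm V a ≤ localKato V ε + ENNReal.ofReal (Real.exp (-a * ε)) * katoENorm V := by
  refine iSup_le fun y => ?_
  have hle : ∀ x, yukawa a (x - y) ≤ (Metric.ball y ε).indicator (fun x => ‖x - y‖ₑ⁻¹) x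
      + ENNReal.ofReal (Real.exp (-a * ε)) * ‖x - y‖ₑ⁻¹ := fun x => by
    by_cases hx : x ∈ Metric.ball y ε
    · rw [Set.indicator_of_mem hx]
      refine le_trans ?_ le_self_add
      refine mul_le_of_le_one_left' (ENNReal.ofReal_le_one.2 (Real.exp_le_one_iff.2 ?_))
      nlinarith [norm_nonneg (x - y)]
    · rw [Set.indicator_of_notMem hx, zero_add, yukawa]
      rw [mem_ball_iff_norm, not_lt] at hx
      gcongr ENNReal.ofReal (Real.exp ?_) * _
      nlinarith
  refine (lintegral_mono hle).trans ?_
  rw [lintegral_add_left ((by fun_prop : Measurable fun x : R3 => ‖x - y‖ₑ⁻¹).indicator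
    measurableSet_ball), lintegral_const_mul _ (by fun_prop), ← LocMeasure.lintegralAbs_eq]
  exact add_le_add (le_iSup (fun y => V.lintegralAbs
    ((Metric.ball y ε).indicator fun x => ‖x - y‖ₑ⁻¹)) y)
    (mul_le_mul_right (lintegral_inv_enorm_sub_le V y) _)

/-- First ε is fixed by the local Kato property, then a → ∞ removes the far part. This is where part
(ii) uses that property. -/
theorem tendsto_yukawaNorm {V : LocMeasure} (hK : katoENorm V ≠ ⊤) (hV : HasLocalKatoProperty V) :
    Tendsto (yukawaNorm V) atTop (𝓝 0) := by
  rw [ENNReal.tendsto_nhds_zero]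
  intro δ hδ
  have hδ2 : 0 < δ / 2 := ENNReal.half_pos hδ.ne'
  obtain ⟨ε, hε, hε0⟩ := ((ENNReal.tendsto_nhds_zero.1 hV _ hδ2).and self_mem_nhdsWithin).exists
  have h1 : Tendsto (fun a : ℝ => ENNReal.ofReal (Real.exp (-a * ε)) * katoENorm V) atTop
      (𝓝 0) := by
    have h2 : Tendsto (fun a : ℝ => Real.exp (-a * ε)) atTop (𝓝 0) :=
      Real.tendsto_exp_atBot.comp (tendsto_neg_atTop_atBot.atBot_mul_const hε0)
    have h3 := ENNReal.Tendsto.mul_const (b := katoENorm V) (ENNReal.tendsto_ofReal h2)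
      (Or.inr hK)
    rwa [ENNReal.ofReal_zero, zero_mul] at h3
  filter_upwards [ENNReal.tendsto_nhds_zero.1 h1 _ hδ2, eventually_ge_atTop 0] with a ha ha0
  refine (yukawaNorm_le V (ε := ε) ha0).trans ?_
  rw [← ENNReal.add_halves δ]
  exact add_le_add hε ha

/-! ### Potentials of locally finite measures -/

namespace LocMeasure

variable {V W ν ν' : LocMeasure} {lam : ℂ}

/-- The function `R₀(lam) ν`. -/
noncomputable def potential (lam : ℂ) (ν : LocMeasure) (x : R3) : ℂ :=
  ν.integral fun y => freeKernel lam (x - y)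

/-- The integral of the modulus of the kernel of `R₀(lam)` against `|ν|`. -/
noncomputable def absPotential (lam : ℂ) (ν : LocMeasure) (x : R3) : ℝ≥0∞ :=
  ∫⁻ y, ‖freeKernel lam (x - y)‖ₑ ∂ν.absMeasure

theorem measurable_freeKernel_sub (lam : ℂ) :
    Measurable fun p : R3 × R3 => freeKernel lam (p.1 - p.2) :=
  (measurable_freeKernel lam).comp (measurable_fst.sub measurable_snd)

theorem measurable_absPotential (lam : ℂ) (ν : LocMeasure) : Measurable (absPotential lam ν) :=
  (measurable_freeKernel_sub lam).enorm.lintegral_prod_right'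

theorem integrable_freeKernel {x : R3} (hx : absPotential lam ν x ≠ ⊤) :
    Integrable (fun y => freeKernel lam (x - y)) ν.absMeasure :=
  ⟨((measurable_freeKernel lam).comp (measurable_const.sub measurable_id)).aestronglyMeasurable,
    hx.lt_top⟩

theorem enorm_potential_le {x : R3} (hx : absPotential lam ν x ≠ ⊤) :
    ‖potential lam ν x‖ₑ ≤ absPotential lam ν x := by
  obtain ⟨h, hh⟩ := ν.exists_isPhase
  rw [potential, integral_eq_of_isPhase hh (integrable_freeKernel hx)]
  refine (enorm_integral_le_lintegral_enorm _).trans (lintegral_mono fun y => ?_)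
  rw [enorm_mul]
  exact mul_le_of_le_one_right' ((hh 0).enorm_le y)

/-- The potential is defined as a limit for each point. Where the absolute potential is finite it
equals the parametrized integral of the kernel times a phase, which is measurable. -/
theorem aestronglyMeasurable_potential {m : Measure R3} (hm : ∀ᵐ x ∂m, absPotential lam ν x ≠ ⊤) :
    AEStronglyMeasurable (potential lam ν) m := by
  obtain ⟨h, hh⟩ := ν.exists_isPhase
  have h1 : StronglyMeasurable fun x => ∫ y, freeKernel lam (x - y) * h y ∂ν.absMeasure :=
    ((measurable_freeKernel_sub lam).mul
      ((hh 0).measurable.comp measurable_snd)).stronglyMeasurable.integral_prod_right'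
  refine h1.aestronglyMeasurable.congr ?_
  filter_upwards [hm] with x hx
  exact (integral_eq_of_isPhase hh (integrable_freeKernel hx)).symm

theorem potential_add {x : R3} (hx : absPotential lam ν x ≠ ⊤) (hx' : absPotential lam ν' x ≠ ⊤) :
    potential lam (ν + ν') x = potential lam ν x + potential lam ν' x :=
  integral_add_measure (integrable_freeKernel hx) (integrable_freeKernel hx')

theorem potential_smul (c : ℂ) {x : R3} (hx : absPotential lam ν x ≠ ⊤) :
    potential lam (c • ν) x = c * potential lam ν x :=
  integral_smul_measure c (integrable_freeKernel hx)

theorem exists_isProduct_potential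
    (h : ∀ n, ∫⁻ x, absPotential lam ν x ∂(V.1 n).variation ≠ ⊤) :
    ∃ W, IsProduct (potential lam ν) V W := by
  refine exists_isProduct fun n => ?_
  have hae : ∀ᵐ x ∂(V.1 n).variation, absPotential lam ν x ≠ ⊤ := by
    filter_upwards [ae_lt_top (measurable_absPotential lam ν) (h n)] with x hx using hx.ne
  refine ⟨aestronglyMeasurable_potential hae, ?_⟩
  rw [hasFiniteIntegral_iff_enorm]
  refine lt_of_le_of_lt (lintegral_mono_ae ?_) (h n).lt_top
  filter_upwards [hae] with x hx using enorm_potential_le hx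

theorem IsProduct.lintegralAbs_potential_le (hW : IsProduct (potential lam ν) V W)
    (h : ∀ᵐ x ∂V.absMeasure, absPotential lam ν x ≠ ⊤) {f : R3 → ℝ≥0∞} (hf : Measurable f) :
    W.lintegralAbs f ≤ ∫⁻ x, absPotential lam ν x * f x ∂V.absMeasure := by
  refine (hW.lintegralAbs_le hf).trans (lintegral_mono_ae ?_)
  filter_upwards [h] with x hx
  exact mul_le_mul' (enorm_potential_le hx) le_rfl

theorem lintegral_absPotential_mul (f : R3 → ℝ≥0∞) (hf : Measurable f) :
    ∫⁻ x, absPotential lam ν x * f x ∂V.absMeasure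
      = ∫⁻ y, ∫⁻ x, ‖freeKernel lam (x - y)‖ₑ * f x ∂V.absMeasure ∂ν.absMeasure := by
  have h1 : Measurable fun p : R3 × R3 => ‖freeKernel lam (p.1 - p.2)‖ₑ * f p.1 :=
    (measurable_freeKernel_sub lam).enorm.mul (hf.comp measurable_fst)
  rw [← lintegral_lintegral_swap h1.aemeasurable]
  refine lintegral_congr fun x => ?_
  exact (lintegral_mul_const _ ((measurable_freeKernel lam).comp
    (measurable_const.sub measurable_id)).enorm).symm

theorem lintegral_absPotential_le (V ν : LocMeasure) (lam : ℂ) :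
    ∫⁻ x, absPotential lam ν x ∂V.absMeasure
      ≤ ENNReal.ofReal (4 * Real.pi)⁻¹ * yukawaNorm V (sqrtNeg lam).re
        * ν.absMeasure Set.univ := by
  have h := lintegral_absPotential_mul (V := V) (ν := ν) (lam := lam) 1 measurable_const
  simp only [Pi.one_apply, mul_one] at h
  rw [h, ← setLIntegral_const, Measure.restrict_univ]
  refine lintegral_mono fun y => ?_
  calc ∫⁻ x, ‖freeKernel lam (x - y)‖ₑ ∂V.absMeasure
      ≤ ∫⁻ x, ENNReal.ofReal (4 * Real.pi)⁻¹ * yukawa (sqrtNeg lam).re (x - y) ∂V.absMeasure :=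
        lintegral_mono fun x => enorm_freeKernel_le lam _
    _ ≤ _ := by
        rw [lintegral_const_mul _ (measurable_yukawa_sub _ y)]
        exact mul_le_mul' le_rfl (lintegral_yukawa_le V _ y)

/-- After Tonelli and the extraction of 1/|y - z|, the integrals over x are bounded uniformly in y
and z, and the integral over y is at most the Kato norm of ν. -/
theorem lintegral_absPotential_mul_inv_le (V ν : LocMeasure) {lam : ℂ}
    (ha : 0 ≤ (sqrtNeg lam).re) (z : R3) :
    ∫⁻ x, absPotential lam ν x * ‖x - z‖ₑ⁻¹ ∂V.absMeasure
      ≤ ENNReal.ofReal (4 * Real.pi)⁻¹ * (3 * yukawaNorm V (sqrtNeg lam).re) * katoENorm ν := by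
  set a := (sqrtNeg lam).re
  have hm := measurable_yukawa_sub a
  have hm2 : ∀ y : R3, Measurable fun x => 2 * yukawa a (x - y) + yukawa a (x - z) := fun y =>
    ((hm y).const_mul 2).add (hm z)
  rw [lintegral_absPotential_mul (fun x => ‖x - z‖ₑ⁻¹) (by fun_prop)]
  calc ∫⁻ y, ∫⁻ x, ‖freeKernel lam (x - y)‖ₑ * ‖x - z‖ₑ⁻¹ ∂V.absMeasure ∂ν.absMeasure
      ≤ ∫⁻ y, ENNReal.ofReal (4 * Real.pi)⁻¹ * (3 * yukawaNorm V a) * ‖y - z‖ₑ⁻¹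
          ∂ν.absMeasure := by
        refine lintegral_mono fun y => ?_
        calc ∫⁻ x, ‖freeKernel lam (x - y)‖ₑ * ‖x - z‖ₑ⁻¹ ∂V.absMeasure
            ≤ ∫⁻ x, ENNReal.ofReal (4 * Real.pi)⁻¹ * (‖y - z‖ₑ⁻¹
                * (2 * yukawa a (x - y) + yukawa a (x - z))) ∂V.absMeasure := by
              refine lintegral_mono fun x => ?_
              refine (mul_le_mul' (enorm_freeKernel_le lam _) le_rfl).trans ?_
              rw [mul_assoc]
              exact mul_le_mul' le_rfl (yukawa_mul_inv_enorm_le ha x y z)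
          _ = ENNReal.ofReal (4 * Real.pi)⁻¹ * (‖y - z‖ₑ⁻¹
                * (2 * ∫⁻ x, yukawa a (x - y) ∂V.absMeasure
                  + ∫⁻ x, yukawa a (x - z) ∂V.absMeasure)) := by
              rw [lintegral_const_mul _ ((hm2 y).const_mul _),
                lintegral_const_mul _ (hm2 y),
                lintegral_add_left ((hm y).const_mul _), lintegral_const_mul _ (hm y)]
          _ ≤ ENNReal.ofReal (4 * Real.pi)⁻¹ * (‖y - z‖ₑ⁻¹
                * (2 * yukawaNorm V a + yukawaNorm V a)) := by
              gcongr <;> exact lintegral_yukawa_le V a _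
          _ = _ := by ring
    _ ≤ _ := by
        rw [lintegral_const_mul _ (by fun_prop)]
        exact mul_le_mul' le_rfl (lintegral_inv_enorm_sub_le ν z)

theorem ae_absPotential_ne_top_of_mul {z : R3}
    (h : ∫⁻ x, absPotential lam ν x * ‖x - z‖ₑ⁻¹ ∂V.absMeasure ≠ ⊤) :
    ∀ᵐ x ∂V.absMeasure, absPotential lam ν x ≠ ⊤ := by
  filter_upwards [ae_lt_top ((measurable_absPotential lam ν).mul
    (by fun_prop : Measurable fun x : R3 => ‖x - z‖ₑ⁻¹)) h] with x hx htop
  rw [Pi.mul_apply, htop, ENNReal.top_mul (by simp)] at hx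
  exact lt_irrefl _ hx

/-- On B(0, n) one has 1 ≤ n/|x|, so integrals with the Kato weight centred at 0 control integrals
over bounded sets. -/
theorem lintegral_variation_le_mul (V : LocMeasure) (n : ℕ) (f : R3 → ℝ≥0∞) :
    ∫⁻ x, f x ∂(V.1 n).variation ≤ n * ∫⁻ x, f x * ‖x‖ₑ⁻¹ ∂V.absMeasure := by
  rw [← absMeasure_restrict, ← lintegral_const_mul' _ _ (by simp)]
  refine (setLIntegral_mono_ae' measurableSet_ball (Eventually.of_forall fun x hx => ?_)).trans
    (setLIntegral_le_lintegral (Metric.ball (0 : R3) (n : ℝ)) _)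
  rw [mem_ball_zero_iff] at hx
  have h1 : 1 ≤ (n : ℝ≥0∞) * ‖x‖ₑ⁻¹ := by
    rw [← div_eq_mul_inv]
    refine (ENNReal.le_div_iff_mul_le (Or.inr (by exact_mod_cast
      ((norm_nonneg x).trans_lt hx).ne')) (Or.inl (by simp))).2 ?_
    rw [one_mul, ← ofReal_norm]
    exact (ENNReal.ofReal_le_ofReal hx.le).trans (by simp)
  calc f x = f x * 1 := (mul_one _).symm
    _ ≤ f x * (n * ‖x‖ₑ⁻¹) := mul_le_mul' le_rfl h1
    _ = _ := by ring

end LocMeasure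

/-! ### Completeness -/

/-- The setwise sums converge absolutely, and countable additivity follows by exchanging two
absolutely convergent sums. -/
theorem exists_hasSum_complexMeasure {u : ℕ → ComplexMeasure R3}
    (hu : ∑' n, (u n).variation Set.univ ≠ ⊤) :
    ∃ S : ComplexMeasure R3, ∀ s, HasSum (fun n => u n s) (S s) := by
  have hle : ∀ s, ∑' n, ‖u n s‖ₑ ≤ ∑' n, (u n).variation Set.univ := fun s =>
    ENNReal.tsum_le_tsum fun n => (VectorMeasure.enorm_measure_le_variation (u n) s).trans
      (measure_mono (Set.subset_univ s))
  have hs : ∀ s, HasSum (fun n => u n s) (∑' n, u n s) := fun s =>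
    (Summable.of_enorm (ne_top_of_le_ne_top hu (hle s))).hasSum
  refine ⟨⟨fun s => ∑' n, u n s, by simp, fun s h => by simp [VectorMeasure.not_measurable _ h],
    fun f hf hd => ?_⟩, hs⟩
  have h1 : ∑' n, ∑' i, ‖u n (f i)‖ₑ ≤ ∑' n, (u n).variation Set.univ :=
    ENNReal.tsum_le_tsum fun n => by
      refine (ENNReal.tsum_le_tsum fun i =>
        VectorMeasure.enorm_measure_le_variation (u n) (f i)).trans ?_
      rw [← measure_iUnion hd hf]
      exact measure_mono (Set.subset_univ _)
  have h2 : Summable fun p : ℕ × ℕ => u p.1 (f p.2) := by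
    refine Summable.of_enorm ?_
    rw [ENNReal.tsum_prod']
    exact ne_top_of_le_ne_top hu h1
  have h3 := h2.hasSum.prod_fiberwise fun n => (u n).m_iUnion hf hd
  have h4 : HasSum (fun p : ℕ × ℕ => u p.2 (f p.1)) (∑' p : ℕ × ℕ, u p.1 (f p.2)) :=
    (Equiv.prodComm ℕ ℕ).hasSum_iff.2 h2.hasSum
  have h5 := h4.prod_fiberwise fun i => hs (f i)
  rwa [← h3.tsum_eq] at h5

/-- The difference is minus the tail of the series on every set, so its variation is bounded by the
tail of the variations. This gives convergence in norm in both completeness proofs. -/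
theorem variation_le_tsum_of_hasSum {u : ℕ → ComplexMeasure R3} {S T : ComplexMeasure R3} {N : ℕ}
    (hS : ∀ s, HasSum (fun n => u n s) (S s)) (hT : ∀ s, T s = ∑ n ∈ Finset.range N, u n s - S s) :
    T.variation ≤ Measure.sum fun n => (u (n + N)).variation := by
  refine VectorMeasure.variation_le_of_forall_enorm_le fun s hs => ?_
  rw [Measure.sum_apply _ hs, hT, ← (hS s).summable.sum_add_tsum_nat_add N |>.trans (hS s).tsum_eq,
    sub_add_cancel_left, enorm_neg]
  exact enorm_tsum_le_tsum_enorm.trans (ENNReal.tsum_le_tsum fun n =>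
    VectorMeasure.enorm_measure_le_variation _ _)

theorem FinMeasure.variation_univ (μ : FinMeasure) :
    μ.toComplexMeasure.variation Set.univ = ENNReal.ofReal ‖μ‖ := by
  have := isFiniteMeasure_variation μ.toComplexMeasure
  exact (ENNReal.ofReal_toReal (measure_ne_top _ _)).symm

/-- Evaluation of finite measures on a set. -/
noncomputable def FinMeasure.eval (s : Set R3) : FinMeasure →+ ℂ where
  toFun μ := μ.toComplexMeasure s
  map_zero' := rfl
  map_add' _ _ := rfl

theorem tendsto_of_ofReal_norm_le {X : Type*} [NormedAddCommGroup X] {v : ℕ → X} {a : X}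
    {r : ℕ → ℝ} (hr : Summable r)
    (h : ∀ N, ENNReal.ofReal ‖v N - a‖ ≤ ∑' n, ENNReal.ofReal (r (n + N))) :
    Tendsto v atTop (𝓝 a) := by
  rw [tendsto_iff_edist_tendsto_0]
  refine tendsto_of_tendsto_of_tendsto_of_le_of_le tendsto_const_nhds
    (ENNReal.tendsto_sum_nat_add (fun n => ENNReal.ofReal (r n)) hr.tsum_ofReal_ne_top)
    (fun _ => zero_le) fun N => ?_
  rw [edist_dist, dist_eq_norm]
  exact h N

instance : CompleteSpace FinMeasure := by
  refine NormedAddCommGroup.completeSpace_of_summable_imp_tendsto fun u hu => ?_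
  have hu' : ∑' n, (u n).toComplexMeasure.variation Set.univ ≠ ⊤ := by
    simp only [FinMeasure.variation_univ]
    exact hu.tsum_ofReal_ne_top
  obtain ⟨S, hS⟩ := exists_hasSum_complexMeasure hu'
  let a : FinMeasure := S
  refine ⟨a, tendsto_of_ofReal_norm_le hu fun N => ?_⟩
  rw [← FinMeasure.variation_univ]
  have h := variation_le_tsum_of_hasSum (N := N)
    (T := (∑ n ∈ Finset.range N, u n - a : FinMeasure).toComplexMeasure) hS fun s => by
      change FinMeasure.eval s (∑ n ∈ Finset.range N, u n - a) = _
      rw [map_sub, map_sum]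
      rfl
  refine (h Set.univ).trans (le_of_eq ?_)
  rw [Measure.sum_apply _ MeasurableSet.univ]
  simp only [FinMeasure.variation_univ]

/-- Evaluation of the elements of the Kato class on the part of a set in a ball. -/
noncomputable def KatoClass.eval (m : ℕ) (s : Set R3) : KatoClass →+ ℂ where
  toFun V := V.toLoc.1 m s
  map_zero' := rfl
  map_add' _ _ := rfl

theorem LocMeasure.variation_univ_le (V : LocMeasure) (n : ℕ) :
    (V.1 n).variation Set.univ ≤ n * katoENorm V := by
  have h := V.lintegral_variation_le_mul n 1
  have h0 := lintegral_inv_enorm_sub_le V 0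
  simp only [Pi.one_apply, lintegral_one, one_mul] at h
  simp only [sub_zero] at h0
  exact h.trans (mul_le_mul' le_rfl h0)

instance : CompleteSpace KatoClass := by
  refine NormedAddCommGroup.completeSpace_of_summable_imp_tendsto fun u hu => ?_
  have hsum : ∑' n, katoENorm (u n).toLoc ≠ ⊤ := by
    simp only [KatoClass.katoENorm_eq]
    exact hu.tsum_ofReal_ne_top
  -- The Kato norm dominates the variation on each ball, so the series can be summed ball by ball
  -- and the sums are compatible.
  have hu' : ∀ m, ∑' n, ((u n).toLoc.1 m).variation Set.univ ≠ ⊤ := fun m => by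
    refine ne_top_of_le_ne_top (ENNReal.mul_ne_top (ENNReal.natCast_ne_top m) hsum) ?_
    rw [← ENNReal.tsum_mul_left]
    exact ENNReal.tsum_le_tsum fun n => (u n).toLoc.variation_univ_le m
  choose S hS using fun m => exists_hasSum_complexMeasure (hu' m)
  let L : LocMeasure := ⟨S, fun m n hmn => by
    ext s hs
    rw [VectorMeasure.restrict_apply _ measurableSet_ball hs]
    refine (hS n _).unique ((hS m s).congr_fun fun k => ?_)
    have h1 : ((u k).toLoc.1 n).restrict (Metric.ball (0 : R3) (m : ℝ)) = (u k).toLoc.1 m :=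
      (u k).toLoc.2 m n hmn
    rw [← h1, VectorMeasure.restrict_apply _ measurableSet_ball hs]⟩
  have hK : ∀ (N : ℕ) (D : LocMeasure),
      (∀ m s, D.1 m s = ∑ n ∈ Finset.range N, (u n).toLoc.1 m s - L.1 m s) →
      katoENorm D ≤ ∑' n, katoENorm (u (n + N)).toLoc := fun N D hD => by
    refine iSup_le fun y => iSup_le fun m => ?_
    refine (lintegral_mono' (variation_le_tsum_of_hasSum (hS m) (hD m)) le_rfl).trans ?_
    rw [lintegral_sum_measure]
    refine ENNReal.tsum_le_tsum fun n => ?_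
    exact (le_iSup (fun m => ∫⁻ x, ‖x - y‖ₑ⁻¹ ∂((u (n + N)).toLoc.1 m).variation) m).trans
      (le_iSup (fun y => (u (n + N)).toLoc.lintegralAbs fun x => ‖x - y‖ₑ⁻¹) y)
  have hL : katoENorm L ≠ ⊤ := by
    -- The case N = 0 of the tail estimate shows that the sum itself has finite Kato norm.
    have h1 := hK 0 (-L) fun m s => by
      rw [Finset.sum_range_zero, zero_sub]
      rfl
    have h2 : katoENorm L = katoENorm (-L) := by
      have := katoENorm_smul (-1) L
      rw [neg_one_smul] at this
      simpa using this.symm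
    rw [h2]
    exact ne_top_of_le_ne_top hsum h1
  let a : KatoClass := ⟨L, hL⟩
  refine ⟨a, tendsto_of_ofReal_norm_le hu fun N => ?_⟩
  rw [← KatoClass.katoENorm_eq]
  refine (hK N _ fun m s => ?_).trans (le_of_eq ?_)
  · change KatoClass.eval m s (∑ n ∈ Finset.range N, u n - a) = _
    rw [map_sub, map_sum]
    rfl
  · simp only [KatoClass.katoENorm_eq]

/-! ### The Kato–Birman operators -/

theorem isBornInvertible_of_norm_lt_one {X : Type*} [NormedAddCommGroup X] [NormedSpace ℂ X]
    [CompleteSpace X] {A : X →L[ℂ] X} (hA : ‖A‖ < 1) : IsBornInvertible A := by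
  have hA' : ‖-A‖ < 1 := by rwa [norm_neg]
  have hs := summable_geometric_of_norm_lt_one hA'
  refine ⟨hA, ∑' n : ℕ, (-A) ^ n, ?_, ?_, hs.hasSum⟩
  · have := mul_neg_geom_series (-A) hA'
    rwa [sub_neg_eq_add] at this
  · have := geom_series_mul_neg (-A) hA'
    rwa [sub_neg_eq_add] at this

/-- A linear map with the estimate `‖A x‖ ≤ C ‖x‖`, given pointwise by a relation that determines
the values and is compatible with the operations. -/
theorem exists_continuousLinearMap_of_forall_exists {X : Type*} [NormedAddCommGroup X]
    [NormedSpace ℂ X] {P : X → X → Prop} {C : ℝ}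
    (hex : ∀ x, ∃ y, P x y ∧ ‖y‖ ≤ C * ‖x‖) (huniq : ∀ x y y', P x y → P x y' → y = y')
    (hadd : ∀ x x' y y', P x y → P x' y' → P (x + x') (y + y'))
    (hsmul : ∀ (c : ℂ) x y, P x y → P (c • x) (c • y)) (hC : 0 ≤ C) :
    ∃ A : X →L[ℂ] X, (∀ x, P x (A x)) ∧ ‖A‖ ≤ C := by
  choose f hf hfC using hex
  let A : X →ₗ[ℂ] X :=
    { toFun := f
      map_add' := fun x x' => huniq _ _ _ (hf _) (hadd _ _ _ _ (hf x) (hf x'))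
      map_smul' := fun c x => huniq _ _ _ (hf _) (hsmul c _ _ (hf x)) }
  exact ⟨A.mkContinuous C hfC, hf, A.mkContinuous_norm_le hC hfC⟩

namespace LocMeasure

theorem ofComplexMeasure_add (μ μ' : ComplexMeasure R3) :
    ofComplexMeasure (μ + μ') = ofComplexMeasure μ + ofComplexMeasure μ' :=
  Subtype.ext (funext fun _ => VectorMeasure.restrict_add _ _ _)

theorem ofComplexMeasure_smul (c : ℂ) (μ : ComplexMeasure R3) :
    ofComplexMeasure (c • μ) = c • ofComplexMeasure μ :=
  Subtype.ext (funext fun _ => VectorMeasure.restrict_smul _)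

theorem ofComplexMeasure_injective : Function.Injective ofComplexMeasure := fun μ μ' h => by
  have h0 : ofComplexMeasure (μ + (-1 : ℂ) • μ') = 0 := by
    rw [ofComplexMeasure_add, ofComplexMeasure_smul, h, neg_one_smul, add_neg_cancel]
  have h1 := absMeasure_ofComplexMeasure (μ + (-1 : ℂ) • μ')
  have h2 : (0 : LocMeasure).absMeasure = 0 := by
    have := absMeasure_smul_le 0 0
    rw [enorm_zero, zero_smul, zero_smul] at this
    exact le_antisymm this (Measure.zero_le _)
  rw [h0, h2] at h1
  have h3 := VectorMeasure.variation_eq_zero.1 h1.symm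
  have h4 : (-1 : ℂ) • μ' = -μ' := neg_one_smul ℂ μ'
  rwa [h4, ← sub_eq_add_neg, sub_eq_zero] at h3

variable {V W W' ν ν' : LocMeasure} {lam : ℂ}

theorem IsProduct.potential_add (hW : IsProduct (potential lam ν) V W)
    (hW' : IsProduct (potential lam ν') V W')
    (h : ∀ᵐ x ∂V.absMeasure, absPotential lam ν x ≠ ⊤)
    (h' : ∀ᵐ x ∂V.absMeasure, absPotential lam ν' x ≠ ⊤) :
    IsProduct (potential lam (ν + ν')) V (W + W') := by
  refine (hW.add hW').congr ?_
  filter_upwards [h, h'] with x hx hx'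
  exact (LocMeasure.potential_add hx hx').symm

theorem IsProduct.potential_smul (c : ℂ) (hW : IsProduct (potential lam ν) V W)
    (h : ∀ᵐ x ∂V.absMeasure, absPotential lam ν x ≠ ⊤) :
    IsProduct (potential lam (c • ν)) V (c • W) := by
  refine (hW.smul c).congr ?_
  filter_upwards [h] with x hx
  exact (LocMeasure.potential_smul c hx).symm

end LocMeasure

open LocMeasure

theorem exists_isKatoBirmanKato {V : LocMeasure} {lam : ℂ} (ha : 0 ≤ (sqrtNeg lam).re)
    (hV : yukawaNorm V (sqrtNeg lam).re ≤ 1) :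
    ∃ A : KatoClass →L[ℂ] KatoClass, IsKatoBirmanKato V lam A ∧ ‖A‖ ≤ (4 * Real.pi)⁻¹ * 3 := by
  have hpi : 0 ≤ (4 * Real.pi)⁻¹ * 3 := by positivity
  have hbound : ∀ (ν : KatoClass) (z : R3),
      ∫⁻ x, absPotential lam ν.toLoc x * ‖x - z‖ₑ⁻¹ ∂V.absMeasure
        ≤ ENNReal.ofReal ((4 * Real.pi)⁻¹ * 3 * ‖ν‖) := fun ν z => by
    refine (lintegral_absPotential_mul_inv_le V ν.toLoc ha z).trans ?_
    rw [KatoClass.katoENorm_eq, ENNReal.ofReal_mul hpi, ENNReal.ofReal_mul (by positivity)]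
    gcongr
    calc 3 * yukawaNorm V (sqrtNeg lam).re ≤ 3 * 1 := by gcongr
      _ = ENNReal.ofReal 3 := by simp
  -- Finiteness |V|-almost everywhere is what makes the potential linear in ν and the product with V
  -- well defined.
  have hae : ∀ ν : KatoClass, ∀ᵐ x ∂V.absMeasure, absPotential lam ν.toLoc x ≠ ⊤ := fun ν =>
    ae_absPotential_ne_top_of_mul
      (ne_top_of_le_ne_top ENNReal.ofReal_ne_top (hbound ν 0))
  refine exists_continuousLinearMap_of_forall_exists
    (P := fun ν W : KatoClass => IsProduct (potential lam ν.toLoc) V W.toLoc) (fun ν => ?_)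
    (fun ν W W' h h' => Subtype.ext (h.unique h'))
    (fun ν ν' W W' h h' => h.potential_add h' (hae ν) (hae ν'))
    (fun c ν W h => h.potential_smul c (hae ν)) hpi
  obtain ⟨W, hW⟩ := exists_isProduct_potential (V := V) (ν := ν.toLoc) (lam := lam) fun n => by
    refine ne_top_of_le_ne_top (ENNReal.mul_ne_top (ENNReal.natCast_ne_top n) ?_)
      (lintegral_variation_le_mul V n _)
    have := hbound ν 0
    simp only [sub_zero] at this
    exact ne_top_of_le_ne_top ENNReal.ofReal_ne_top this
  have hle : katoENorm W ≤ ENNReal.ofReal ((4 * Real.pi)⁻¹ * 3 * ‖ν‖) := iSup_le fun z =>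
    (hW.lintegralAbs_potential_le (hae ν) (by fun_prop)).trans (hbound ν z)
  refine ⟨⟨W, ne_top_of_le_ne_top ENNReal.ofReal_ne_top hle⟩, hW, ?_⟩
  exact ENNReal.toReal_le_of_le_ofReal (by positivity) hle

theorem exists_isKatoBirmanFin {V : LocMeasure} {lam : ℂ}
    (hV : yukawaNorm V (sqrtNeg lam).re ≤ 1) :
    ∃ A : FinMeasure →L[ℂ] FinMeasure, IsKatoBirmanFin V lam A ∧ ‖A‖ ≤ (4 * Real.pi)⁻¹ := by
  have hpi : 0 ≤ (4 * Real.pi)⁻¹ := by positivity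
  have hbound : ∀ μ : FinMeasure,
      ∫⁻ x, absPotential lam (ofComplexMeasure μ.toComplexMeasure) x ∂V.absMeasure
        ≤ ENNReal.ofReal ((4 * Real.pi)⁻¹ * ‖μ‖) := fun μ => by
    refine (lintegral_absPotential_le V _ lam).trans ?_
    rw [absMeasure_ofComplexMeasure, FinMeasure.variation_univ, ENNReal.ofReal_mul hpi]
    gcongr
    exact mul_le_of_le_one_right' hV
  have hae : ∀ μ : FinMeasure, ∀ᵐ x ∂V.absMeasure,
      absPotential lam (ofComplexMeasure μ.toComplexMeasure) x ≠ ⊤ := fun μ => by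
    filter_upwards [ae_lt_top (measurable_absPotential lam _)
      (ne_top_of_le_ne_top ENNReal.ofReal_ne_top (hbound μ))] with x hx using hx.ne
  suffices h : ∃ A : FinMeasure →L[ℂ] FinMeasure,
      (∀ μ, IsProduct (potential lam (ofComplexMeasure μ.toComplexMeasure)) V
        (ofComplexMeasure (A μ).toComplexMeasure)) ∧ ‖A‖ ≤ (4 * Real.pi)⁻¹ by
    obtain ⟨A, hA, hnorm⟩ := h
    refine ⟨A, fun μ => (hA μ).congr ?_, hnorm⟩
    filter_upwards [hae μ] with x hx
    refine integral_ofComplexMeasure ?_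
    have hi := integrable_freeKernel hx
    rwa [absMeasure_ofComplexMeasure] at hi
  refine exists_continuousLinearMap_of_forall_exists
    (P := fun μ W : FinMeasure => IsProduct (potential lam (ofComplexMeasure μ.toComplexMeasure)) V
      (ofComplexMeasure W.toComplexMeasure)) (fun μ => ?_)
    (fun μ W W' h h' => ofComplexMeasure_injective (h.unique h'))
    (fun μ μ' W W' h h' => ?_) (fun c μ W h => ?_) hpi
  · obtain ⟨W, hW⟩ := exists_isProduct_potential (V := V) (lam := lam)
      (ν := ofComplexMeasure μ.toComplexMeasure) fun n => by
        refine ne_top_of_le_ne_top ENNReal.ofReal_ne_top ((lintegral_mono' ?_ le_rfl).trans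
          (hbound μ))
        rw [← absMeasure_restrict]
        exact Measure.restrict_le_self
    have hle : W.absMeasure Set.univ ≤ ENNReal.ofReal ((4 * Real.pi)⁻¹ * ‖μ‖) := by
      have h1 := hW.lintegralAbs_potential_le (hae μ) (f := 1) measurable_const
      simp only [Pi.one_apply, mul_one, lintegralAbs_eq, lintegral_one] at h1
      exact h1.trans (hbound μ)
    -- The product is constructed as a locally finite measure; its total variation is finite by the
    -- estimate, so it comes from an element of ℳ.
    obtain ⟨c, rfl⟩ := exists_ofComplexMeasure_eq (ne_top_of_le_ne_top ENNReal.ofReal_ne_top hle)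
    rw [absMeasure_ofComplexMeasure] at hle
    exact ⟨c, hW, ENNReal.toReal_le_of_le_ofReal (by positivity) hle⟩
  · have h1 := h.potential_add h' (hae μ) (hae μ')
    rwa [← ofComplexMeasure_add, ← ofComplexMeasure_add] at h1
  · have h1 := h.potential_smul c (hae μ)
    rwa [← ofComplexMeasure_smul, ← ofComplexMeasure_smul] at h1

theorem inv_four_pi_mul_three_lt_one : (4 * Real.pi)⁻¹ * 3 < 1 := by
  rw [inv_mul_lt_iff₀ (by positivity)]
  linarith [Real.pi_gt_three]

theorem exists_bornInvertible_katoBirman (V : KatoClass) (hV : HasLocalKatoProperty V.toLoc) :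
    ∃ a₀ : ℝ, 0 ≤ a₀ ∧ ∀ lam : ℂ, a₀ < (sqrtNeg lam).re →
      (∃ A : FinMeasure →L[ℂ] FinMeasure,
        IsKatoBirmanFin V.toLoc lam A ∧ IsBornInvertible A) ∧
      (∃ A : KatoClass →L[ℂ] KatoClass,
        IsKatoBirmanKato V.toLoc lam A ∧ IsBornInvertible A) := by
  -- The threshold 1 suffices, as the factors 1/(4π) and 3/(4π) are already below 1. Monotonicity in
  -- a extends the bound to all larger values.
  obtain ⟨a₀, ha, ha0⟩ := ((ENNReal.tendsto_nhds_zero.1 (tendsto_yukawaNorm V.2 hV) 1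
    one_pos).and (eventually_ge_atTop 0)).exists
  refine ⟨a₀, ha0, fun lam hlam => ?_⟩
  have hle := (yukawaNorm_anti V.toLoc hlam.le).trans ha
  obtain ⟨A, hA, hAn⟩ := exists_isKatoBirmanFin hle
  obtain ⟨B, hB, hBn⟩ := exists_isKatoBirmanKato (ha0.trans hlam.le) hle
  have hpi : 0 < (4 * Real.pi)⁻¹ := by positivity
  exact ⟨⟨A, hA, isBornInvertible_of_norm_lt_one
    (by linarith [inv_four_pi_mul_three_lt_one])⟩, ⟨B, hB, isBornInvertible_of_norm_lt_one
    (hBn.trans_lt inv_four_pi_mul_three_lt_one)⟩⟩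

end KatoSchrodinger

theorem propositionB5 (V : KatoClass) (hreal : V.toLoc.IsReal)
    (hV : HasLocalKatoProperty V.toLoc ∨ V ∈ kato₀ ∨ V ∈ kato₁) :
    ((hamiltonian V.toLoc).graph = hamiltonianGraph V.toLoc ∧
      ∃ c : ℝ, ∀ z ∈ operatorSpectrum (hamiltonian V.toLoc), z.im = 0 ∧ c ≤ z.re) ∧
    ∃ a₀ : ℝ, 0 ≤ a₀ ∧ ∀ lam : ℂ, a₀ < (sqrtNeg lam).re →
      (∃ A : FinMeasure →L[ℂ] FinMeasure,
        IsKatoBirmanFin V.toLoc lam A ∧ IsBornInvertible A) ∧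
      (∃ A : KatoClass →L[ℂ] KatoClass,
        IsKatoBirmanKato V.toLoc lam A ∧ IsBornInvertible A) := by
  -- Every alternative reduces to the local Kato property: for 𝒦₀ by approximation with test
  -- functions, for 𝒦₁ by definition.
  have hloc : HasLocalKatoProperty V.toLoc := by
    rcases hV with h | h | h
    · exact h
    · exact hasLocalKatoProperty_of_mem_kato₀ h
    · exact h.1
  exact ⟨hamiltonian_spec V hreal hloc, exists_bornInvertible_katoBirman V hloc⟩
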